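/- Let $\mathbb R^d_+=(0,\infty)^d$, $d\ge 1$. Let $\mathcal S(\mathbb R^d_+)$ be the space of all complex-valued $f\in C^\infty(\mathbb R^d_+)$ such that every derivative $\partial^p f$, $p\in\mathbb N_0^d$, extends continuously to $[0,\infty)^d$ and $\sup_{x\in\mathbb R^d_+}x^k|\partial^p f(x)|<\infty$ for all $k,p\in\mathbb N_0^d$. Let $$E=-\sum_{j=1}^d\Big(x_j\frac{\partial^2}{\partial x_j^2}+\frac{\partial}{\partial x_j}-\frac{x_j}{4}+\frac12\Big)$$ be the Laguerre operator. For $\alpha>0$ and $h>0$ let $\mathbf G^{\alpha,h}_{\alpha,h}(\mathbb R^d_+)$ be the space of all $f\in\mathcal S(\mathbb R^d_+)$ with $$\eta^\alpha_h(f)=\sup_{N\in\mathbb N_0}\frac{\|E^Nf\|_{L^2(\mathbb R^d_+)}}{h^N\,N!^{\alpha}}<\infty,$$ normed by $\eta^\alpha_h$. Put $$\mathbf G^\alpha_\alpha(\mathbb R^d_+)=\bigcup_{h>0}\mathbf G^{\alpha,h}_{\alpha,h}(\mathbb R^d_+),\qquad \mathbf g^\alpha_\alpha(\mathbb R^d_+)=\bigcap_{h>0}\mathbf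 G^{\alpha,h}_{\alpha,h}(\mathbb R^d_+),$$ with the locally convex inductive limit topology and the projective limit topology, respectively. Let $(\mathbf G^\alpha_\alpha)'(\mathbb R^d_+)$ and $(\mathbf g^\alpha_\alpha)'(\mathbb R^d_+)$ be their strong duals. Let $V\hat\otimes W$ denote the (Hausdorff) completion of $V\otimes W$ in the projective topology, i.e. the finest locally convex topology for which $(v,w)\mapsto v\otimes w$ is continuous. **Theorem.** Let $\alpha>0$ and $d_1,d_2\ge1$. There are topological (linear) isomorphisms $$\mathbf G^\alpha_\alpha(\mathbb R^{d_1}_+)\hat\otimes\mathbf G^\alpha_\alpha(\mathbb R^{d_2}_+)\cong\mathbf G^\alpha_\alpha(\mathbb R^{d_1+d_2}_+),\qquad (\mathbf G^\alpha_\alpha)'(\mathbb R^{d_1}_+)\hat\otimes(\mathbf G^\alpha_\alpha)'(\mathbb R^{d_2}_+)\cong(\mathbf G^\alpha_\alpha)'(\mathbb R^{d_1+d_2}_+),$$ $$\mathbf g^\alpha_\alpha(\mathbb R^{d_1}_+)\hat\otimes\mathbf g^\alpha_\alpha(\mathbb R^{d_2}_+)\cong\mathbf g^\alpha_\alpha(\mathbb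 R^{d_1+d_2}_+),\qquad (\mathbf g^\alpha_\alpha)'(\mathbb R^{d_1}_+)\hat\otimes(\mathbf g^\alpha_\alpha)'(\mathbb R^{d_2}_+)\cong(\mathbf g^\alpha_\alpha)'(\mathbb R^{d_1+d_2}_+),$$ which are the canonical ones: for functions, $f\otimes g$ is sent to the function $(x,y)\mapsto f(x)g(y)$; for the duals, $u\otimes v$ is sent to a functional whose value at the function $(x,y)\mapsto f(x)g(y)$ is $u(f)\,v(g)$. -/

import Mathlib

open Set MeasureTheory
open scoped ENNReal ContDiff TensorProduct

noncomputable section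

namespace POrthant

/-! ### Functions on the positive orthant

A function on `(0,∞)^d` is represented by its extension by zero to `ℝ^d`; all derivatives
and norms below are only evaluated on the open orthant. -/

/-- The open positive orthant `(0,∞)^d`. -/
def orthant (d : ℕ) : Set (Fin d → ℝ) := {x | ∀ j, 0 < x j}

/-- The closed positive orthant `[0,∞)^d`. -/
def closedOrthant (d : ℕ) : Set (Fin d → ℝ) := {x | ∀ j, 0 ≤ x j}

/-- The partial derivative `∂f/∂x_j`. -/
def partialD {d : ℕ} (j : Fin d) (f : (Fin d → ℝ) → ℂ) : (Fin d → ℝ) → ℂ :=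
  fun x => fderiv ℝ f x (Pi.single j 1)

/-- The iterated partial derivative `∂^p f`, for a multi-index `p`. -/
def multiD {d : ℕ} (p : Fin d → ℕ) (f : (Fin d → ℝ) → ℂ) : (Fin d → ℝ) → ℂ :=
  (List.finRange d).foldr (fun j g => (partialD j)^[p j] g) f

/-- The Laguerre operator `E = -∑_j (x_j ∂_j² + ∂_j - x_j/4 + 1/2)`. -/
def laguerreOp {d : ℕ} (f : (Fin d → ℝ) → ℂ) : (Fin d → ℝ) → ℂ :=
  fun x => -∑ j, ((x j : ℂ) * partialD j (partialD j f) x + partialD j f x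
    - (x j : ℂ) / 4 * f x + 1 / 2 * f x)

/-- `f` is smooth on the open orthant. -/
def IsSmooth {d : ℕ} (f : (Fin d → ℝ) → ℂ) : Prop := ContDiffOn ℝ ∞ f (orthant d)

/-- The quantity `η_h^α(f) = sup_N ‖E^N f‖_{L²} / (h^N (N!)^α)`, in `[0,∞]`. -/
def eta (α h : ℝ) {d : ℕ} (f : (Fin d → ℝ) → ℂ) : ℝ≥0∞ :=
  ⨆ N : ℕ, eLpNorm (laguerreOp^[N] f) 2 (volume.restrict (orthant d)) /
    ENNReal.ofReal (h ^ N * (N.factorial : ℝ) ^ α)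

/-- Membership in `𝒮(ℝ^d_+)`: zero outside the orthant (choice of representative), smooth on the
orthant, every derivative extends continuously to the
closed orthant, and all `x^k ∂^p f` are bounded. -/
structure IsSchwartz {d : ℕ} (f : (Fin d → ℝ) → ℂ) : Prop where
  zero_off : ∀ x, x ∉ orthant d → f x = 0
  smooth : IsSmooth f
  extends_cont : ∀ p : Fin d → ℕ, ∃ g : (Fin d → ℝ) → ℂ,
    ContinuousOn g (closedOrthant d) ∧ EqOn g (multiD p f) (orthant d)
  decay : ∀ k p : Fin d → ℕ, ∃ C : ℝ, ∀ x ∈ orthant d,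
    (∏ j, x j ^ k j) * ‖multiD p f x‖ ≤ C

/-! ### Linearity of the differential operators on the orthant (helper facts) -/

lemma isOpen_orthant (d : ℕ) : IsOpen (orthant d) := by
  have : orthant d = ⋂ j, {x : Fin d → ℝ | 0 < x j} := by ext; simp [orthant]
  rw [this]
  exact isOpen_iInter_of_finite fun j => isOpen_lt continuous_const (continuous_apply j)

/-- An operator which, on functions smooth on the orthant, is local and linear. -/
structure LocLin {d : ℕ} (D : ((Fin d → ℝ) → ℂ) → ((Fin d → ℝ) → ℂ)) : Prop where
  smooth : ∀ f, IsSmooth f → IsSmooth (D f)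
  congr : ∀ f g, EqOn f g (orthant d) → EqOn (D f) (D g) (orthant d)
  add : ∀ f g, IsSmooth f → IsSmooth g → EqOn (D (f + g)) (D f + D g) (orthant d)
  smul : ∀ (c : ℂ) f, IsSmooth f → EqOn (D (c • f)) (c • D f) (orthant d)

lemma IsSmooth.add {d : ℕ} {f g : (Fin d → ℝ) → ℂ} (hf : IsSmooth f) (hg : IsSmooth g) :
    IsSmooth (f + g) := ContDiffOn.add hf hg

lemma IsSmooth.smul {d : ℕ} {f : (Fin d → ℝ) → ℂ} (c : ℂ) (hf : IsSmooth f) :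
    IsSmooth (c • f) := ContDiffOn.const_smul c hf

lemma IsSmooth.differentiableAt {d : ℕ} {f : (Fin d → ℝ) → ℂ} (hf : IsSmooth f)
    {x : Fin d → ℝ} (hx : x ∈ orthant d) : DifferentiableAt ℝ f x :=
  (ContDiffOn.contDiffAt hf ((isOpen_orthant d).mem_nhds hx)).differentiableAt (by simp)

lemma LocLin.id {d : ℕ} : LocLin (d := d) (fun f => f) :=
  ⟨fun _ h => h, fun _ _ h => h, fun _ _ _ _ _ _ => rfl, fun _ _ _ _ _ => rfl⟩

lemma LocLin.comp {d : ℕ} {D D' : ((Fin d → ℝ) → ℂ) → ((Fin d → ℝ) → ℂ)}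
    (h : LocLin D) (h' : LocLin D') : LocLin (fun f => D (D' f)) where
  smooth f hf := h.smooth _ (h'.smooth f hf)
  congr f g e := h.congr _ _ (h'.congr f g e)
  add f g hf hg := (h.congr _ _ (h'.add f g hf hg)).trans
    (h.add _ _ (h'.smooth f hf) (h'.smooth g hg))
  smul c f hf := (h.congr _ _ (h'.smul c f hf)).trans (h.smul c _ (h'.smooth f hf))

lemma LocLin.iterate {d : ℕ} {D : ((Fin d → ℝ) → ℂ) → ((Fin d → ℝ) → ℂ)}
    (h : LocLin D) (n : ℕ) : LocLin (D^[n]) := by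
  induction n with
  | zero => exact LocLin.id
  | succ n ih => simpa [Function.iterate_succ, Function.comp_def] using ih.comp h

lemma locLin_partialD {d : ℕ} (j : Fin d) : LocLin (partialD (d := d) j) where
  smooth f hf := by
    have h1 : ContDiffOn ℝ ∞ (fderiv ℝ f) (orthant d) :=
      ContDiffOn.fderiv_of_isOpen hf (isOpen_orthant d) (by simp)
    exact h1.clm_apply contDiffOn_const
  congr f g e x hx := by
    have : f =ᶠ[nhds x] g := Filter.eventuallyEq_of_mem ((isOpen_orthant d).mem_nhds hx) e
    simp [partialD, this.fderiv_eq]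
  add f g hf hg x hx := by
    simp [partialD, fderiv_add (hf.differentiableAt hx) (hg.differentiableAt hx)]
  smul c f hf x hx := by
    simp [partialD, fderiv_const_smul (hf.differentiableAt hx)]

lemma locLin_multiD {d : ℕ} (p : Fin d → ℕ) : LocLin (multiD (d := d) p) := by
  unfold multiD
  induction List.finRange d with
  | nil => exact LocLin.id
  | cons j l ih => exact ((locLin_partialD j).iterate (p j)).comp ih

lemma isSmooth_coord {d : ℕ} (j : Fin d) : IsSmooth (fun x : Fin d → ℝ => (x j : ℂ)) :=
  (Complex.ofRealCLM.contDiff.comp (contDiff_apply ℝ ℝ j)).contDiffOn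

lemma locLin_laguerreOp {d : ℕ} : LocLin (laguerreOp (d := d)) where
  smooth f hf := by
    refine ContDiffOn.neg (ContDiffOn.sum fun j _ => ?_)
    have h1 := (locLin_partialD j).smooth f hf
    have h2 := (locLin_partialD j).smooth _ h1
    exact (((ContDiffOn.mul (isSmooth_coord j) h2).add h1).sub
      (ContDiffOn.mul ((isSmooth_coord j).div_const 4) hf)).add
      (ContDiffOn.mul contDiffOn_const hf)
  congr f g e x hx := by
    simp only [laguerreOp]
    congr 1
    refine Finset.sum_congr rfl fun j _ => ?_
    have h1 := (locLin_partialD j).congr f g e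
    rw [(locLin_partialD j).congr _ _ h1 hx, h1 hx, e hx]
  add f g hf hg x hx := by
    simp only [laguerreOp, Pi.add_apply]
    rw [← neg_add, ← Finset.sum_add_distrib]
    congr 1
    refine Finset.sum_congr rfl fun j _ => ?_
    have h := locLin_partialD j
    rw [(h.comp h).add f g hf hg hx, h.add f g hf hg hx]
    simp only [Pi.add_apply]
    ring
  smul c f hf x hx := by
    simp only [laguerreOp, Pi.smul_apply, smul_eq_mul]
    rw [mul_neg, Finset.mul_sum]
    congr 1
    refine Finset.sum_congr rfl fun j _ => ?_
    have h := locLin_partialD j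
    rw [(h.comp h).smul c f hf hx, h.smul c f hf hx]
    simp only [Pi.smul_apply, smul_eq_mul]
    ring

lemma IsSchwartz.zero (d : ℕ) : IsSchwartz (0 : (Fin d → ℝ) → ℂ) := by
  have h0 : IsSmooth (0 : (Fin d → ℝ) → ℂ) := contDiffOn_const
  have hz : ∀ p, EqOn (multiD p (0 : (Fin d → ℝ) → ℂ)) 0 (orthant d) := fun p x hx => by
    simpa using (locLin_multiD p).smul 0 0 h0 hx
  exact ⟨fun _ _ => rfl, h0, fun p => ⟨0, continuousOn_const, (hz p).symm⟩,
    fun k p => ⟨0, fun x hx => by simp [hz p hx]⟩⟩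

lemma IsSchwartz.add {d : ℕ} {f g : (Fin d → ℝ) → ℂ} (hf : IsSchwartz f) (hg : IsSchwartz g) :
    IsSchwartz (f + g) where
  zero_off x hx := by simp [hf.zero_off x hx, hg.zero_off x hx]
  smooth := hf.smooth.add hg.smooth
  extends_cont p := by
    obtain ⟨F, hF, eF⟩ := hf.extends_cont p
    obtain ⟨G, hG, eG⟩ := hg.extends_cont p
    refine ⟨F + G, hF.add hG, fun x hx => ?_⟩
    rw [(locLin_multiD p).add f g hf.smooth hg.smooth hx, Pi.add_apply, Pi.add_apply, eF hx, eG hx]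
  decay k p := by
    obtain ⟨A, hA⟩ := hf.decay k p
    obtain ⟨B, hB⟩ := hg.decay k p
    refine ⟨A + B, fun x hx => ?_⟩
    rw [(locLin_multiD p).add f g hf.smooth hg.smooth hx, Pi.add_apply]
    have hk : 0 ≤ ∏ j, x j ^ k j := Finset.prod_nonneg fun j _ => pow_nonneg (hx j).le _
    calc _ ≤ (∏ j, x j ^ k j) * (‖multiD p f x‖ + ‖multiD p g x‖) :=
          mul_le_mul_of_nonneg_left (norm_add_le _ _) hk
      _ ≤ A + B := by rw [mul_add]; exact add_le_add (hA x hx) (hB x hx)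

lemma IsSchwartz.smul {d : ℕ} (c : ℂ) {f : (Fin d → ℝ) → ℂ} (hf : IsSchwartz f) :
    IsSchwartz (c • f) where
  zero_off x hx := by simp [hf.zero_off x hx]
  smooth := hf.smooth.smul c
  extends_cont p := by
    obtain ⟨F, hF, eF⟩ := hf.extends_cont p
    refine ⟨c • F, hF.const_smul c, fun x hx => ?_⟩
    rw [(locLin_multiD p).smul c f hf.smooth hx, Pi.smul_apply, Pi.smul_apply, eF hx]
  decay k p := by
    obtain ⟨A, hA⟩ := hf.decay k p
    refine ⟨‖c‖ * A, fun x hx => ?_⟩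
    rw [(locLin_multiD p).smul c f hf.smooth hx, Pi.smul_apply, norm_smul, mul_left_comm]
    exact mul_le_mul_of_nonneg_left (hA x hx) (norm_nonneg c)

lemma eLpNorm_congr_orthant {d : ℕ} {f g : (Fin d → ℝ) → ℂ} (e : EqOn f g (orthant d)) :
    eLpNorm f 2 (volume.restrict (orthant d)) = eLpNorm g 2 (volume.restrict (orthant d)) :=
  eLpNorm_congr_ae (ae_restrict_of_forall_mem (isOpen_orthant d).measurableSet e)

lemma IsSmooth.aestronglyMeasurable {d : ℕ} {f : (Fin d → ℝ) → ℂ} (hf : IsSmooth f) :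
    AEStronglyMeasurable f (volume.restrict (orthant d)) :=
  (ContDiffOn.continuousOn hf).aestronglyMeasurable (isOpen_orthant d).measurableSet

lemma eta_smul (α h : ℝ) {d : ℕ} (c : ℂ) {f : (Fin d → ℝ) → ℂ} (hf : IsSmooth f) :
    eta α h (c • f) = ‖c‖ₑ * eta α h f := by
  rw [eta, eta, ENNReal.mul_iSup]
  refine iSup_congr fun N => ?_
  rw [eLpNorm_congr_orthant ((locLin_laguerreOp.iterate N).smul c f hf), eLpNorm_const_smul,
    mul_div_assoc]

lemma eta_zero (α h : ℝ) (d : ℕ) : eta α h (0 : (Fin d → ℝ) → ℂ) = 0 := by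
  simpa using eta_smul α h (d := d) 0 (f := 0) contDiffOn_const

lemma eta_add (α h : ℝ) {d : ℕ} {f g : (Fin d → ℝ) → ℂ} (hf : IsSmooth f) (hg : IsSmooth g) :
    eta α h (f + g) ≤ eta α h f + eta α h g := by
  refine iSup_le fun N => ?_
  have hN := (locLin_laguerreOp (d := d)).iterate N
  rw [eLpNorm_congr_orthant (hN.add f g hf hg)]
  refine (ENNReal.div_le_div_right (eLpNorm_add_le (hN.smooth f hf).aestronglyMeasurable
    (hN.smooth g hg).aestronglyMeasurable (by norm_num)) _).trans ?_
  rw [ENNReal.add_div]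
  exact add_le_add (le_iSup (fun N : ℕ => eLpNorm (laguerreOp^[N] f) 2
      (volume.restrict (orthant d)) / ENNReal.ofReal (h ^ N * (N.factorial : ℝ) ^ α)) N)
    (le_iSup (fun N : ℕ => eLpNorm (laguerreOp^[N] g) 2
      (volume.restrict (orthant d)) / ENNReal.ofReal (h ^ N * (N.factorial : ℝ) ^ α)) N)

lemma eta_anti (α : ℝ) {h h' : ℝ} (h0 : 0 < h) (hh : h ≤ h') {d : ℕ} (f : (Fin d → ℝ) → ℂ) :
    eta α h' f ≤ eta α h f := by
  refine iSup_mono fun N => ENNReal.div_le_div_left (ENNReal.ofReal_le_ofReal ?_) _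
  gcongr

lemma eq_zero_of_eta_eq_zero {α h : ℝ} {d : ℕ} {f : (Fin d → ℝ) → ℂ}
    (hf : IsSchwartz f) (h0 : eta α h f = 0) : f = 0 := by
  have h1 : eLpNorm f 2 (volume.restrict (orthant d)) = 0 := by
    have := (iSup_eq_bot.mp h0) 0
    simpa using this
  rw [eLpNorm_eq_zero_iff hf.smooth.aestronglyMeasurable (by norm_num)] at h1
  have h2 : EqOn f 0 (orthant d) :=
    Measure.eqOn_open_of_ae_eq h1 (isOpen_orthant d) (ContDiffOn.continuousOn hf.smooth)
      continuousOn_const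
  funext x
  by_cases hx : x ∈ orthant d
  · exact h2 hx
  · exact hf.zero_off x hx

/-! ### The spaces -/

/-- The space `𝐆^{α,h}_{α,h}(ℝ^d_+)` as a subspace of functions. -/
def stepSubmodule (α h : ℝ) (d : ℕ) : Submodule ℂ ((Fin d → ℝ) → ℂ) where
  carrier := {f | IsSchwartz f ∧ eta α h f < ⊤}
  zero_mem' := ⟨.zero d, by simp [eta_zero]⟩
  add_mem' hf hg := ⟨hf.1.add hg.1,
    (eta_add α h hf.1.smooth hg.1.smooth).trans_lt (ENNReal.add_lt_top.2 ⟨hf.2, hg.2⟩)⟩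
  smul_mem' c f hf := ⟨hf.1.smul c, by
    rw [eta_smul α h c hf.1.smooth]; exact ENNReal.mul_lt_top (by simp) hf.2⟩

/-- The union of the spaces `𝐆^{α,h}_{α,h}(ℝ^d_+)` over `h > 0`. -/
def roumieuSubmodule (α : ℝ) (d : ℕ) : Submodule ℂ ((Fin d → ℝ) → ℂ) where
  carrier := {f | ∃ h : ℝ, 0 < h ∧ f ∈ stepSubmodule α h d}
  zero_mem' := ⟨1, one_pos, Submodule.zero_mem _⟩
  add_mem' := by
    rintro f g ⟨h, h0, hf⟩ ⟨k, k0, hg⟩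
    refine ⟨max h k, lt_max_of_lt_left h0, Submodule.add_mem _ ⟨hf.1, ?_⟩ ⟨hg.1, ?_⟩⟩
    · exact (eta_anti α h0 (le_max_left h k) f).trans_lt hf.2
    · exact (eta_anti α k0 (le_max_right h k) g).trans_lt hg.2
  smul_mem' := by
    rintro c f ⟨h, h0, hf⟩
    exact ⟨h, h0, Submodule.smul_mem _ c hf⟩

/-- The intersection of the spaces `𝐆^{α,h}_{α,h}(ℝ^d_+)` over `h > 0`. -/
def beurlingSubmodule (α : ℝ) (d : ℕ) : Submodule ℂ ((Fin d → ℝ) → ℂ) :=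
  ⨅ h : Ioi (0 : ℝ), stepSubmodule α h d

/-- The normed space `𝐆^{α,h}_{α,h}(ℝ^d_+)`, with norm `η_h^α`. -/
def StepSpace (α h : ℝ) (d : ℕ) : Type := stepSubmodule α h d

instance (α h : ℝ) (d : ℕ) : AddCommGroup (StepSpace α h d) :=
  inferInstanceAs (AddCommGroup (stepSubmodule α h d))

instance (α h : ℝ) (d : ℕ) : Module ℂ (StepSpace α h d) :=
  inferInstanceAs (Module ℂ (stepSubmodule α h d))

/-- `η_h^α` as a norm on `𝐆^{α,h}_{α,h}(ℝ^d_+)`. -/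
def etaNorm (α h : ℝ) (d : ℕ) : AddGroupNorm (StepSpace α h d) where
  toFun f := (eta α h f.1).toReal
  map_zero' := by
    change (eta α h (0 : (Fin d → ℝ) → ℂ)).toReal = 0
    simp [eta_zero]
  add_le' f g := by
    change (eta α h (f.1 + g.1)).toReal ≤ _
    rw [← ENNReal.toReal_add f.2.2.ne g.2.2.ne]
    exact ENNReal.toReal_mono (ENNReal.add_lt_top.2 ⟨f.2.2, g.2.2⟩).ne
      (eta_add α h f.2.1.smooth g.2.1.smooth)
  neg' f := by
    change (eta α h (-f.1)).toReal = _
    rw [← neg_one_smul ℂ f.1, eta_smul α h _ f.2.1.smooth]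
    simp
  eq_zero_of_map_eq_zero' f hf :=
    Subtype.ext (eq_zero_of_eta_eq_zero f.2.1
      (((ENNReal.toReal_eq_zero_iff _).1 hf).resolve_right f.2.2.ne))

instance (α h : ℝ) (d : ℕ) : NormedAddCommGroup (StepSpace α h d) :=
  (etaNorm α h d).toNormedAddCommGroup

/-- The Roumieu space `𝐆^α_α(ℝ^d_+)`. -/
def Roumieu (α : ℝ) (d : ℕ) : Type := roumieuSubmodule α d

/-- The Beurling space `𝐠^α_α(ℝ^d_+)`. -/
def Beurling (α : ℝ) (d : ℕ) : Type := beurlingSubmodule α d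

instance (α : ℝ) (d : ℕ) : AddCommGroup (Roumieu α d) :=
  inferInstanceAs (AddCommGroup (roumieuSubmodule α d))

instance (α : ℝ) (d : ℕ) : Module ℂ (Roumieu α d) :=
  inferInstanceAs (Module ℂ (roumieuSubmodule α d))

instance (α : ℝ) (d : ℕ) : AddCommGroup (Beurling α d) :=
  inferInstanceAs (AddCommGroup (beurlingSubmodule α d))

instance (α : ℝ) (d : ℕ) : Module ℂ (Beurling α d) :=
  inferInstanceAs (Module ℂ (beurlingSubmodule α d))

instance (α : ℝ) (d : ℕ) : CoeFun (Roumieu α d) (fun _ => (Fin d → ℝ) → ℂ) := ⟨fun f => f.1⟩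

instance (α : ℝ) (d : ℕ) : CoeFun (Beurling α d) (fun _ => (Fin d → ℝ) → ℂ) := ⟨fun f => f.1⟩

/-- The inclusion `𝐆^{α,h}_{α,h} → 𝐆^α_α`. -/
def stepToRoumieu (α : ℝ) (d : ℕ) (h : Ioi (0 : ℝ)) : StepSpace α h d →ₗ[ℂ] Roumieu α d :=
  Submodule.inclusion (p := stepSubmodule α h d) (p' := roumieuSubmodule α d)
    fun _ hf => ⟨h, h.2, hf⟩

/-- The inclusion `𝐠^α_α → 𝐆^{α,h}_{α,h}`. -/
def beurlingToStep (α : ℝ) (d : ℕ) (h : Ioi (0 : ℝ)) : Beurling α d →ₗ[ℂ] StepSpace α h d :=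
  Submodule.inclusion (p := beurlingSubmodule α d) (p' := stepSubmodule α h d)
    (iInf_le (fun h : Ioi (0 : ℝ) => stepSubmodule α h d) h)

/-! ### Locally convex topologies -/

/-- `t` is a locally convex vector space topology on the complex vector space `V`. -/
def IsLCTopology (V : Type*) [AddCommGroup V] [Module ℂ V] (t : TopologicalSpace V) : Prop :=
  IsTopologicalAddGroup V ∧ ContinuousSMul ℂ V ∧ LocallyConvexSpace ℝ V

/-- The finest locally convex topology with property `P` (used for properties which say that given
maps into `V` are continuous; these are stable under suprema of topologies, which are infima in
Mathlib's order). -/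
@[reducible] def finestLC (V : Type*) [AddCommGroup V] [Module ℂ V] (P : TopologicalSpace V → Prop) :
    TopologicalSpace V :=
  sInf {t | IsLCTopology V t ∧ P t}

lemma isLCTopology_finestLC (V : Type*) [AddCommGroup V] [Module ℂ V]
    (P : TopologicalSpace V → Prop) : IsLCTopology V (finestLC V P) :=
  ⟨topologicalAddGroup_sInf fun _ ht => ht.1.1, continuousSMul_sInf fun _ ht => ht.1.2.1,
    LocallyConvexSpace.sInf fun _ ht => ht.1.2.2⟩

/-- `𝐆^α_α(ℝ^d_+)` carries the locally convex inductive limit topology. -/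
instance (α : ℝ) (d : ℕ) : TopologicalSpace (Roumieu α d) :=
  finestLC (Roumieu α d) fun t =>
    ∀ h : Ioi (0 : ℝ), @Continuous (StepSpace α h d) (Roumieu α d) _ t (stepToRoumieu α d h)

/-- `𝐠^α_α(ℝ^d_+)` carries the projective limit topology. -/
instance (α : ℝ) (d : ℕ) : TopologicalSpace (Beurling α d) :=
  ⨅ h : Ioi (0 : ℝ), TopologicalSpace.induced (beurlingToStep α d h) inferInstance

/-! ### The completed projective tensor product -/

/-- The algebraic tensor product, to be endowed with the projective topology. -/
def ProjTensor (V W : Type*) [AddCommGroup V] [Module ℂ V] [AddCommGroup W] [Module ℂ W] :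
    Type _ := V ⊗[ℂ] W

section ProjTensor

variable (V W : Type*) [AddCommGroup V] [Module ℂ V] [AddCommGroup W] [Module ℂ W]

instance : AddCommGroup (ProjTensor V W) := inferInstanceAs (AddCommGroup (V ⊗[ℂ] W))

instance : Module ℂ (ProjTensor V W) := inferInstanceAs (Module ℂ (V ⊗[ℂ] W))

variable {V W} in
/-- The canonical bilinear map `(v, w) ↦ v ⊗ w`. -/
def ptmul (v : V) (w : W) : ProjTensor V W := v ⊗ₜ[ℂ] w

variable [TopologicalSpace V] [TopologicalSpace W]

/-- The projective topology: the finest locally convex topology for which `(v, w) ↦ v ⊗ w` is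
(jointly) continuous. -/
instance : TopologicalSpace (ProjTensor V W) :=
  finestLC (ProjTensor V W) fun t =>
    @Continuous (V × W) (ProjTensor V W) _ t (fun p => ptmul p.1 p.2)

instance : IsTopologicalAddGroup (ProjTensor V W) := (isLCTopology_finestLC _ _).1

instance : ContinuousSMul ℂ (ProjTensor V W) := (isLCTopology_finestLC _ _).2.1

instance : UniformSpace (ProjTensor V W) := IsTopologicalAddGroup.rightUniformSpace _

instance : IsUniformAddGroup (ProjTensor V W) := isUniformAddGroup_of_addCommGroup

instance : UniformContinuousConstSMul ℂ (ProjTensor V W) :=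
  uniformContinuousConstSMul_of_continuousConstSMul _ _

/-- The completed projective tensor product `V ⊗̂ W` (Hausdorff completion). -/
abbrev CTensor : Type _ := UniformSpace.Completion (ProjTensor V W)

variable {V W} in
/-- The elementary tensor `v ⊗ w` in `V ⊗̂ W`. -/
def ctmul (v : V) (w : W) : CTensor V W := (ptmul v w : ProjTensor V W)

end ProjTensor

end POrthant

end

open POrthant

/-! The products of Laguerre functions `e^{-x/2} L_n(x)` form a complete orthonormal system on the
orthant, and the Laguerre operator multiplies the one with index `n` by `|n|`. Hence `E^N f` has the
coefficients `|n|^N c_n`. The supremum over `N` of `t^N / (h^N N!^α)` lies between `2^{-α} exp(c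
t^{1/α} / 2)` and `exp(c t^{1/α})`, where `c = α h^{-1/α}`. So a function belongs to the Beurling
(Roumieu) space exactly when its coefficients are summable against `exp(s |n|^{1/α})` for every
(some) `s > 0`.

Both spaces thereby become Köthe sequence spaces: all sequences absolutely summable against a set
`P` of weights, with the weighted `ℓ¹`-seminorms. For the Roumieu space, `P` consists of the weights
dominated by every `exp(s |n|^{1/α})`, `s > 0`; this describes an inductive limit by seminorms.
These identifications are `isKothe_beurling` and `isKothe_roumieu`.

For `ℓ¹`-type spaces the projective tensor product is explicit. A continuous seminorm `p` on `X ⊗ Y`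
satisfies `p(e_i ⊗ e_j) ≤ C v_i w_j`, so `p(z) ≤ C ∑ |z_ij| v_i w_j`. Thus the completion is the
Köthe space on the product index set with weights `v_i w_j`, and it equals `Z` as soon as these
weights and those of `Z` dominate each other (`IsKothe.exists_tensorEquiv`).

The strong dual is again a Köthe space, for the Köthe dual weights, when `P` is nuclear (a sup bound
against one weight gives summability against another) and reflexive (a sequence summable against the
Köthe dual is dominated by a weight); this is `IsKothe.dual`. The tensor theorem therefore applies
to the duals too. What remains is domination between weights. Since `|m ⊕ n| = |m| + |n|`, it
reduces to splitting a function of `|m| + |n|` into a product, which is done with monotone radial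
envelopes (`dominatedByProd_roumieu`, `dominatedByProd_kotheDual_beurling`). -/

open Filter Topology

noncomputable section

namespace POrthant

/-! ### Köthe spaces -/

section Kothe

variable {I J K X Y Z : Type*}
  [AddCommGroup X] [Module ℂ X] [TopologicalSpace X]
  [AddCommGroup Y] [Module ℂ Y] [TopologicalSpace Y]
  [AddCommGroup Z] [Module ℂ Z] [TopologicalSpace Z]

/-- The coefficient map `T` identifies `X` with the `ℓ¹`-type Köthe sequence space given by the
weights in `P`, algebraically and topologically. -/
structure IsKothe (T : X →ₗ[ℂ] I → ℂ) (P : Set (I → ℝ)) : Prop where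
  topGroup : IsTopologicalAddGroup X
  nonneg : ∀ v ∈ P, ∀ i, 0 ≤ v i
  pos : ∀ i, ∃ v ∈ P, 0 < v i
  inj : Function.Injective T
  exists_iff : ∀ a, (∃ x, T x = a) ↔ ∀ v ∈ P, Summable fun i => ‖a i‖ * v i
  mem_nhds_zero : ∀ U : Set X, U ∈ 𝓝 (0 : X) ↔
    ∃ v ∈ P, ∃ ε > 0, {x | ∑' i, ‖T x i‖ * v i < ε} ⊆ U

/-- The Köthe dual of a set of weights. -/
def kotheDual (P : Set (I → ℝ)) : Set (I → ℝ) :=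
  {b | (∀ i, 0 ≤ b i) ∧ ∀ v ∈ P, Summable fun i => b i * v i}

namespace IsKothe

variable {T : X →ₗ[ℂ] I → ℂ} {P : Set (I → ℝ)} {TY : Y →ₗ[ℂ] J → ℂ} {Q : Set (J → ℝ)}
  {TZ : Z →ₗ[ℂ] K → ℂ} {R : Set (K → ℝ)}

lemma summable (hX : IsKothe T P) (x : X) {v : I → ℝ} (hv : v ∈ P) :
    Summable fun i => ‖T x i‖ * v i :=
  (hX.exists_iff (T x)).1 ⟨x, rfl⟩ v hv

/-- The weighted `ℓ¹`-seminorm. -/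
def seminorm (hX : IsKothe T P) (v : P) : Seminorm ℂ X :=
  Seminorm.of (fun x => ∑' i, ‖T x i‖ * v.1 i)
    (fun x y => by
      rw [← (hX.summable x v.2).tsum_add (hX.summable y v.2)]
      refine (hX.summable _ v.2).tsum_le_tsum (fun i => ?_)
        ((hX.summable x v.2).add (hX.summable y v.2))
      rw [← add_mul, map_add, Pi.add_apply]
      exact mul_le_mul_of_nonneg_right (norm_add_le _ _) (hX.nonneg v v.2 i))
    (fun c x => by
      rw [← tsum_mul_left]
      simp [mul_assoc])

lemma seminorm_apply (hX : IsKothe T P) (v : P) (x : X) :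
    hX.seminorm v x = ∑' i, ‖T x i‖ * v.1 i := rfl

lemma withSeminorms (hX : IsKothe T P) : WithSeminorms hX.seminorm := by
  have := hX.topGroup
  rw [SeminormFamily.withSeminorms_iff_nhds_eq_iInf]
  apply le_antisymm
  · refine le_iInf fun v => ?_
    rw [((nhds_basis_zero_abs_lt ℝ).comap _).ge_iff]
    intro ε hε
    refine (hX.mem_nhds_zero _).2 ⟨v, v.2, ε, hε, fun x hx => ?_⟩
    rw [mem_preimage, mem_ofPred_eq]
    rwa [abs_of_nonneg (apply_nonneg _ _)]
  · intro U hU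
    obtain ⟨v, hv, ε, hε, h⟩ := (hX.mem_nhds_zero _).1 hU
    refine mem_iInf_of_mem ⟨v, hv⟩ ?_
    exact mem_of_superset (preimage_mem_comap (Iio_mem_nhds hε)) h

lemma continuousSMul (hX : IsKothe T P) : ContinuousSMul ℂ X :=
  hX.withSeminorms.continuousSMul

lemma locallyConvexSpace (hX : IsKothe T P) : LocallyConvexSpace ℝ X :=
  hX.withSeminorms.toLocallyConvexSpace

lemma exists_coord (hX : IsKothe T P) (i : I) : ∃ x, T x = Set.indicator {i} 1 := by
  refine (hX.exists_iff _).2 fun v _ => ?_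
  refine summable_of_ne_finset_zero (s := {i}) fun j hj => ?_
  rw [Set.indicator_of_notMem (by simpa using hj)]
  simp

/-- The coordinate vectors. -/
def coord (hX : IsKothe T P) (i : I) : X := (hX.exists_coord i).choose

lemma map_coord (hX : IsKothe T P) (i : I) : T (hX.coord i) = Set.indicator {i} 1 :=
  (hX.exists_coord i).choose_spec

lemma map_coord_self (hX : IsKothe T P) (i : I) : T (hX.coord i) i = 1 := by
  simp [hX.map_coord]

lemma map_coord_ne (hX : IsKothe T P) {i j : I} (h : j ≠ i) : T (hX.coord i) j = 0 := by
  simp [hX.map_coord, h]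

lemma seminorm_coord (hX : IsKothe T P) (v : P) (i : I) : hX.seminorm v (hX.coord i) = v.1 i := by
  rw [seminorm_apply, tsum_eq_single i (fun j hj => by simp [hX.map_coord_ne hj])]
  simp [hX.map_coord_self]

lemma map_sub_sum (hX : IsKothe T P) (x : X) (s : Finset I) (i : I) :
    T (x - ∑ j ∈ s, T x j • hX.coord j) i = Set.indicator (↑s)ᶜ (T x) i := by
  classical
  rw [map_sub, map_sum, Pi.sub_apply, Finset.sum_apply]
  have : ∀ j ∈ s, T (T x j • hX.coord j) i = if i = j then T x j else 0 := by
    intro j _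
    rw [map_smul, Pi.smul_apply, smul_eq_mul]
    split_ifs with h
    · rw [h, hX.map_coord_self, mul_one]
    · rw [hX.map_coord_ne h, mul_zero]
  rw [Finset.sum_congr rfl this, Finset.sum_ite_eq]
  by_cases h : i ∈ s <;> simp [h]

/-- The error of a partial sum has as seminorm the tail of an absolutely convergent series, so the
coordinate vectors form an unconditional basis. -/
lemma hasSum_coord (hX : IsKothe T P) (x : X) : HasSum (fun i => T x i • hX.coord i) x := by
  rw [HasSum, SummationFilter.unconditional_filter, hX.withSeminorms.tendsto_nhds]
  intro v ε hε
  have h := tendsto_tsum_compl_atTop_zero fun i => ‖T x i‖ * v.1 i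
  filter_upwards [h.eventually (gt_mem_nhds hε)] with s hs
  rw [map_sub_rev, seminorm_apply]
  refine lt_of_eq_of_lt ?_ hs
  refine Eq.trans (tsum_congr fun i => ?_)
    (tsum_subtype ((↑s : Set I)ᶜ) (fun i => ‖T x i‖ * v.1 i)).symm
  rw [hX.map_sub_sum]
  by_cases h : i ∈ s <;> simp [h]

lemma exists_bound_of_continuous (hX : IsKothe T P) {p : Seminorm ℂ X} (hp : Continuous p) :
    ∃ v ∈ P, ∃ C : ℝ, 0 ≤ C ∧ ∀ x, p x ≤ C * ∑' i, ‖T x i‖ * v i := by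
  have hU : {x | p x < 1} ∈ 𝓝 (0 : X) :=
    (isOpen_lt hp continuous_const).mem_nhds (by simp)
  obtain ⟨v, hv, ε, hε, h⟩ := (hX.mem_nhds_zero _).1 hU
  refine ⟨v, hv, ε⁻¹, by positivity, fun x => ?_⟩
  by_contra! hlt
  set q := hX.seminorm ⟨v, hv⟩ with hq
  have hqx : (∑' i, ‖T x i‖ * v i) = q x := rfl
  rw [hqx] at hlt
  have hpx : 0 < p x := lt_of_le_of_lt (by positivity) hlt
  -- Normalizing by `p x`, which is positive here, instead of by `q x` avoids a separate case `q x =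
  -- 0`.
  have h1 : q (((p x)⁻¹ : ℂ) • x) < ε := by
    rw [map_smul_eq_mul, norm_inv, Complex.norm_real, Real.norm_of_nonneg hpx.le,
      inv_mul_lt_iff₀ hpx]
    rwa [inv_mul_lt_iff₀ hε, mul_comm] at hlt
  have h2 : p (((p x)⁻¹ : ℂ) • x) < 1 := h h1
  rw [map_smul_eq_mul, norm_inv, Complex.norm_real, Real.norm_of_nonneg hpx.le,
    inv_mul_cancel₀ hpx.ne'] at h2
  exact lt_irrefl _ h2

/-- The usual completeness proof for `ℓ¹`: coordinates converge because some weight is positive at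
each index, and the weighted norm is lower semicontinuous under coordinatewise limits. -/
lemma completeSpace {Z : Type*} [AddCommGroup Z] [Module ℂ Z] [UniformSpace Z]
    [IsUniformAddGroup Z] {TZ : Z →ₗ[ℂ] K → ℂ} (hZ : IsKothe TZ R) : CompleteSpace Z := by
  refine ⟨fun {F} hF => ?_⟩
  have hne := hF.1
  -- smallness of differences along the filter
  have hsmall : ∀ v : R, ∀ ε > 0, ∃ S ∈ F, ∀ x ∈ S, ∀ y ∈ S, hZ.seminorm v (x - y) < ε := by
    intro v ε hε
    have hU : {x | hZ.seminorm v x < ε} ∈ 𝓝 (0 : Z) :=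
      (hZ.mem_nhds_zero _).2 ⟨v, v.2, ε, hε, fun x hx => hx⟩
    have hV : {p : Z × Z | hZ.seminorm v (p.2 - p.1) < ε} ∈ uniformity Z := by
      rw [uniformity_eq_comap_nhds_zero Z]
      exact preimage_mem_comap hU
    obtain ⟨S, hS, h⟩ := (cauchy_iff.1 hF).2 _ hV
    exact ⟨S, hS, fun x hx y hy => by simpa using h (mk_mem_prod hy hx)⟩
  have hle : ∀ (v : R) (x : Z) (i : K), ‖TZ x i‖ * v.1 i ≤ hZ.seminorm v x := fun v x i =>
    (hZ.summable x v.2).le_tsum i fun j _ => mul_nonneg (norm_nonneg _) (hZ.nonneg v v.2 j)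
  have hlim : ∀ i, ∃ c : ℂ, Tendsto (fun x => TZ x i) F (𝓝 c) := by
    intro i
    obtain ⟨v, hv, hvi⟩ := hZ.pos i
    refine cauchy_iff_exists_le_nhds.1 (Metric.cauchy_iff.2 ⟨hne.map _, fun ε hε => ?_⟩)
    obtain ⟨S, hS, h⟩ := hsmall ⟨v, hv⟩ (ε * v i) (by positivity)
    refine ⟨_, image_mem_map hS, ?_⟩
    rintro _ ⟨x, hx, rfl⟩ _ ⟨y, hy, rfl⟩
    have := (hle ⟨v, hv⟩ (x - y) i).trans_lt (h x hx y hy)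
    rw [map_sub, Pi.sub_apply] at this
    rw [dist_eq_norm]
    exact lt_of_mul_lt_mul_right this hvi.le
  choose a ha using hlim
  -- Only finite sums are passed to the limit in `y`. The bound is uniform in `s`, so it survives
  -- for the full series.
  have hfatou : ∀ (v : R) (ε : ℝ) (S : Set Z), S ∈ F →
      (∀ x ∈ S, ∀ y ∈ S, hZ.seminorm v (x - y) < ε) → ∀ x ∈ S, ∀ s : Finset K,
      ∑ i ∈ s, ‖TZ x i - a i‖ * v.1 i ≤ ε := by
    intro v ε S hS h x hx s
    have ht : Tendsto (fun y => ∑ i ∈ s, ‖TZ x i - TZ y i‖ * v.1 i) F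
        (𝓝 (∑ i ∈ s, ‖TZ x i - a i‖ * v.1 i)) :=
      tendsto_finsetSum _ fun i _ => ((tendsto_const_nhds.sub (ha i)).norm).mul_const _
    refine le_of_tendsto ht ?_
    filter_upwards [hS] with y hy
    refine le_trans ?_ (h x hx y hy).le
    have := (hZ.summable (x - y) v.2).sum_le_tsum s
      fun j _ => mul_nonneg (norm_nonneg _) (hZ.nonneg v v.2 j)
    simpa [seminorm_apply] using this
  obtain ⟨z, hz⟩ : ∃ z, TZ z = a := by
    refine (hZ.exists_iff a).2 fun v hv => ?_
    obtain ⟨S, hS, h⟩ := hsmall ⟨v, hv⟩ 1 one_pos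
    obtain ⟨x, hx⟩ := hne.nonempty_of_mem hS
    have h1 : Summable fun i => ‖TZ x i - a i‖ * v i :=
      summable_of_sum_le (fun i => mul_nonneg (norm_nonneg _) (hZ.nonneg v hv i))
        (hfatou ⟨v, hv⟩ 1 S hS h x hx)
    refine Summable.of_nonneg_of_le (fun i => mul_nonneg (norm_nonneg _) (hZ.nonneg v hv i))
      (fun i => ?_) (h1.add (hZ.summable x hv))
    rw [← add_mul]
    refine mul_le_mul_of_nonneg_right ?_ (hZ.nonneg v hv i)
    calc ‖a i‖ = ‖TZ x i - (TZ x i - a i)‖ := by simp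
      _ ≤ ‖TZ x i‖ + ‖TZ x i - a i‖ := norm_sub_le _ _
      _ = _ := add_comm _ _
  refine ⟨z, ?_⟩
  have : Tendsto id F (𝓝 z) := by
    rw [hZ.withSeminorms.tendsto_nhds]
    intro v ε hε
    obtain ⟨S, hS, h⟩ := hsmall v (ε / 2) (by positivity)
    filter_upwards [hS] with x hx
    refine lt_of_le_of_lt ?_ (half_lt_self hε)
    rw [seminorm_apply]
    refine Real.tsum_le_of_sum_le (fun i => mul_nonneg (norm_nonneg _) (hZ.nonneg v v.2 i))
      fun s => ?_
    simpa [hz] using hfatou v (ε / 2) S hS h x hx s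
  exact this

lemma t2Space (hX : IsKothe T P) : T2Space X := by
  have := hX.topGroup
  have : T1Space X := by
    refine hX.withSeminorms.T1_of_separating fun x hx => ?_
    obtain ⟨i, hi⟩ : ∃ i, T x i ≠ 0 := by
      by_contra! h
      exact hx (hX.inj (by rw [map_zero]; exact funext h))
    obtain ⟨v, hv, hvi⟩ := hX.pos i
    refine ⟨⟨v, hv⟩, ne_of_gt ?_⟩
    refine lt_of_lt_of_le (mul_pos (norm_pos_iff.2 hi) hvi) ?_
    exact (hX.summable x hv).le_tsum i fun j _ => mul_nonneg (norm_nonneg _) (hX.nonneg v hv j)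
  infer_instance

end IsKothe

end Kothe

/-! ### Seminorms in complex locally convex spaces -/

/-- Local convexity is a condition over `ℝ`, whereas the gauge must be homogeneous over `ℂ`. The two
are reconciled because multiplication by a complex scalar is real linear and so commutes with real
convex hulls. -/
lemma balanced_convexHull_real {V : Type*} [AddCommGroup V] [Module ℂ V] {s : Set V}
    (hs : Balanced ℂ s) : Balanced ℂ (convexHull ℝ s) := by
  intro a ha
  rintro _ ⟨x, hx, rfl⟩
  let f : V →ₗ[ℝ] V := (LinearMap.lsmul ℂ V a).restrictScalars ℝ
  have h : f x ∈ convexHull ℝ (f '' s) := by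
    rw [← LinearMap.image_convexHull]
    exact mem_image_of_mem f hx
  refine convexHull_mono ?_ h
  rintro _ ⟨y, hy, rfl⟩
  exact hs a ha ⟨y, hy, rfl⟩

/-- In a locally convex complex vector space, every neighbourhood of zero contains the open unit
ball of a continuous seminorm. -/
lemma exists_continuous_seminorm {V : Type*} [AddCommGroup V] [Module ℂ V] [TopologicalSpace V]
    [IsTopologicalAddGroup V] [ContinuousSMul ℂ V] [LocallyConvexSpace ℝ V] {U : Set V}
    (hU : U ∈ 𝓝 (0 : V)) : ∃ p : Seminorm ℂ V, Continuous p ∧ {x | p x < 1} ⊆ U := by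
  have : ContinuousSMul ℝ V := IsScalarTower.continuousSMul ℂ
  obtain ⟨C, ⟨hC, hC'⟩, hCU⟩ := (LocallyConvexSpace.convex_basis_zero ℝ V).mem_iff.1 hU
  obtain ⟨B, hB⟩ : ∃ B, B = convexHull ℝ (balancedCore ℂ C) := ⟨_, rfl⟩
  have hBC : B ⊆ C := hB ▸ convexHull_min (balancedCore_subset C) hC'
  have hBn : B ∈ 𝓝 (0 : V) := hB ▸
    Filter.mem_of_superset (balancedCore_mem_nhds_zero hC) (subset_convexHull ℝ _)
  have hBb : Balanced ℂ B := hB ▸ balanced_convexHull_real (balancedCore_balanced C)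
  have hBx : Convex ℝ B := hB ▸ convex_convexHull ℝ _
  have hBa : Absorbent ℝ B := absorbent_nhds_zero hBn
  refine ⟨gaugeSeminorm hBb hBx hBa, ?_, fun x hx => hCU (hBC ?_)⟩
  · exact continuous_gauge hBx hBn
  · exact setOfPred_gauge_lt_one_subset_self hBx (mem_of_mem_nhds hBn) hBa hx

lemma seminorm_le_of_forall_lt {V : Type*} [AddCommGroup V] [Module ℂ V] {p q : Seminorm ℂ V}
    {δ M : ℝ} (hδ : 0 < δ) (h : ∀ y, q y < δ → p y ≤ M) (y : V) :
    p y ≤ M / δ * q y := by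
  -- Scaling uses some `s > q y` because `q y` may vanish; afterwards `s` decreases to `q y`.
  have key : ∀ s > q y, p y ≤ M / δ * s := by
    intro s hs
    have hs0 : 0 < s := lt_of_le_of_lt (apply_nonneg q y) hs
    have hc : ‖((δ / s : ℝ) : ℂ)‖ = δ / s := by
      rw [Complex.norm_real, Real.norm_of_nonneg (by positivity)]
    have h1 := h (((δ / s : ℝ) : ℂ) • y) (by
      rw [map_smul_eq_mul, hc, div_mul_eq_mul_div, div_lt_iff₀ hs0]
      exact mul_lt_mul_of_pos_left hs hδ)
    rw [map_smul_eq_mul, hc, div_mul_eq_mul_div, div_le_iff₀ hs0] at h1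
    rw [div_mul_eq_mul_div, le_div_iff₀ hδ]
    linarith
  have ht : Tendsto (fun s => M / δ * s) (𝓝[>] q y) (𝓝 (M / δ * q y)) :=
    ((continuous_const.mul continuous_id).tendsto _).mono_left nhdsWithin_le_nhds
  exact ge_of_tendsto ht (by filter_upwards [self_mem_nhdsWithin] with s hs using key s hs)

/-! ### The algebraic tensor product -/

/-- The canonical bilinear map into the algebraic tensor product. -/
def ptmulBilin (V W : Type*) [AddCommGroup V] [Module ℂ V] [AddCommGroup W] [Module ℂ W] :
    V →ₗ[ℂ] W →ₗ[ℂ] ProjTensor V W := TensorProduct.mk ℂ V W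

lemma ptmulBilin_apply {V W : Type*} [AddCommGroup V] [Module ℂ V] [AddCommGroup W] [Module ℂ W]
    (v : V) (w : W) : ptmulBilin V W v w = ptmul v w := rfl

/-- The linear map on the algebraic tensor product given by a bilinear map. -/
def projLift {V W Z : Type*} [AddCommGroup V] [Module ℂ V] [AddCommGroup W] [Module ℂ W]
    [AddCommGroup Z] [Module ℂ Z] (b : V →ₗ[ℂ] W →ₗ[ℂ] Z) : ProjTensor V W →ₗ[ℂ] Z :=
  TensorProduct.lift b

lemma projLift_ptmul {V W Z : Type*} [AddCommGroup V] [Module ℂ V] [AddCommGroup W] [Module ℂ W]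
    [AddCommGroup Z] [Module ℂ Z] (b : V →ₗ[ℂ] W →ₗ[ℂ] Z) (v : V) (w : W) :
    projLift b (ptmul v w) = b v w := TensorProduct.lift.tmul v w

lemma projTensor_induction {V W : Type*} [AddCommGroup V] [Module ℂ V] [AddCommGroup W]
    [Module ℂ W] {motive : ProjTensor V W → Prop} (zero : motive 0)
    (tmul : ∀ v w, motive (ptmul v w)) (add : ∀ x y, motive x → motive y → motive (x + y))
    (z : ProjTensor V W) : motive z :=
  TensorProduct.induction_on (motive := motive) z zero tmul add

lemma continuous_ptmul (V W : Type*) [AddCommGroup V] [Module ℂ V] [AddCommGroup W] [Module ℂ W]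
    [TopologicalSpace V] [TopologicalSpace W] :
    Continuous fun p : V × W => ptmul p.1 p.2 := by
  refine continuous_sInf_rng.2 fun t ht => ht.2

/-! ### Projective tensor products of Köthe spaces -/

section

variable {I J K X Y Z : Type*}
  [AddCommGroup X] [Module ℂ X] [TopologicalSpace X]
  [AddCommGroup Y] [Module ℂ Y] [TopologicalSpace Y]
  [AddCommGroup Z] [Module ℂ Z] [TopologicalSpace Z]
  {T : X →ₗ[ℂ] I → ℂ} {P : Set (I → ℝ)} {TY : Y →ₗ[ℂ] J → ℂ} {Q : Set (J → ℝ)}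
  {TZ : Z →ₗ[ℂ] K → ℂ} {R : Set (K → ℝ)}

/-- The weights in `R` are dominated by products of weights in `P` and `Q`. -/
def DominatedByProd (e : I × J ≃ K) (P : Set (I → ℝ)) (Q : Set (J → ℝ)) (R : Set (K → ℝ)) : Prop :=
  ∀ r ∈ R, ∃ p ∈ P, ∃ q ∈ Q, ∃ C : ℝ, ∀ i j, r (e (i, j)) ≤ C * (p i * q j)

/-- Products of weights in `P` and `Q` are dominated by weights in `R`. -/
def DominatesProd (e : I × J ≃ K) (P : Set (I → ℝ)) (Q : Set (J → ℝ)) (R : Set (K → ℝ)) : Prop :=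
  ∀ p ∈ P, ∀ q ∈ Q, ∃ r ∈ R, ∃ C : ℝ, ∀ i j, p i * q j ≤ C * r (e (i, j))

namespace IsKothe

variable (hX : IsKothe T P) (hY : IsKothe TY Q) (hZ : IsKothe TZ R) {e : I × J ≃ K}

include hX hY hZ in
-- The double series of products factors. The sequence `a` is arbitrary, rather than the
-- coefficients of an element of `Z`, because the summability obtained here is what produces that
-- element.
lemma exists_tensor_bound (h : DominatedByProd e P Q R) {r : K → ℝ} (hr : r ∈ R) :
    ∃ p : P, ∃ q : Q, ∃ C : ℝ, 0 ≤ C ∧ ∀ (x : X) (y : Y) (a : K → ℂ),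
      (∀ i j, a (e (i, j)) = T x i * TY y j) → Summable (fun k => ‖a k‖ * r k) ∧
        ∑' k, ‖a k‖ * r k ≤ C * (hX.seminorm p x * hY.seminorm q y) := by
  obtain ⟨p, hp, q, hq, C, hC⟩ := h r hr
  refine ⟨⟨p, hp⟩, ⟨q, hq⟩, |C|, abs_nonneg _, fun x y a ha => ?_⟩
  have hsx := hX.summable x hp
  have hsy := hY.summable y hq
  have hx0 : ∀ i, 0 ≤ ‖T x i‖ * p i := fun i => mul_nonneg (norm_nonneg _) (hX.nonneg p hp i)
  have hy0 : ∀ j, 0 ≤ ‖TY y j‖ * q j := fun i => mul_nonneg (norm_nonneg _) (hY.nonneg q hq i)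
  have hs : Summable fun z : I × J => (‖T x z.1‖ * p z.1) * (‖TY y z.2‖ * q z.2) :=
    hsx.mul_of_nonneg hsy hx0 hy0
  have hle : ∀ z : I × J, ‖a (e z)‖ * r (e z) ≤
      |C| * ((‖T x z.1‖ * p z.1) * (‖TY y z.2‖ * q z.2)) := by
    rintro ⟨i, j⟩
    rw [ha, norm_mul]
    have h0 : 0 ≤ p i * q j := mul_nonneg (hX.nonneg p hp i) (hY.nonneg q hq j)
    calc ‖T x i‖ * ‖TY y j‖ * r (e (i, j))
        ≤ ‖T x i‖ * ‖TY y j‖ * (|C| * (p i * q j)) := by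
          refine mul_le_mul_of_nonneg_left ((hC i j).trans ?_) (by positivity)
          exact mul_le_mul_of_nonneg_right (le_abs_self C) h0
      _ = _ := by ring
  have hs' : Summable fun z : I × J => ‖a (e z)‖ * r (e z) :=
    Summable.of_nonneg_of_le (fun z => mul_nonneg (norm_nonneg _) (hZ.nonneg r hr _)) hle
      (hs.mul_left _)
  refine ⟨e.summable_iff.1 hs', ?_⟩
  rw [← e.tsum_eq, seminorm_apply, seminorm_apply, hsx.tsum_mul_tsum hsy hs, ← tsum_mul_left]
  exact hs'.tsum_le_tsum hle (hs.mul_left _)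

include hX hY hZ in
lemma exists_tensor (h : DominatedByProd e P Q R) (x : X) (y : Y) :
    ∃ z, TZ z = fun k => T x (e.symm k).1 * TY y (e.symm k).2 := by
  refine (hZ.exists_iff _).2 fun r hr => ?_
  obtain ⟨p, q, C, -, hC⟩ := exists_tensor_bound hX hY hZ h hr
  exact (hC x y _ fun i j => by simp).1

/-- The element of `Z` whose coefficients are the products of those of `x` and `y`. -/
def tensorElt (h : DominatedByProd e P Q R) (x : X) (y : Y) : Z :=
  (exists_tensor hX hY hZ h x y).choose

lemma map_tensorElt (h : DominatedByProd e P Q R) (x : X) (y : Y) (k : K) :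
    TZ (tensorElt hX hY hZ h x y) k = T x (e.symm k).1 * TY y (e.symm k).2 :=
  congrFun (exists_tensor hX hY hZ h x y).choose_spec k

/-- The bilinear map `X × Y → Z` which multiplies coefficients. -/
def tensorBilin (h : DominatedByProd e P Q R) : X →ₗ[ℂ] Y →ₗ[ℂ] Z :=
  LinearMap.mk₂ ℂ (tensorElt hX hY hZ h)
    (fun x x' y => hZ.inj <| funext fun k => by
      simp only [map_add, Pi.add_apply, map_tensorElt, add_mul])
    (fun c x y => hZ.inj <| funext fun k => by
      simp only [map_smul, Pi.smul_apply, map_tensorElt, smul_eq_mul, mul_assoc])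
    (fun x y y' => hZ.inj <| funext fun k => by
      simp only [map_add, Pi.add_apply, map_tensorElt, mul_add])
    (fun c x y => hZ.inj <| funext fun k => by
      simp only [map_smul, Pi.smul_apply, map_tensorElt, smul_eq_mul, mul_left_comm])

lemma map_tensorBilin (h : DominatedByProd e P Q R) (x : X) (y : Y) (i : I) (j : J) :
    TZ (tensorBilin hX hY hZ h x y) (e (i, j)) = T x i * TY y j := by
  have := map_tensorElt hX hY hZ h x y (e (i, j))
  rwa [e.symm_apply_apply] at this

/-- Joint continuity of a biadditive map amounts to continuity at zero jointly and in each variable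
with the other fixed. The maps `F` and `G` let one estimate cover all three cases. -/
lemma tendsto_tensorBilin_zero (h : DominatedByProd e P Q R) {W : Type*} [TopologicalSpace W]
    {F : W → X} {G : W → Y} {w : W} (hF : Continuous F) (hG : Continuous G)
    (h0 : F w = 0 ∨ G w = 0) :
    Tendsto (fun w' => tensorBilin hX hY hZ h (F w') (G w')) (𝓝 w) (𝓝 0) := by
  rw [hZ.withSeminorms.tendsto_nhds]
  intro r ε hε
  obtain ⟨p, q, C, hC0, hC⟩ := exists_tensor_bound hX hY hZ h r.2
  have hc : Continuous fun w' => C * (hX.seminorm p (F w') * hY.seminorm q (G w')) :=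
    continuous_const.mul (((hX.withSeminorms.continuous_seminorm p).comp hF).mul
      ((hY.withSeminorms.continuous_seminorm q).comp hG))
  have hz : C * (hX.seminorm p (F w) * hY.seminorm q (G w)) < ε := by
    rcases h0 with h0 | h0 <;> simpa [h0] using hε
  filter_upwards [hc.continuousAt.eventually (gt_mem_nhds hz)] with w' hw'
  rw [sub_zero]
  exact ((hC _ _ _ (map_tensorBilin hX hY hZ h _ _)).2).trans_lt hw'

lemma continuous_tensorBilin (h : DominatedByProd e P Q R) :
    Continuous fun p : X × Y => tensorBilin hX hY hZ h p.1 p.2 := by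
  have := hX.topGroup
  have := hY.topGroup
  have := hZ.topGroup
  refine continuous_of_continuousAt_zero₂
    (AddMonoidHom.mk' (fun x => (tensorBilin hX hY hZ h x).toAddMonoidHom) fun a b => by
      ext; simp) ?_ (fun x => ?_) (fun y => ?_)
  · have := tendsto_tensorBilin_zero hX hY hZ h (w := ((0, 0) : X × Y)) continuous_fst
      continuous_snd (Or.inl rfl)
    simpa [ContinuousAt] using this
  · have := tendsto_tensorBilin_zero hX hY hZ h (w := (0 : Y)) (F := fun _ => x) continuous_const
      continuous_id (Or.inr rfl)
    simpa [ContinuousAt] using this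
  · have := tendsto_tensorBilin_zero hX hY hZ h (w := (0 : X)) (G := fun _ => y) continuous_id
      continuous_const (Or.inl rfl)
    simpa [ContinuousAt] using this

/-- The topology pulled back from `Z` is locally convex and makes `⊗` continuous, so it is coarser
than the projective topology. -/
lemma continuous_projLift (h : DominatedByProd e P Q R) :
    Continuous (projLift (tensorBilin hX hY hZ h)) := by
  have := hZ.topGroup
  have := hZ.continuousSMul
  have := hZ.locallyConvexSpace
  rw [continuous_iff_le_induced]
  refine sInf_le ⟨⟨topologicalAddGroup_induced _, continuousSMul_induced _,
    LocallyConvexSpace.induced ((projLift (tensorBilin hX hY hZ h)).restrictScalars ℝ)⟩, ?_⟩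
  refine continuous_induced_rng.2 ?_
  exact continuous_tensorBilin hX hY hZ h

/-- On `x ⊗ y` this is joint continuity of `⊗` applied to the two basis expansions. The convergence
takes place in the projective topology, so seminorms on the tensor product can be estimated term by
term. -/
lemma tendsto_partial_tensor (h : DominatedByProd e P Q R) (z : ProjTensor X Y) :
    Tendsto (fun s : Finset I × Finset J => ∑ i ∈ s.1, ∑ j ∈ s.2,
      TZ (projLift (tensorBilin hX hY hZ h) z) (e (i, j)) • ptmul (hX.coord i) (hY.coord j))
      (atTop ×ˢ atTop) (𝓝 z) := by
  induction z using projTensor_induction with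
  | zero =>
    simp only [map_zero, Pi.zero_apply, zero_smul, Finset.sum_const_zero]
    exact tendsto_const_nhds
  | tmul x y =>
    have h1 : Tendsto (fun s : Finset I × Finset J =>
        ((∑ i ∈ s.1, T x i • hX.coord i, ∑ j ∈ s.2, TY y j • hY.coord j) : X × Y))
        (atTop ×ˢ atTop) (𝓝 (x, y)) := by
      rw [nhds_prod_eq]
      refine Tendsto.prodMk ?_ ?_
      · have := hX.hasSum_coord x
        rw [HasSum, SummationFilter.unconditional_filter] at this
        exact this.comp tendsto_fst
      · have := hY.hasSum_coord y
        rw [HasSum, SummationFilter.unconditional_filter] at this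
        exact this.comp tendsto_snd
    refine (((continuous_ptmul X Y).tendsto (x, y)).comp h1).congr fun s => ?_
    simp only [Function.comp, ← ptmulBilin_apply]
    rw [map_sum (ptmulBilin X Y), LinearMap.sum_apply]
    refine Finset.sum_congr rfl fun i _ => ?_
    rw [map_sum]
    refine Finset.sum_congr rfl fun j _ => ?_
    rw [ptmulBilin_apply x y, projLift_ptmul, map_tensorBilin, map_smul, map_smul,
      LinearMap.smul_apply, smul_smul, mul_comm]
  | add z w hz hw =>
    refine (hz.add hw).congr fun s => ?_
    simp only [map_add, Pi.add_apply, add_smul, Finset.sum_add_distrib]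

/-- The heart of the tensor theorem. By the basis expansion a continuous seminorm `p` satisfies
`p(z) ≤ ∑ |z_ij| p(e_i ⊗ e_j)`, and continuity of `⊗` gives `p(e_i ⊗ e_j) ≤ C v_i w_j`. Hence `p` is
dominated by a weighted `ℓ¹`-seminorm of the image in `Z`. -/
lemma isInducing_projLift (h : DominatedByProd e P Q R) (h' : DominatesProd e P Q R) :
    IsInducing (projLift (tensorBilin hX hY hZ h)) := by
  have := hZ.topGroup
  have := hX.topGroup
  have := hY.topGroup
  have hLC : LocallyConvexSpace ℝ (ProjTensor X Y) := (isLCTopology_finestLC _ _).2.2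
  rw [IsTopologicalAddGroup.isInducing_iff_nhds_zero]
  refine le_antisymm ?_ fun U hU => ?_
  · exact map_le_iff_le_comap.1 ((continuous_projLift hX hY hZ h).tendsto' 0 0 (map_zero _))
  obtain ⟨p, hp, hpU⟩ := exists_continuous_seminorm hU
  have hV : {z : X × Y | p (ptmul z.1 z.2) < 1} ∈ 𝓝 ((0, 0) : X × Y) := by
    refine (isOpen_lt (hp.comp (continuous_ptmul X Y)) continuous_const).mem_nhds ?_
    simp [← ptmulBilin_apply]
  rw [nhds_prod_eq, mem_prod_iff] at hV
  obtain ⟨A, hA, B, hB, hAB⟩ := hV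
  obtain ⟨v, hv, ε, hε, hvA⟩ := (hX.mem_nhds_zero _).1 hA
  obtain ⟨w, hw, δ, hδ, hwB⟩ := (hY.mem_nhds_zero _).1 hB
  have hbd : ∀ i j, p (ptmul (hX.coord i) (hY.coord j)) ≤ (ε * δ)⁻¹ * (v i * w j) := by
    -- The bound by one on a product of balls is made homogeneous first in `x`, with `y` in its
    -- ball, and then in `y`.
    have h1 : ∀ y, hY.seminorm ⟨w, hw⟩ y < δ → ∀ x,
        p (ptmul x y) ≤ 1 / ε * hX.seminorm ⟨v, hv⟩ x := fun y hy x =>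
      seminorm_le_of_forall_lt (p := p.comp ((ptmulBilin X Y).flip y)) hε
        (fun x' hx' => (hAB (mk_mem_prod (hvA hx') (hwB hy)) : p _ < 1).le) x
    have h2 : ∀ x y, p (ptmul x y) ≤ 1 / ε * hX.seminorm ⟨v, hv⟩ x / δ * hY.seminorm ⟨w, hw⟩ y :=
      fun x => seminorm_le_of_forall_lt (p := p.comp (ptmulBilin X Y x)) hδ
        (fun y' hy' => h1 y' hy' x)
    intro i j
    refine (h2 _ _).trans (le_of_eq ?_)
    rw [seminorm_coord, seminorm_coord]
    field_simp
  obtain ⟨r, hr, C, hC⟩ := h' v hv w hw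
  have hmain : ∀ z, p z ≤ (ε * δ)⁻¹ * |C| *
      hZ.seminorm ⟨r, hr⟩ (projLift (tensorBilin hX hY hZ h) z) := by
    intro z
    set a := TZ (projLift (tensorBilin hX hY hZ h) z) with ha
    refine le_of_tendsto ((hp.tendsto z).comp (tendsto_partial_tensor hX hY hZ h z))
      (Eventually.of_forall fun s => ?_)
    have hsum := hZ.summable (projLift (tensorBilin hX hY hZ h) z) hr
    have hsum' := e.summable_iff.2 hsum
    calc p (∑ i ∈ s.1, ∑ j ∈ s.2, a (e (i, j)) • ptmul (hX.coord i) (hY.coord j))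
        ≤ ∑ i ∈ s.1, ∑ j ∈ s.2, p (a (e (i, j)) • ptmul (hX.coord i) (hY.coord j)) := by
          refine (Finset.le_sum_of_subadditive p (map_zero p).le (map_add_le_add p) _ _).trans
            (Finset.sum_le_sum fun i _ => ?_)
          exact Finset.le_sum_of_subadditive p (map_zero p).le (map_add_le_add p) _ _
      _ ≤ ∑ i ∈ s.1, ∑ j ∈ s.2, (ε * δ)⁻¹ * |C| * (‖a (e (i, j))‖ * r (e (i, j))) := by
          refine Finset.sum_le_sum fun i _ => Finset.sum_le_sum fun j _ => ?_
          rw [map_smul_eq_mul]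
          have h3 : v i * w j ≤ |C| * r (e (i, j)) :=
            (hC i j).trans (mul_le_mul_of_nonneg_right (le_abs_self C) (hZ.nonneg r hr _))
          calc ‖a (e (i, j))‖ * p (ptmul (hX.coord i) (hY.coord j))
              ≤ ‖a (e (i, j))‖ * ((ε * δ)⁻¹ * (|C| * r (e (i, j)))) := by
                refine mul_le_mul_of_nonneg_left ((hbd i j).trans ?_) (norm_nonneg _)
                exact mul_le_mul_of_nonneg_left h3 (by positivity)
            _ = _ := by ring
      _ = (ε * δ)⁻¹ * |C| * ∑ z ∈ s.1 ×ˢ s.2, ‖a (e z)‖ * r (e z) := by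
          rw [Finset.sum_product, Finset.mul_sum]
          simp_rw [Finset.mul_sum]
      _ ≤ (ε * δ)⁻¹ * |C| * ∑' z, ‖a (e z)‖ * r (e z) := by
          refine mul_le_mul_of_nonneg_left ?_ (by positivity)
          exact hsum'.sum_le_tsum _ fun z _ => mul_nonneg (norm_nonneg _) (hZ.nonneg r hr _)
      _ = _ := by rw [e.tsum_eq (fun k => ‖a k‖ * r k)]; rfl
  set D := (ε * δ)⁻¹ * |C| with hD
  have hD0 : 0 ≤ D := by positivity
  -- `D + 1` because `D` may be zero.
  refine ⟨{z | hZ.seminorm ⟨r, hr⟩ z < (D + 1)⁻¹},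
    (hZ.mem_nhds_zero _).2 ⟨r, hr, _, by positivity, fun x hx => hx⟩, fun z hz => hpU ?_⟩
  have hz' : hZ.seminorm ⟨r, hr⟩ (projLift (tensorBilin hX hY hZ h) z) < (D + 1)⁻¹ := hz
  refine (hmain z).trans_lt ?_
  calc _ ≤ D * (D + 1)⁻¹ := mul_le_mul_of_nonneg_left hz'.le hD0
    _ < 1 := by rw [← div_eq_mul_inv, div_lt_one (by positivity)]; linarith

lemma denseRange_projLift (h : DominatedByProd e P Q R) :
    DenseRange (projLift (tensorBilin hX hY hZ h)) := by
  intro z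
  have := hZ.hasSum_coord z
  rw [HasSum, SummationFilter.unconditional_filter] at this
  refine mem_closure_of_tendsto this (Eventually.of_forall fun s => ?_)
  refine Submodule.sum_mem (LinearMap.range (projLift (tensorBilin hX hY hZ h))) fun k _ => ?_
  refine Submodule.smul_mem _ _ ⟨ptmul (hX.coord (e.symm k).1) (hY.coord (e.symm k).2), ?_⟩
  rw [projLift_ptmul]
  refine hZ.inj (funext fun l => ?_)
  obtain ⟨⟨i, j⟩, rfl⟩ := e.surjective l
  obtain ⟨⟨i', j'⟩, rfl⟩ := e.surjective k
  rw [map_tensorBilin, hX.map_coord, hY.map_coord, hZ.map_coord]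
  simp only [Equiv.symm_apply_apply, Set.indicator, mem_singleton_iff, EmbeddingLike.apply_eq_iff_eq,
    Prod.mk.injEq, Pi.one_apply]
  by_cases h1 : i = i' <;> by_cases h2 : j = j' <;> simp [h1, h2]

include hX hY hZ in
/-- The completed projective tensor product of two Köthe spaces is a Köthe space. -/
theorem exists_tensorEquiv (h : DominatedByProd e P Q R) (h' : DominatesProd e P Q R) :
    ∃ Φ : CTensor X Y ≃L[ℂ] Z, ∀ x y i j, TZ (Φ (ctmul x y)) (e (i, j)) = T x i * TY y j := by
  have := hZ.topGroup
  let _ : UniformSpace Z := IsTopologicalAddGroup.rightUniformSpace Z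
  have : IsUniformAddGroup Z := isUniformAddGroup_of_addCommGroup
  have := hZ.continuousSMul
  have := uniformContinuousConstSMul_of_continuousConstSMul ℂ Z
  have := hZ.completeSpace
  have := hZ.t2Space
  let B : ProjTensor X Y →L[ℂ] Z := ⟨projLift (tensorBilin hX hY hZ h),
    continuous_projLift hX hY hZ h⟩
  have hBi : IsUniformInducing B := by
    refine ⟨?_⟩
    rw [uniformity_eq_comap_nhds_zero, uniformity_eq_comap_nhds_zero, comap_comap,
      (IsTopologicalAddGroup.isInducing_iff_nhds_zero
        (f := projLift (tensorBilin hX hY hZ h))).1 (isInducing_projLift hX hY hZ h h'),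
      comap_comap]
    congr 1
    funext p
    exact (map_sub (projLift (tensorBilin hX hY hZ h)) p.2 p.1).symm
  -- `Z` is complete, Hausdorff and contains a dense image of the tensor product with the right
  -- uniformity, so it is itself a Hausdorff completion. Uniqueness of completions gives the
  -- homeomorphism, and the continuous extension of `B`, which agrees with it, gives linearity.
  let pkg : AbstractCompletion (ProjTensor X Y) :=
    { space := Z
      coe := B
      uniformStruct := inferInstance
      complete := inferInstance
      separation := inferInstance
      isUniformInducing := hBi
      dense := denseRange_projLift hX hY hZ h }
  let E : CTensor X Y ≃ᵤ Z := UniformSpace.Completion.cPkg.compareEquiv pkg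
  have hE : (E : CTensor X Y → Z) = B.fromCompletion := by
    refine UniformSpace.Completion.ext E.continuous B.fromCompletion.continuous fun a => ?_
    rw [ContinuousLinearMap.fromCompletion_apply_coe]
    exact UniformSpace.Completion.cPkg.compare_coe pkg a
  refine ⟨⟨⟨B.fromCompletion.toLinearMap, E.symm, fun x => ?_, fun x => ?_⟩,
    B.fromCompletion.continuous, E.symm.continuous⟩, fun x y i j => ?_⟩
  · exact (congrArg E.symm (congrFun hE x).symm).trans (E.symm_apply_apply x)
  · exact (congrFun hE _).symm.trans (E.apply_symm_apply x)
  · have h1 : B.fromCompletion (ctmul x y) = tensorBilin hX hY hZ h x y := by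
      rw [ctmul, ContinuousLinearMap.fromCompletion_apply_coe]
      exact projLift_ptmul _ x y
    have h2 := map_tensorBilin hX hY hZ h x y i j
    rw [← h1] at h2
    exact h2

end IsKothe

end

/-! ### Strong duals of Köthe spaces -/

section

variable {I J K X Y Z : Type*}
  [AddCommGroup X] [Module ℂ X] [TopologicalSpace X]
  [AddCommGroup Y] [Module ℂ Y] [TopologicalSpace Y]
  [AddCommGroup Z] [Module ℂ Z] [TopologicalSpace Z]
  {T : X →ₗ[ℂ] I → ℂ} {P : Set (I → ℝ)} {TY : Y →ₗ[ℂ] J → ℂ} {Q : Set (J → ℝ)}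
  {TZ : Z →ₗ[ℂ] K → ℂ} {R : Set (K → ℝ)}

/-- Every weight is a summable multiple of another one (the Grothendieck–Pietsch condition). -/
def IsNuclearWeights (P : Set (I → ℝ)) : Prop :=
  ∀ v ∈ P, ∃ w ∈ P, ∃ c : I → ℝ, Summable c ∧ ∀ i, v i ≤ c i * w i

/-- A sequence which is summable against the Köthe dual is dominated by a weight. -/
def IsReflexiveWeights (P : Set (I → ℝ)) : Prop :=
  ∀ u : I → ℝ, (∀ i, 0 ≤ u i) → (∀ b ∈ kotheDual P, Summable fun i => u i * b i) →
    ∃ v ∈ P, ∃ C : ℝ, ∀ i, u i ≤ C * v i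

namespace IsKothe

/-- The coefficients of a functional. -/
def dualCoeff (hX : IsKothe T P) : StrongDual ℂ X →ₗ[ℂ] I → ℂ where
  toFun u i := u (hX.coord i)
  map_add' _ _ := rfl
  map_smul' _ _ := rfl

lemma dualCoeff_apply (hX : IsKothe T P) (u : StrongDual ℂ X) (i : I) :
    hX.dualCoeff u i = u (hX.coord i) := rfl

lemma hasSum_dualCoeff (hX : IsKothe T P) (u : StrongDual ℂ X) (x : X) :
    HasSum (fun i => hX.dualCoeff u i * T x i) (u x) := by
  have := (hX.hasSum_coord x).mapL u
  simpa [dualCoeff_apply, mul_comm] using this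

lemma exists_dualCoeff_le (hX : IsKothe T P) (u : StrongDual ℂ X) :
    ∃ v ∈ P, ∃ C : ℝ, 0 ≤ C ∧ ∀ i, ‖hX.dualCoeff u i‖ ≤ C * v i := by
  obtain ⟨v, hv, C, hC, h⟩ := hX.exists_bound_of_continuous
    (p := (normSeminorm ℂ ℂ).comp u.toLinearMap) (continuous_norm.comp u.continuous)
  refine ⟨v, hv, C, hC, fun i => ?_⟩
  have := h (hX.coord i)
  rwa [← hX.seminorm_apply ⟨v, hv⟩, seminorm_coord] at this

/-- The functional with given coefficients. -/
lemma exists_functional (hX : IsKothe T P) {a : I → ℂ} {v : I → ℝ} (hv : v ∈ P) {C : ℝ}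
    (ha : ∀ i, ‖a i‖ ≤ C * v i) : ∃ u, hX.dualCoeff u = a := by
  have hle : ∀ x i, ‖a i * T x i‖ ≤ C * (‖T x i‖ * v i) := fun x i => by
    rw [norm_mul]
    calc ‖a i‖ * ‖T x i‖ ≤ C * v i * ‖T x i‖ :=
          mul_le_mul_of_nonneg_right (ha i) (norm_nonneg _)
      _ = _ := by ring
  have hs : ∀ x, Summable fun i => a i * T x i := fun x =>
    Summable.of_norm_bounded ((hX.summable x hv).mul_left C) (hle x)
  let f : X →ₗ[ℂ] ℂ :=
    { toFun := fun x => ∑' i, a i * T x i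
      map_add' := fun x y => by
        rw [← (hs x).tsum_add (hs y)]
        simp [mul_add]
      map_smul' := fun c x => by
        rw [RingHom.id_apply, smul_eq_mul, ← tsum_mul_left]
        simp [mul_left_comm] }
  have := hX.topGroup
  have hf : Continuous f := by
    refine continuous_of_continuousAt_zero f ?_
    rw [ContinuousAt, map_zero]
    refine squeeze_zero_norm (a := fun x => C * hX.seminorm ⟨v, hv⟩ x) (fun x => ?_) ?_
    · rw [seminorm_apply, ← tsum_mul_left]
      exact tsum_of_norm_bounded ((hX.summable x hv).mul_left C).hasSum (hle x)
    · have := (hX.withSeminorms.continuous_seminorm ⟨v, hv⟩).const_mul C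
      exact this.tendsto' 0 0 (by simp)
  refine ⟨⟨f, hf⟩, funext fun i => ?_⟩
  change ∑' j, a j * T (hX.coord i) j = a i
  rw [tsum_eq_single i (fun j hj => by simp [hX.map_coord_ne hj]), hX.map_coord_self, mul_one]

lemma exists_phase (z : ℂ) : ∃ c : ℂ, ‖c‖ = 1 ∧ z * c = ‖z‖ := by
  by_cases h : z = 0
  · exact ⟨1, by simp, by simp [h]⟩
  · refine ⟨(‖z‖ : ℂ) / z, ?_, ?_⟩
    · rw [norm_div, Complex.norm_real, norm_norm, div_self (norm_ne_zero_iff.2 h)]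
    · field_simp

/-- The strong dual of a Köthe space with nuclear and reflexive weights is the Köthe space of the
dual weights. -/
theorem dual (hX : IsKothe T P) (hn : IsNuclearWeights P) (hr : IsReflexiveWeights P) :
    IsKothe hX.dualCoeff (kotheDual P) where
  topGroup := inferInstance
  nonneg b hb := hb.1
  pos i := by
    classical
    refine ⟨Pi.single i 1, ⟨fun j => ?_, fun v _ => ?_⟩, by simp⟩
    · by_cases h : j = i
      · subst h; simp
      · simp [h]
    · refine summable_of_ne_finset_zero (s := {i}) fun j hj => ?_
      rw [Pi.single_eq_of_ne (by simpa using hj), zero_mul]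
  inj := by
    intro u u' h
    ext x
    rw [← (hX.hasSum_dualCoeff u x).tsum_eq, h, (hX.hasSum_dualCoeff u' x).tsum_eq]
  exists_iff a := by
    constructor
    · rintro ⟨u, rfl⟩ b hb
      obtain ⟨v, hv, C, hC, h⟩ := hX.exists_dualCoeff_le u
      refine Summable.of_nonneg_of_le (fun i => mul_nonneg (norm_nonneg _) (hb.1 i)) (fun i => ?_)
        ((hb.2 v hv).mul_left C)
      calc ‖hX.dualCoeff u i‖ * b i ≤ C * v i * b i := mul_le_mul_of_nonneg_right (h i) (hb.1 i)
        _ = _ := by ring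
    · intro h
      -- Reflexivity turns summability against the Köthe dual into domination by a weight, which is
      -- exactly continuity of the functional with coefficients `a`.
      obtain ⟨v, hv, C, hC⟩ := hr (fun i => ‖a i‖) (fun i => norm_nonneg _) h
      exact hX.exists_functional hv hC
  mem_nhds_zero U := by
    have := hX.topGroup
    have := hX.continuousSMul
    constructor
    · intro hU
      obtain ⟨⟨S, V⟩, ⟨hS, hV⟩, hSV⟩ :=
        (ContinuousLinearMap.hasBasis_nhds_zero (𝕜₁ := ℂ) (𝕜₂ := ℂ) (σ := RingHom.id ℂ)
          (E := X) (F := ℂ)).mem_iff.1 hU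
      obtain ⟨ε, hε, hεV⟩ := Metric.mem_nhds_iff.1 hV
      have hb0 : ∀ v : P, ∃ M : ℝ, 0 < M ∧ ∀ x ∈ S, hX.seminorm v x < M := fun v =>
        hX.withSeminorms.isVonNBounded_iff_seminorm_bounded.1 hS v
      have hterm : ∀ (v : P) (x : X) (i : I), ‖T x i‖ * v.1 i ≤ hX.seminorm v x := fun v x i =>
        (hX.summable x v.2).le_tsum i fun j _ =>
          mul_nonneg (norm_nonneg _) (hX.nonneg v v.2 j)
      have hbdd : ∀ i, BddAbove (range fun x : S => ‖T x.1 i‖) := by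
        intro i
        obtain ⟨v, hv, hvi⟩ := hX.pos i
        obtain ⟨M, hM, h⟩ := hb0 ⟨v, hv⟩
        refine ⟨M / v i, ?_⟩
        rintro _ ⟨x, rfl⟩
        rw [le_div_iff₀ hvi]
        exact (hterm ⟨v, hv⟩ x i).trans (h x x.2).le
      -- The coordinatewise envelope of the bounded set `S`. If it belongs to the Köthe dual, its
      -- weighted seminorm controls functionals uniformly on `S`.
      set b : I → ℝ := fun i => ⨆ x : S, ‖T x.1 i‖ with hb
      have hb_nonneg : ∀ i, 0 ≤ b i := fun i => Real.iSup_nonneg fun x => norm_nonneg _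
      have hbP : b ∈ kotheDual P := by
        refine ⟨hb_nonneg, fun v hv => ?_⟩
        -- Boundedness of `S` only gives `sup b_i w_i < ∞`. Nuclearity upgrades this to summability
        -- of `b_i v_i`.
        obtain ⟨w, hw, c, hc, hvw⟩ := hn v hv
        obtain ⟨M, hM, h⟩ := hb0 ⟨w, hw⟩
        have hbw : ∀ i, b i * w i ≤ M := by
          intro i
          rw [hb, Real.iSup_mul_of_nonneg (hX.nonneg w hw i)]
          refine Real.iSup_le (fun x => ?_) hM.le
          exact (hterm ⟨w, hw⟩ x i).trans (h x x.2).le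
        refine Summable.of_nonneg_of_le (fun i => mul_nonneg (hb_nonneg i) (hX.nonneg v hv i))
          (fun i => ?_) (hc.norm.mul_left M)
        calc b i * v i ≤ b i * (‖c i‖ * w i) := by
              refine mul_le_mul_of_nonneg_left ((hvw i).trans ?_) (hb_nonneg i)
              exact mul_le_mul_of_nonneg_right (le_abs_self _) (hX.nonneg w hw i)
          _ = (b i * w i) * ‖c i‖ := by ring
          _ ≤ M * ‖c i‖ := mul_le_mul_of_nonneg_right (hbw i) (norm_nonneg _)
      refine ⟨b, hbP, ε, hε, fun u hu => hSV fun x hx => hεV ?_⟩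
      rw [mem_ball_zero_iff]
      refine lt_of_le_of_lt ?_ (show ∑' i, ‖hX.dualCoeff u i‖ * b i < ε from hu)
      obtain ⟨v, hv, C, hC, h⟩ := hX.exists_dualCoeff_le u
      have hs : Summable fun i => ‖hX.dualCoeff u i‖ * b i := by
        refine Summable.of_nonneg_of_le (fun i => mul_nonneg (norm_nonneg _) (hb_nonneg i))
          (fun i => ?_) ((hbP.2 v hv).mul_left C)
        calc ‖hX.dualCoeff u i‖ * b i ≤ C * v i * b i :=
              mul_le_mul_of_nonneg_right (h i) (hb_nonneg i)
          _ = _ := by ring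
      rw [← (hX.hasSum_dualCoeff u x).tsum_eq]
      refine tsum_of_norm_bounded hs.hasSum fun i => ?_
      rw [norm_mul]
      exact mul_le_mul_of_nonneg_left (le_ciSup (hbdd i) ⟨x, hx⟩) (norm_nonneg _)
    -- Conversely, the box `|x_i| ≤ b_i` is a bounded set. On it the supremum of `|u|` is attained
    -- at the element whose phases cancel those of the coefficients of `u`, with value the
    -- `ℓ¹`-seminorm of `u`.
    · rintro ⟨b, hb, ε, hε, hU⟩
      refine mem_of_superset ?_ hU
      refine (ContinuousLinearMap.hasBasis_nhds_zero (𝕜₁ := ℂ) (𝕜₂ := ℂ) (σ := RingHom.id ℂ)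
          (E := X) (F := ℂ)).mem_iff.2
        ⟨⟨{x | ∀ i, ‖T x i‖ ≤ b i}, Metric.ball 0 ε⟩, ⟨?_, Metric.ball_mem_nhds _ hε⟩, ?_⟩
      · refine hX.withSeminorms.isVonNBounded_iff_seminorm_bounded.2 fun v => ?_
        refine ⟨(∑' i, b i * v.1 i) + 1, ?_, fun x hx => ?_⟩
        · have : 0 ≤ ∑' i, b i * v.1 i :=
            tsum_nonneg fun i => mul_nonneg (hb.1 i) (hX.nonneg v v.2 i)
          linarith
        · refine lt_of_le_of_lt ?_ (lt_add_one _)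
          exact (hX.summable x v.2).tsum_le_tsum
            (fun i => mul_le_mul_of_nonneg_right (hx i) (hX.nonneg v v.2 i)) (hb.2 v v.2)
      · intro u hu
        choose c hc1 hc2 using fun i => exists_phase (hX.dualCoeff u i)
        have hnorm : ∀ i, ‖c i * b i‖ = b i := fun i => by
          rw [norm_mul, hc1, one_mul, Complex.norm_real, Real.norm_of_nonneg (hb.1 i)]
        obtain ⟨x, hx⟩ := (hX.exists_iff fun i => c i * b i).2 fun v hv => by
          simpa only [hnorm] using hb.2 v hv
        have hux : ‖u x‖ < ε := by
          have := hu x (show ∀ i, ‖T x i‖ ≤ b i from fun i => by rw [hx, hnorm])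
          simpa using this
        have hterm : ∀ i, hX.dualCoeff u i * T x i = ((‖hX.dualCoeff u i‖ * b i : ℝ) : ℂ) := by
          intro i
          rw [hx, ← mul_assoc, hc2]
          push_cast
          rfl
        have h1 := (hX.hasSum_dualCoeff u x).tsum_eq
        simp only [hterm, ← Complex.ofReal_tsum] at h1
        rw [← h1, Complex.norm_real] at hux
        exact (le_abs_self _).trans_lt hux

/-- Duality reverses domination: when the weights in `R` are dominated by products, the product of
two dual weights is summable against `R` and is therefore itself a dual weight. -/
lemma dominatesProd_dual {e : I × J ≃ K} (h : DominatedByProd e P Q R)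
    (hP : ∀ v ∈ P, ∀ i, 0 ≤ v i) (hQ : ∀ v ∈ Q, ∀ i, 0 ≤ v i) (hR : ∀ v ∈ R, ∀ i, 0 ≤ v i) :
    DominatesProd e (kotheDual P) (kotheDual Q) (kotheDual R) := by
  intro b hb b' hb'
  refine ⟨fun k => b (e.symm k).1 * b' (e.symm k).2, ⟨fun k => mul_nonneg (hb.1 _) (hb'.1 _), ?_⟩,
    1, fun i j => by simp⟩
  intro r hr
  obtain ⟨p, hp, q, hq, C, hC⟩ := h r hr
  refine e.summable_iff.1 ?_
  have hs : Summable fun z : I × J => (b z.1 * p z.1) * (b' z.2 * q z.2) :=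
    (hb.2 p hp).mul_of_nonneg (hb'.2 q hq) (fun i => mul_nonneg (hb.1 i) (hP p hp i))
      (fun i => mul_nonneg (hb'.1 i) (hQ q hq i))
  refine Summable.of_nonneg_of_le (fun z => mul_nonneg (mul_nonneg (hb.1 _) (hb'.1 _)) (hR r hr _))
    (fun z => ?_) (hs.mul_left C)
  obtain ⟨i, j⟩ := z
  simp only [Function.comp, Equiv.symm_apply_apply]
  calc b i * b' j * r (e (i, j)) ≤ b i * b' j * (C * (p i * q j)) :=
        mul_le_mul_of_nonneg_left (hC i j) (mul_nonneg (hb.1 _) (hb'.1 _))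
    _ = _ := by ring

/-- The pairing of a functional with a vector is the sum of products of coefficients. For tensors
this double series is the product of two series. -/
lemma apply_eq_mul_of_coeff (hX : IsKothe T P) (hY : IsKothe TY Q) (hZ : IsKothe TZ R)
    {e : I × J ≃ K} {u : StrongDual ℂ X} {v : StrongDual ℂ Y} {x : X} {y : Y}
    {w : StrongDual ℂ Z} {z : Z}
    (hw : ∀ i j, hZ.dualCoeff w (e (i, j)) = hX.dualCoeff u i * hY.dualCoeff v j)
    (hz : ∀ i j, TZ z (e (i, j)) = T x i * TY y j) : w z = u x * v y := by
  have h1 := (e.hasSum_iff).2 (hZ.hasSum_dualCoeff w z)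
  have h2 : ((fun k => hZ.dualCoeff w k * TZ z k) ∘ e) = fun p : I × J =>
      (hX.dualCoeff u p.1 * T x p.1) * (hY.dualCoeff v p.2 * TY y p.2) := by
    funext ⟨i, j⟩
    rw [Function.comp_apply, hw, hz]
    ring
  rw [h2] at h1
  have h3 := (hX.hasSum_dualCoeff u x).mul (hY.hasSum_dualCoeff v y) h1.summable
  have key : ∀ {f : I × J → ℂ} {a b : ℂ}, HasSum f a → HasSum f b → a = b :=
    fun h h' => h.unique h'
  exact key h1 h3

/-- Kernel theorem for a pair of Köthe spaces and their strong duals. -/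
theorem exists_tensorEquiv_and_dual (hX : IsKothe T P) (hY : IsKothe TY Q) (hZ : IsKothe TZ R)
    {e : I × J ≃ K} (h : DominatedByProd e P Q R) (h' : DominatesProd e P Q R)
    (hd : DominatedByProd e (kotheDual P) (kotheDual Q) (kotheDual R))
    (nP : IsNuclearWeights P) (nQ : IsNuclearWeights Q) (nR : IsNuclearWeights R)
    (rP : IsReflexiveWeights P) (rQ : IsReflexiveWeights Q) (rR : IsReflexiveWeights R) :
    ∃ (Φ : CTensor X Y ≃L[ℂ] Z)
      (Ψ : CTensor (StrongDual ℂ X) (StrongDual ℂ Y) ≃L[ℂ] StrongDual ℂ Z),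
      (∀ x y i j, TZ (Φ (ctmul x y)) (e (i, j)) = T x i * TY y j) ∧
      ∀ u v x y, Ψ (ctmul u v) (Φ (ctmul x y)) = u x * v y := by
  obtain ⟨Φ, hΦ⟩ := exists_tensorEquiv hX hY hZ h h'
  obtain ⟨Ψ, hΨ⟩ := exists_tensorEquiv (hX.dual nP rP) (hY.dual nQ rQ) (hZ.dual nR rR) hd
    (dominatesProd_dual h hX.nonneg hY.nonneg hZ.nonneg)
  exact ⟨Φ, Ψ, hΦ, fun u v x y => apply_eq_mul_of_coeff hX hY hZ (hΨ u v) (hΦ x y)⟩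

end IsKothe

end

/-! ### Exponential weights on multi-indices -/

/-- The degree of a multi-index. -/
def deg {d : ℕ} (n : Fin d → ℕ) : ℕ := ∑ i, n i

/-- The weight `exp (s |n|^β)`. -/
def wt (β s : ℝ) {d : ℕ} (n : Fin d → ℕ) : ℝ := Real.exp (s * (deg n : ℝ) ^ β)

/-- The summable weight `∏ (1 + n_i)⁻²`. -/
def polyWt {d : ℕ} (n : Fin d → ℕ) : ℝ := ∏ i, ((1 + n i : ℝ) ^ 2)⁻¹

lemma polyWt_pos {d : ℕ} (n : Fin d → ℕ) : 0 < polyWt n :=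
  Finset.prod_pos fun i _ => by positivity

/-- A finite set of multi-indices lies in a box, over which the sum factors. -/
lemma summable_fin_prod {d : ℕ} {f : ℕ → ℝ} (hf : Summable f) (h0 : ∀ k, 0 ≤ f k) :
    Summable fun n : Fin d → ℕ => ∏ i, f (n i) := by
  refine summable_of_sum_le (c := (∑' k, f k) ^ d) (fun n => Finset.prod_nonneg fun i _ => h0 _)
    fun s => ?_
  have hs : s ⊆ Fintype.piFinset fun i => s.image fun n => n i := fun n hn =>
    Fintype.mem_piFinset.2 fun i => Finset.mem_image_of_mem _ hn
  calc ∑ n ∈ s, ∏ i, f (n i)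
      ≤ ∑ n ∈ Fintype.piFinset fun i => s.image fun n => n i, ∏ i, f (n i) :=
        Finset.sum_le_sum_of_subset_of_nonneg hs fun n _ _ => Finset.prod_nonneg fun i _ => h0 _
    _ = ∏ i, ∑ k ∈ s.image fun n => n i, f k := (Finset.prod_univ_sum _ _).symm
    _ ≤ ∏ _i : Fin d, ∑' k, f k := Finset.prod_le_prod
        (fun i _ => Finset.sum_nonneg fun k _ => h0 k)
        fun i _ => hf.sum_le_tsum _ fun k _ => h0 k
    _ = _ := by simp

lemma summable_inv_one_add_sq : Summable fun k : ℕ => ((1 + k : ℝ) ^ 2)⁻¹ := by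
  have := (summable_nat_add_iff 1).2 (Real.summable_nat_pow_inv.2 (show 1 < 2 by norm_num))
  simpa [add_comm] using this

lemma summable_polyWt (d : ℕ) : Summable (polyWt (d := d)) :=
  summable_fin_prod (d := d) (f := fun k => ((1 + k : ℝ) ^ 2)⁻¹) summable_inv_one_add_sq
    fun k => by positivity

lemma wt_pos (β s : ℝ) {d : ℕ} (n : Fin d → ℕ) : 0 < wt β s n := Real.exp_pos _

lemma wt_mul (β s t : ℝ) {d : ℕ} (n : Fin d → ℕ) : wt β s n * wt β t n = wt β (s + t) n := by
  rw [wt, wt, wt, ← Real.exp_add, add_mul]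

lemma wt_mono (β : ℝ) {s t : ℝ} (h : s ≤ t) {d : ℕ} (n : Fin d → ℕ) : wt β s n ≤ wt β t n :=
  Real.exp_le_exp.2 (mul_le_mul_of_nonneg_right h (by positivity))

lemma wt_zero (β : ℝ) {d : ℕ} (n : Fin d → ℕ) : wt β 0 n = 1 := by simp [wt]

lemma le_deg {d : ℕ} (n : Fin d → ℕ) (i : Fin d) : n i ≤ deg n :=
  Finset.single_le_sum (fun _ _ => Nat.zero_le _) (Finset.mem_univ i)

lemma exists_one_add_pow_le_exp {β s : ℝ} (hβ : 0 < β) (hs : 0 < s) (K : ℕ) :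
    ∃ C : ℝ, 0 < C ∧ ∀ t : ℕ, (1 + t : ℝ) ^ K ≤ C * Real.exp (s * (t : ℝ) ^ β) := by
  have h1 : Tendsto (fun t : ℕ => ((t : ℝ) ^ β) ^ (K / β) * Real.exp (-s * (t : ℝ) ^ β)) atTop
      (𝓝 0) :=
    (tendsto_rpow_mul_exp_neg_mul_atTop_nhds_zero (K / β) s hs).comp
      ((tendsto_rpow_atTop hβ).comp tendsto_natCast_atTop_atTop)
  obtain ⟨C, hC⟩ := h1.bddAbove_range
  refine ⟨2 ^ K * |C| + 1, by positivity, fun t => ?_⟩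
  -- The estimate `1 + t ≤ 2 t` used below needs `t ≥ 1`.
  rcases Nat.eq_zero_or_pos t with rfl | ht
  · have : (1 : ℝ) ≤ Real.exp (s * ((0 : ℕ) : ℝ) ^ β) := Real.one_le_exp (by positivity)
    simp only [Nat.cast_zero, add_zero, one_pow] at this ⊢
    have h0 : 0 ≤ 2 ^ K * |C| := by positivity
    nlinarith
  · have ht1 : (1 : ℝ) ≤ t := by exact_mod_cast ht
    have h2 := hC (mem_range_self t)
    beta_reduce at h2
    rw [← Real.rpow_mul (by positivity), mul_div_cancel₀ _ hβ.ne', Real.rpow_natCast, neg_mul,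
      Real.exp_neg, ← div_eq_mul_inv, div_le_iff₀ (Real.exp_pos _)] at h2
    calc (1 + t : ℝ) ^ K ≤ (2 * t) ^ K := by gcongr; linarith
      _ = 2 ^ K * t ^ K := mul_pow _ _ _
      _ ≤ 2 ^ K * (|C| * Real.exp (s * (t : ℝ) ^ β)) := by
          gcongr
          exact h2.trans (mul_le_mul_of_nonneg_right (le_abs_self C) (Real.exp_pos _).le)
      _ ≤ _ := by
          have := Real.exp_pos (s * (t : ℝ) ^ β)
          nlinarith

lemma inv_polyWt_le {d : ℕ} (n : Fin d → ℕ) : (polyWt n)⁻¹ ≤ (1 + deg n : ℝ) ^ (2 * d) := by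
  rw [polyWt, Finset.prod_inv_distrib, inv_inv]
  calc ∏ i, (1 + n i : ℝ) ^ 2 ≤ ∏ _i : Fin d, (1 + deg n : ℝ) ^ 2 := by
        refine Finset.prod_le_prod (fun i _ => by positivity) fun i _ => ?_
        gcongr
        exact le_deg n i
    _ = _ := by simp [pow_mul]

/-- Polynomial losses are absorbed by an arbitrarily small change of the exponent; nuclearity and
the passage from sup to `ℓ¹` bounds rest on this. -/
lemma exists_one_le_polyWt_mul_wt {β s : ℝ} (hβ : 0 < β) (hs : 0 < s) (d : ℕ) :
    ∃ C : ℝ, 0 < C ∧ ∀ n : Fin d → ℕ, 1 ≤ C * (polyWt n * wt β s n) := by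
  obtain ⟨C, hC0, hC⟩ := exists_one_add_pow_le_exp hβ hs (2 * d)
  refine ⟨C, hC0, fun n => ?_⟩
  have h := (inv_polyWt_le n).trans (hC (deg n))
  rw [inv_le_iff_one_le_mul₀ (polyWt_pos n)] at h
  calc (1 : ℝ) ≤ _ := h
    _ = _ := by rw [wt]; ring

lemma summable_wt {β s : ℝ} (hβ : 0 < β) (hs : s < 0) (d : ℕ) : Summable (wt β s (d := d)) := by
  obtain ⟨C, hC0, hC⟩ := exists_one_le_polyWt_mul_wt hβ (neg_pos.2 hs) d
  refine Summable.of_nonneg_of_le (fun n => (wt_pos β s n).le) (fun n => ?_)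
    ((summable_polyWt d).mul_left C)
  calc wt β s n ≤ C * (polyWt n * wt β (-s) n) * wt β s n :=
        le_mul_of_one_le_left (wt_pos β s n).le (hC n)
    _ = C * polyWt n * (wt β (-s) n * wt β s n) := by ring
    _ = _ := by rw [wt_mul, neg_add_cancel, wt_zero, mul_one]

/-- The weights of the Beurling space. -/
def beurlingWeights (β : ℝ) (d : ℕ) : Set ((Fin d → ℕ) → ℝ) := {v | ∃ s > 0, v = wt β s}

/-- The weights of the Roumieu space. -/
def roumieuWeights (β : ℝ) (d : ℕ) : Set ((Fin d → ℕ) → ℝ) :=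
  {v | (∀ n, 0 ≤ v n) ∧ ∀ s > 0, ∃ C : ℝ, ∀ n, v n ≤ C * wt β s n}

lemma isNuclearWeights_beurling {β : ℝ} (hβ : 0 < β) (d : ℕ) :
    IsNuclearWeights (beurlingWeights β d) := by
  rintro _ ⟨s, hs, rfl⟩
  refine ⟨_, ⟨s + 1, by linarith, rfl⟩, wt β (-1), summable_wt hβ (by norm_num) d, fun n => ?_⟩
  rw [wt_mul]
  exact (congrArg (wt β · n) (by ring : s = -1 + (s + 1))).le

/-- Dividing by the summable `polyWt` keeps a weight in the class: half of each exponent `s` bounds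
`v`, the other half absorbs the polynomial factor. -/
lemma isNuclearWeights_roumieu {β : ℝ} (hβ : 0 < β) (d : ℕ) :
    IsNuclearWeights (roumieuWeights β d) := by
  intro v hv
  refine ⟨fun n => v n / polyWt n, ⟨fun n => div_nonneg (hv.1 n) (polyWt_pos n).le, ?_⟩, polyWt,
    summable_polyWt d, fun n => (mul_div_cancel₀ (v n) (polyWt_pos n).ne').ge⟩
  intro s hs
  obtain ⟨C, hC⟩ := hv.2 (s / 2) (half_pos hs)
  obtain ⟨D, hD0, hD⟩ := exists_one_le_polyWt_mul_wt hβ (half_pos hs) d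
  refine ⟨|C| * D, fun n => ?_⟩
  rw [div_le_iff₀ (polyWt_pos n)]
  have hw := wt_pos β (s / 2) n
  have h1 : v n ≤ |C| * wt β (s / 2) n :=
    (hC n).trans (mul_le_mul_of_nonneg_right (le_abs_self C) hw.le)
  calc v n ≤ |C| * wt β (s / 2) n * 1 := by rwa [mul_one]
    _ ≤ |C| * wt β (s / 2) n * (D * (polyWt n * wt β (s / 2) n)) :=
        mul_le_mul_of_nonneg_left (hD n) (by positivity)
    _ = |C| * D * (wt β (s / 2) n * wt β (s / 2) n) * polyWt n := by ring
    _ = _ := by rw [wt_mul, add_halves]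

/-- If `u` is not dominated by any of the increasing weights `W k`, there is a sequence which
decreases faster than all `1 / W k` and is not summable against `u`. -/
lemma exists_not_summable_of_not_dominated {I : Type*} {W : ℕ → I → ℝ} (hW0 : ∀ k i, 0 < W k i)
    (hW : ∀ i, Monotone fun k => W k i) {u : I → ℝ} (hu : ∀ k, ∀ C : ℝ, ∃ i, C * W k i < u i) :
    ∃ v : I → ℝ, (∀ i, 0 ≤ v i) ∧ (∀ k, ∃ C : ℝ, ∀ i, v i * W k i ≤ C) ∧
      ¬ Summable fun i => u i * v i := by
  classical
  choose n hn using fun k : ℕ => hu k (k + 1)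
  have hupos : ∀ k, 0 < u (n k) := fun k =>
    lt_trans (mul_pos (by positivity) (hW0 k (n k))) (hn k)
  -- On a finite range `u / W 0` would be bounded, but at `n k` it exceeds `k + 1`.
  have hinf : (range n).Infinite := by
    intro hfin
    obtain ⟨M, hM⟩ := (hfin.image fun i => u i / W 0 i).bddAbove
    obtain ⟨k, hk⟩ := exists_nat_gt M
    have h1 := hM (mem_image_of_mem (fun i => u i / W 0 i) (mem_range_self k))
    have h2 : (k + 1 : ℝ) * W 0 (n k) < u (n k) :=
      (mul_le_mul_of_nonneg_left (hW (n k) (Nat.zero_le k)) (by positivity)).trans_lt (hn k)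
    have h3 := (lt_div_iff₀ (hW0 0 (n k))).2 h2
    beta_reduce at h1
    linarith
  -- With `v = 1 / u` on the chosen indices, `u v = 1` infinitely often. At `n j` with `j ≥ k` one
  -- has `v * W k ≤ 1`; the finitely many `j < k` go into the constant.
  refine ⟨(range n).indicator fun i => (u i)⁻¹, fun i => ?_, fun k => ?_, fun hs => ?_⟩
  · refine indicator_nonneg ?_ i
    rintro _ ⟨k, rfl⟩
    exact (inv_pos.2 (hupos k)).le
  · have hterm : ∀ j, 0 ≤ (u (n j))⁻¹ * W k (n j) := fun j =>
      mul_nonneg (inv_pos.2 (hupos j)).le (hW0 k _).le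
    have hsum0 : 0 ≤ ∑ j ∈ Finset.range k, (u (n j))⁻¹ * W k (n j) :=
      Finset.sum_nonneg fun j _ => hterm j
    refine ⟨1 + ∑ j ∈ Finset.range k, (u (n j))⁻¹ * W k (n j), fun i => ?_⟩
    by_cases hi : i ∈ range n
    · rw [indicator_of_mem hi]
      obtain ⟨j, rfl⟩ := hi
      rcases lt_or_ge j k with hj | hj
      · have := Finset.single_le_sum (f := fun j => (u (n j))⁻¹ * W k (n j))
          (fun j _ => hterm j) (Finset.mem_range.2 hj)
        beta_reduce at this
        linarith
      · refine le_trans ?_ (le_add_of_nonneg_right hsum0)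
        rw [inv_mul_le_iff₀ (hupos j), mul_one]
        refine le_trans ?_ (hn j).le
        refine (hW (n j) hj).trans (le_mul_of_one_le_left (hW0 j _).le ?_)
        have : (0 : ℝ) ≤ j := by positivity
        linarith
    · rw [indicator_of_notMem hi, zero_mul]
      linarith
  · have h := hs.tendsto_cofinite_zero.eventually (gt_mem_nhds (zero_lt_one' ℝ))
    refine hinf (Set.Finite.subset h fun i hi => ?_)
    change ¬ (u i * (range n).indicator (fun i => (u i)⁻¹) i < 1)
    rw [indicator_of_mem hi]
    obtain ⟨k, rfl⟩ := hi
    rw [mul_inv_cancel₀ (hupos k).ne']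
    exact lt_irrefl 1

lemma mul_wt_le_iff {β s C x : ℝ} {d : ℕ} {n : Fin d → ℕ} :
    x * wt β s n ≤ C ↔ x ≤ C * wt β (-s) n := by
  have h : wt β (-s) n = (wt β s n)⁻¹ := by rw [wt, wt, ← Real.exp_neg, neg_mul]
  rw [h, ← div_eq_mul_inv, le_div_iff₀ (wt_pos β s n)]

/-- The exponent `s + 1` in place of `s` leaves a summable factor `exp(-|n|^β)`. Together with the
next lemma this describes the Köthe dual by decay at every rate. -/
lemma mem_kotheDual_beurling {β : ℝ} (hβ : 0 < β) {d : ℕ} {b : (Fin d → ℕ) → ℝ}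
    (h0 : ∀ n, 0 ≤ b n) (h : ∀ s : ℝ, ∃ C : ℝ, ∀ n, b n ≤ C * wt β (-s) n) :
    b ∈ kotheDual (beurlingWeights β d) := by
  refine ⟨h0, ?_⟩
  rintro _ ⟨s, hs, rfl⟩
  obtain ⟨C, hC⟩ := h (s + 1)
  refine Summable.of_nonneg_of_le (fun n => mul_nonneg (h0 n) (wt_pos _ _ n).le) (fun n => ?_)
    ((summable_wt hβ (show (-1 : ℝ) < 0 by norm_num) d).mul_left C)
  calc b n * wt β s n ≤ C * wt β (-(s + 1)) n * wt β s n :=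
        mul_le_mul_of_nonneg_right (hC n) (wt_pos _ _ n).le
    _ = C * (wt β (-(s + 1)) n * wt β s n) := by ring
    _ = _ := by rw [wt_mul]; congr 2; ring

lemma exists_le_of_mem_kotheDual_beurling {β : ℝ} {d : ℕ} {b : (Fin d → ℕ) → ℝ}
    (h : b ∈ kotheDual (beurlingWeights β d)) (s : ℝ) (hs : 0 < s) :
    ∃ C : ℝ, 0 < C ∧ ∀ n, b n ≤ C * wt β (-s) n := by
  have hsum := h.2 _ ⟨s, hs, rfl⟩
  have h0 : ∀ n, 0 ≤ b n * wt β s n := fun n => mul_nonneg (h.1 n) (wt_pos _ _ n).le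
  have ht : 0 ≤ ∑' n, b n * wt β s n := tsum_nonneg h0
  refine ⟨(∑' n, b n * wt β s n) + 1, by linarith, fun n => mul_wt_le_iff.1 ?_⟩
  have := hsum.le_tsum n fun j _ => h0 j
  linarith

/-- A sequence dominated by no weight exceeds every multiple of `wt β (k + 1)`. The sequence
constructed above then decays at every rate, so it lies in the Köthe dual, yet it is not summable
against `u`. -/
lemma isReflexiveWeights_beurling {β : ℝ} (hβ : 0 < β) (d : ℕ) :
    IsReflexiveWeights (beurlingWeights β d) := by
  intro u hu h
  by_contra! hcon
  obtain ⟨v, hv0, hv, hns⟩ := exists_not_summable_of_not_dominated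
    (W := fun k : ℕ => wt β ((k : ℝ) + 1) (d := d)) (u := u) (fun k n => wt_pos _ _ n)
    (fun n k l hkl => wt_mono β (by simpa using hkl) n)
    (fun k C => hcon _ ⟨k + 1, by positivity, rfl⟩ C)
  refine hns (h v (mem_kotheDual_beurling hβ hv0 fun s => ?_))
  obtain ⟨k, hk⟩ := exists_nat_ge s
  obtain ⟨C, hC⟩ := hv k
  refine ⟨|C|, fun n => (mul_wt_le_iff.1 ((hC n).trans (le_abs_self C))).trans ?_⟩
  exact mul_le_mul_of_nonneg_left (wt_mono β (by linarith) n) (abs_nonneg C)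

/-- This converts the intersection over all Roumieu weights into decay at a single rate, that is,
into membership in the inductive limit. If no rate worked, the construction above with `W k = wt β
(-1/(k+1))` would give a Roumieu weight against which `b` diverges. -/
lemma exists_le_of_summable_roumieu {β : ℝ} {d : ℕ} {b : (Fin d → ℕ) → ℝ}
    (h : ∀ v ∈ roumieuWeights β d, Summable fun n => b n * v n) :
    ∃ s > 0, ∃ C : ℝ, 0 < C ∧ ∀ n, b n ≤ C * wt β (-s) n := by
  by_contra! hcon
  obtain ⟨v, hv0, hv, hns⟩ := exists_not_summable_of_not_dominated
    (W := fun k : ℕ => wt β (-(1 / ((k : ℝ) + 1))) (d := d)) (u := b) (fun k n => wt_pos _ _ n)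
    (fun n k l hkl => wt_mono β (neg_le_neg (Nat.one_div_le_one_div hkl)) n) (fun k C => by
      -- The negated statement only speaks of positive constants, hence `|C| + 1`.
      obtain ⟨n, hn⟩ := hcon (1 / ((k : ℝ) + 1)) (by positivity) (|C| + 1) (by positivity)
      refine ⟨n, lt_of_le_of_lt ?_ hn⟩
      refine mul_le_mul_of_nonneg_right ?_ (wt_pos _ _ n).le
      linarith [le_abs_self C])
  refine hns (h v ⟨hv0, fun s hs => ?_⟩)
  obtain ⟨k, hk⟩ := exists_nat_one_div_lt hs
  obtain ⟨C, hC⟩ := hv k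
  refine ⟨|C|, fun n => (mul_wt_le_iff.1 ((hC n).trans (le_abs_self C))).trans ?_⟩
  rw [neg_neg]
  exact mul_le_mul_of_nonneg_left (wt_mono β hk.le n) (abs_nonneg C)

lemma summable_mul_roumieu {β : ℝ} (hβ : 0 < β) {d : ℕ} {b : (Fin d → ℕ) → ℝ}
    (h0 : ∀ n, 0 ≤ b n) {s C : ℝ} (hs : 0 < s) (hb : ∀ n, b n ≤ C * wt β (-s) n)
    {v : (Fin d → ℕ) → ℝ} (hv : v ∈ roumieuWeights β d) : Summable fun n => b n * v n := by
  obtain ⟨D, hD⟩ := hv.2 (s / 2) (half_pos hs)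
  refine Summable.of_nonneg_of_le (fun n => mul_nonneg (h0 n) (hv.1 n)) (fun n => ?_)
    ((summable_wt hβ (show -(s / 2) < 0 by linarith) d).mul_left (C * D))
  calc b n * v n ≤ C * wt β (-s) n * (D * wt β (s / 2) n) :=
        mul_le_mul (hb n) (hD n) (hv.1 n) ((h0 n).trans (hb n))
    _ = C * D * (wt β (-s) n * wt β (s / 2) n) := by ring
    _ = _ := by rw [wt_mul]; congr 2; ring

/-- Every `wt β (-s)` with `s > 0` lies in the Köthe dual, so summability against it bounds `u` by a
multiple of `wt β s`: the sequence `u` is itself a Roumieu weight. -/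
lemma isReflexiveWeights_roumieu {β : ℝ} (hβ : 0 < β) (d : ℕ) :
    IsReflexiveWeights (roumieuWeights β d) := by
  intro u hu h
  refine ⟨u, ⟨hu, fun s hs => ?_⟩, 1, fun n => (one_mul _).ge⟩
  have hsum := h (wt β (-s)) ⟨fun n => (wt_pos _ _ n).le, fun v hv =>
    summable_mul_roumieu hβ (fun n => (wt_pos _ _ n).le) hs (fun n => (one_mul _).ge) hv⟩
  refine ⟨∑' n, u n * wt β (-s) n, fun n => ?_⟩
  have := hsum.le_tsum n fun j _ => mul_nonneg (hu j) (wt_pos _ _ j).le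
  have := mul_wt_le_iff.1 this
  rwa [neg_neg] at this

/-! ### Tensor products of the weights -/

lemma deg_appendEquiv {d₁ d₂ : ℕ} (m : Fin d₁ → ℕ) (n : Fin d₂ → ℕ) :
    deg (Fin.appendEquiv d₁ d₂ (m, n)) = deg m + deg n := by
  simp [deg, Fin.sum_univ_add]

/-- Estimating through the maximum avoids a distinction between `β ≤ 1` and `β ≥ 1`; the constant is
immaterial because exponents may be rescaled. -/
lemma add_rpow_le {β a b : ℝ} (hβ : 0 < β) (ha : 0 ≤ a) (hb : 0 ≤ b) :
    (a + b) ^ β ≤ 2 ^ β * (a ^ β + b ^ β) := by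
  have hm : 0 ≤ max a b := le_max_of_le_left ha
  calc (a + b) ^ β ≤ (2 * max a b) ^ β :=
        Real.rpow_le_rpow (by positivity) (by linarith [le_max_left a b, le_max_right a b]) hβ.le
    _ = 2 ^ β * (max a b) ^ β := Real.mul_rpow (by norm_num) hm
    _ ≤ _ := by
        refine mul_le_mul_of_nonneg_left ?_ (by positivity)
        have h1 := Real.rpow_nonneg ha β
        have h2 := Real.rpow_nonneg hb β
        rcases max_cases a b with ⟨h, -⟩ | ⟨h, -⟩ <;> rw [h] <;> linarith

lemma rpow_add_rpow_le {β a b : ℝ} (hβ : 0 < β) (ha : 0 ≤ a) (hb : 0 ≤ b) :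
    a ^ β + b ^ β ≤ 2 * (a + b) ^ β := by
  have h1 : a ^ β ≤ (a + b) ^ β := Real.rpow_le_rpow ha (by linarith) hβ.le
  have h2 : b ^ β ≤ (a + b) ^ β := Real.rpow_le_rpow hb (by linarith) hβ.le
  linarith

lemma wt_appendEquiv_le {β s : ℝ} (hβ : 0 < β) (hs : 0 ≤ s) {d₁ d₂ : ℕ} (m : Fin d₁ → ℕ)
    (n : Fin d₂ → ℕ) : wt β s (Fin.appendEquiv d₁ d₂ (m, n)) ≤
      wt β (2 ^ β * s) m * wt β (2 ^ β * s) n := by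
  rw [wt, wt, wt, ← Real.exp_add, deg_appendEquiv, Nat.cast_add]
  refine Real.exp_le_exp.2 ?_
  have := mul_le_mul_of_nonneg_left
    (add_rpow_le hβ (Nat.cast_nonneg (deg m)) (Nat.cast_nonneg (deg n))) hs
  linarith

lemma wt_mul_wt_le {β s : ℝ} (hβ : 0 < β) (hs : 0 ≤ s) {d₁ d₂ : ℕ} (m : Fin d₁ → ℕ)
    (n : Fin d₂ → ℕ) : wt β s m * wt β s n ≤ wt β (2 * s) (Fin.appendEquiv d₁ d₂ (m, n)) := by
  rw [wt, wt, wt, ← Real.exp_add, deg_appendEquiv, Nat.cast_add]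
  refine Real.exp_le_exp.2 ?_
  have := mul_le_mul_of_nonneg_left
    (rpow_add_rpow_le hβ (Nat.cast_nonneg (deg m)) (Nat.cast_nonneg (deg n))) hs
  linarith

lemma dominatedByProd_beurling {β : ℝ} (hβ : 0 < β) (d₁ d₂ : ℕ) :
    DominatedByProd (Fin.appendEquiv d₁ d₂) (beurlingWeights β d₁) (beurlingWeights β d₂)
      (beurlingWeights β (d₁ + d₂)) := by
  rintro _ ⟨s, hs, rfl⟩
  refine ⟨_, ⟨2 ^ β * s, by positivity, rfl⟩, _, ⟨2 ^ β * s, by positivity, rfl⟩, 1, fun m n => ?_⟩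
  rw [one_mul]
  exact wt_appendEquiv_le hβ hs.le m n

lemma dominatesProd_beurling {β : ℝ} (hβ : 0 < β) (d₁ d₂ : ℕ) :
    DominatesProd (Fin.appendEquiv d₁ d₂) (beurlingWeights β d₁) (beurlingWeights β d₂)
      (beurlingWeights β (d₁ + d₂)) := by
  rintro _ ⟨s, hs, rfl⟩ _ ⟨t, ht, rfl⟩
  refine ⟨_, ⟨2 * max s t, by positivity, rfl⟩, 1, fun m n => ?_⟩
  rw [one_mul]
  refine le_trans ?_ (wt_mul_wt_le hβ (by positivity) m n)
  exact mul_le_mul (wt_mono β (le_max_left s t) m) (wt_mono β (le_max_right s t) n)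
    (wt_pos _ _ n).le (wt_pos _ _ m).le

lemma dominatesProd_roumieu {β : ℝ} (hβ : 0 < β) (d₁ d₂ : ℕ) :
    DominatesProd (Fin.appendEquiv d₁ d₂) (roumieuWeights β d₁) (roumieuWeights β d₂)
      (roumieuWeights β (d₁ + d₂)) := by
  intro p hp q hq
  refine ⟨fun k => p ((Fin.appendEquiv d₁ d₂).symm k).1 * q ((Fin.appendEquiv d₁ d₂).symm k).2,
    ⟨fun k => mul_nonneg (hp.1 _) (hq.1 _), fun s hs => ?_⟩, 1, fun m n => by
      beta_reduce
      rw [Equiv.symm_apply_apply, one_mul]⟩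
  obtain ⟨C, hC⟩ := hp.2 (s / 2) (half_pos hs)
  obtain ⟨D, hD⟩ := hq.2 (s / 2) (half_pos hs)
  refine ⟨|C * D|, fun k => ?_⟩
  obtain ⟨⟨m, n⟩, rfl⟩ := (Fin.appendEquiv d₁ d₂).surjective k
  beta_reduce
  rw [Equiv.symm_apply_apply]
  calc p m * q n ≤ (C * wt β (s / 2) m) * (D * wt β (s / 2) n) :=
        mul_le_mul (hC m) (hD n) (hq.1 n) ((hp.1 m).trans (hC m))
    _ = C * D * (wt β (s / 2) m * wt β (s / 2) n) := by ring
    _ ≤ |C * D| * (wt β (s / 2) m * wt β (s / 2) n) :=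
        mul_le_mul_of_nonneg_right (le_abs_self _) (mul_nonneg (wt_pos _ _ m).le (wt_pos _ _ n).le)
    _ ≤ |C * D| * wt β (2 * (s / 2)) (Fin.appendEquiv d₁ d₂ (m, n)) :=
        mul_le_mul_of_nonneg_left (wt_mul_wt_le hβ (by positivity) m n) (abs_nonneg _)
    _ = _ := by rw [mul_div_cancel₀ s two_ne_zero]

/-- The weight is majorized by a radial envelope `G(t) = inf_k C_k exp(t^β / (k + 1))`, which is
nondecreasing and at least one. Since `|m| + |n|` is at most twice the larger degree, `G(|m| + |n|)
≤ G(2|m|) G(2|n|)`. -/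
lemma dominatedByProd_roumieu {β : ℝ} (hβ : 0 < β) (d₁ d₂ : ℕ) :
    DominatedByProd (Fin.appendEquiv d₁ d₂) (roumieuWeights β d₁) (roumieuWeights β d₂)
      (roumieuWeights β (d₁ + d₂)) := by
  intro v hv
  have hex : ∀ k : ℕ, ∃ C : ℝ, 1 ≤ C ∧ ∀ n, v n ≤ C * wt β (1 / ((k : ℝ) + 1)) n := by
    intro k
    obtain ⟨C, hC⟩ := hv.2 (1 / ((k : ℝ) + 1)) (by positivity)
    -- Constants at least one make `G ≥ 1`, so the factor belonging to the smaller degree can be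
    -- inserted at the end.
    refine ⟨max C 1, le_max_right _ _, fun n => (hC n).trans ?_⟩
    exact mul_le_mul_of_nonneg_right (le_max_left _ _) (wt_pos _ _ n).le
  choose C hC1 hC using hex
  set G : ℕ → ℝ := fun t => ⨅ k : ℕ, C k * Real.exp (1 / ((k : ℝ) + 1) * (t : ℝ) ^ β) with hG
  have hone : ∀ (t k : ℕ), 1 ≤ C k * Real.exp (1 / ((k : ℝ) + 1) * (t : ℝ) ^ β) := fun t k =>
    one_le_mul_of_one_le_of_one_le (hC1 k) (Real.one_le_exp (by positivity))
  have hbdd : ∀ t : ℕ, BddBelow (range fun k : ℕ =>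
      C k * Real.exp (1 / ((k : ℝ) + 1) * (t : ℝ) ^ β)) := fun t =>
    ⟨1, by rintro _ ⟨k, rfl⟩; exact hone t k⟩
  have hG1 : ∀ t, 1 ≤ G t := fun t => le_ciInf (hone t)
  have hGmono : Monotone G := fun t t' h => ciInf_mono (hbdd t) fun k => by
    refine mul_le_mul_of_nonneg_left (Real.exp_le_exp.2 ?_) (zero_le_one.trans (hC1 k))
    gcongr
  have hvG : ∀ n, v n ≤ G (deg n) := fun n => le_ciInf fun k => hC k n
  have hmem : ∀ d : ℕ, (fun m : Fin d → ℕ => G (2 * deg m)) ∈ roumieuWeights β d := by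
    intro d
    refine ⟨fun m => zero_le_one.trans (hG1 _), fun s hs => ?_⟩
    obtain ⟨k, hk⟩ := exists_nat_one_div_lt (show 0 < s / 2 ^ β by positivity)
    refine ⟨C k, fun m => (ciInf_le (hbdd _) k).trans ?_⟩
    refine mul_le_mul_of_nonneg_left (Real.exp_le_exp.2 ?_) (zero_le_one.trans (hC1 k))
    rw [Nat.cast_mul, Nat.cast_ofNat, Real.mul_rpow (by norm_num) (by positivity), ← mul_assoc]
    refine mul_le_mul_of_nonneg_right ?_ (by positivity)
    exact ((lt_div_iff₀ (by positivity)).1 hk).le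
  refine ⟨_, hmem d₁, _, hmem d₂, 1, fun m n => ?_⟩
  rw [one_mul]
  refine (hvG _).trans ?_
  rw [deg_appendEquiv]
  rcases le_total (deg m) (deg n) with h | h
  · exact (hGmono (by omega)).trans (le_mul_of_one_le_left (zero_le_one.trans (hG1 _)) (hG1 _))
  · exact (hGmono (by omega)).trans (le_mul_of_one_le_right (zero_le_one.trans (hG1 _)) (hG1 _))

/-- A dual weight decays at some rate `s`, and half of that rate for each factor suffices since `a^β
+ b^β ≤ 2 (a + b)^β`. -/
lemma dominatedByProd_kotheDual_roumieu {β : ℝ} (hβ : 0 < β) (d₁ d₂ : ℕ) :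
    DominatedByProd (Fin.appendEquiv d₁ d₂) (kotheDual (roumieuWeights β d₁))
      (kotheDual (roumieuWeights β d₂)) (kotheDual (roumieuWeights β (d₁ + d₂))) := by
  intro b hb
  obtain ⟨s, hs, C, hC0, hC⟩ := exists_le_of_summable_roumieu hb.2
  have hmem : ∀ d : ℕ, wt β (-(s / 2)) (d := d) ∈ kotheDual (roumieuWeights β d) := fun d =>
    ⟨fun n => (wt_pos _ _ n).le, fun v hv => summable_mul_roumieu hβ (fun n => (wt_pos _ _ n).le)
      (half_pos hs) (fun n => (one_mul _).ge) hv⟩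
  refine ⟨_, hmem d₁, _, hmem d₂, C, fun m n => (hC _).trans ?_⟩
  refine mul_le_mul_of_nonneg_left ?_ hC0.le
  rw [wt, wt, wt, ← Real.exp_add, deg_appendEquiv, Nat.cast_add]
  refine Real.exp_le_exp.2 ?_
  have := mul_le_mul_of_nonneg_left
    (rpow_add_rpow_le hβ (Nat.cast_nonneg (deg m)) (Nat.cast_nonneg (deg n))) (half_pos hs).le
  linarith

/-- Dual weights decay at every rate, hence lie below a nonincreasing radial envelope `H`. Writing
`H` as the square of its root, `H(|m| + |n|) ≤ √H(|m|) √H(|n|)`. -/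
lemma dominatedByProd_kotheDual_beurling {β : ℝ} (hβ : 0 < β) (d₁ d₂ : ℕ) :
    DominatedByProd (Fin.appendEquiv d₁ d₂) (kotheDual (beurlingWeights β d₁))
      (kotheDual (beurlingWeights β d₂)) (kotheDual (beurlingWeights β (d₁ + d₂))) := by
  intro b hb
  choose C hC0 hC using fun k : ℕ =>
    exists_le_of_mem_kotheDual_beurling hb ((k : ℝ) + 1) (by positivity)
  set H : ℕ → ℝ := fun t => ⨅ k : ℕ, C k * Real.exp (-((k : ℝ) + 1) * (t : ℝ) ^ β) with hH
  have hpos : ∀ (t k : ℕ), 0 ≤ C k * Real.exp (-((k : ℝ) + 1) * (t : ℝ) ^ β) := fun t k =>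
    mul_nonneg (hC0 k).le (Real.exp_pos _).le
  have hbdd : ∀ t : ℕ, BddBelow (range fun k : ℕ =>
      C k * Real.exp (-((k : ℝ) + 1) * (t : ℝ) ^ β)) := fun t =>
    ⟨0, by rintro _ ⟨k, rfl⟩; exact hpos t k⟩
  have hH0 : ∀ t, 0 ≤ H t := fun t => le_ciInf (hpos t)
  have hHanti : Antitone H := fun t t' h => ciInf_mono (hbdd t') fun k => by
    refine mul_le_mul_of_nonneg_left (Real.exp_le_exp.2 ?_) (hC0 k).le
    rw [neg_mul, neg_mul]
    refine neg_le_neg ?_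
    gcongr
  have hbH : ∀ n, b n ≤ H (deg n) := fun n => le_ciInf fun k => hC k n
  have hmem : ∀ d : ℕ, (fun m : Fin d → ℕ => √(H (deg m))) ∈ kotheDual (beurlingWeights β d) := by
    intro d
    refine mem_kotheDual_beurling hβ (fun m => Real.sqrt_nonneg _) fun s => ?_
    -- The square root halves the exponent, so rate `s` requires `k + 1 ≥ 2 s`.
    obtain ⟨k, hk⟩ := exists_nat_ge (2 * s)
    refine ⟨√(C k), fun m => ?_⟩
    refine (Real.sqrt_le_sqrt (ciInf_le (hbdd _) k)).trans ?_
    rw [Real.sqrt_mul (hC0 k).le]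
    refine mul_le_mul_of_nonneg_left ?_ (Real.sqrt_nonneg _)
    rw [Real.sqrt_le_left (wt_pos _ _ m).le, wt, ← Real.exp_nat_mul]
    refine Real.exp_le_exp.2 ?_
    push_cast
    rw [← mul_assoc]
    exact mul_le_mul_of_nonneg_right (by linarith) (by positivity)
  refine ⟨_, hmem d₁, _, hmem d₂, 1, fun m n => ?_⟩
  rw [one_mul]
  refine (hbH _).trans ?_
  rw [deg_appendEquiv, ← Real.mul_self_sqrt (hH0 (deg m + deg n))]
  exact mul_le_mul (Real.sqrt_le_sqrt (hHanti (by omega))) (Real.sqrt_le_sqrt (hHanti (by omega)))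
    (Real.sqrt_nonneg _) (Real.sqrt_nonneg _)

/-! ### Laguerre functions of one variable -/

/-- The Laguerre polynomial `∑ (n choose k) (-1)^k / k! X^k`. -/
def lagPoly (n : ℕ) : Polynomial ℝ :=
  ∑ k ∈ Finset.range (n + 1), Polynomial.monomial k ((n.choose k : ℝ) * ((-1) ^ k / k.factorial))

lemma coeff_lagPoly (n k : ℕ) :
    (lagPoly n).coeff k = (n.choose k : ℝ) * ((-1) ^ k / k.factorial) := by
  rw [lagPoly, Polynomial.finsetSum_coeff]
  simp only [Polynomial.coeff_monomial, Finset.sum_ite_eq', Finset.mem_range]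
  split_ifs with h
  · rfl
  · rw [Nat.choose_eq_zero_of_lt (by omega)]
    simp

lemma lagPoly_zero : lagPoly 0 = 1 := by
  simp [lagPoly]

lemma eval_zero_lagPoly (n : ℕ) : (lagPoly n).eval 0 = 1 := by
  rw [← Polynomial.coeff_zero_eq_eval_zero, coeff_lagPoly]
  simp

/-- Pascal's rule on coefficients. -/
lemma derivative_lagPoly_succ (n : ℕ) :
    Polynomial.derivative (lagPoly (n + 1)) = Polynomial.derivative (lagPoly n) - lagPoly n := by
  ext k
  rw [Polynomial.coeff_sub, Polynomial.coeff_derivative, Polynomial.coeff_derivative, coeff_lagPoly,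
    coeff_lagPoly, coeff_lagPoly, Nat.choose_succ_succ, Nat.factorial_succ]
  push_cast
  field_simp
  ring

lemma X_mul_derivative_lagPoly_succ (n : ℕ) :
    Polynomial.X * Polynomial.derivative (lagPoly (n + 1)) =
      Polynomial.C ((n : ℝ) + 1) * (lagPoly (n + 1) - lagPoly n) := by
  ext k
  rw [Polynomial.coeff_C_mul, Polynomial.coeff_sub, coeff_lagPoly, coeff_lagPoly]
  rcases k with _ | k
  · simp
  · rw [Polynomial.coeff_X_mul, Polynomial.coeff_derivative, coeff_lagPoly]
    have h1 : ((n + 1).choose (k + 1) : ℝ) * (k + 1) = (n + 1) * n.choose k := by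
      exact_mod_cast (Nat.add_one_mul_choose_eq n k).symm
    have h2 : ((n + 1).choose (k + 1) : ℝ) = n.choose k + n.choose (k + 1) := by
      exact_mod_cast Nat.choose_succ_succ n k
    have h3 : ((n + 1).choose (k + 1) : ℝ) - n.choose (k + 1) = n.choose k := by linarith
    rw [← sub_mul, h3, mul_right_comm, h1, mul_assoc]

lemma derivative_lagPoly (n : ℕ) :
    Polynomial.derivative (lagPoly n) = -∑ j ∈ Finset.range n, lagPoly j := by
  induction n with
  | zero => simp [lagPoly_zero]
  | succ n ih => rw [derivative_lagPoly_succ, ih, Finset.sum_range_succ]; ring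

/-- For `n = 0` the truncated index `n - 1` is harmless because of the factor `n`. -/
lemma eval_X_mul_derivative_lagPoly (n : ℕ) (x : ℝ) :
    x * (Polynomial.derivative (lagPoly n)).eval x =
      n * ((lagPoly n).eval x - (lagPoly (n - 1)).eval x) := by
  rcases n with _ | n
  · simp [lagPoly_zero]
  · have := congrArg (Polynomial.eval x) (X_mul_derivative_lagPoly_succ n)
    simpa using this

lemma eval_lagPoly_three_term (n : ℕ) (x : ℝ) :
    x * (lagPoly n).eval x = (2 * n + 1) * (lagPoly n).eval x - (n + 1) * (lagPoly (n + 1)).eval x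
      - n * (lagPoly (n - 1)).eval x := by
  have h1 := eval_X_mul_derivative_lagPoly n x
  have h2 := eval_X_mul_derivative_lagPoly (n + 1) x
  have h3 := congrArg (Polynomial.eval x) (derivative_lagPoly_succ n)
  simp only [Polynomial.eval_sub, Nat.add_sub_cancel, Nat.cast_add, Nat.cast_one] at h2 h3
  rw [h3] at h2
  linarith

/-- Differentiate `x L_{n+1}' = (n+1)(L_{n+1} - L_n)` and eliminate `L_n` by means of `L_{n+1}' =
L_n' - L_n`. -/
lemma eval_lagPoly_ode (n : ℕ) (x : ℝ) :
    x * (Polynomial.derivative (Polynomial.derivative (lagPoly n))).eval x +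
      (1 - x) * (Polynomial.derivative (lagPoly n)).eval x + n * (lagPoly n).eval x = 0 := by
  rcases n with _ | n
  · simp [lagPoly_zero]
  · have h := congrArg (fun p => (Polynomial.derivative p).eval x)
      (X_mul_derivative_lagPoly_succ n)
    have h1 := congrArg (Polynomial.eval x) (X_mul_derivative_lagPoly_succ n)
    have h3 := congrArg (Polynomial.eval x) (derivative_lagPoly_succ n)
    simp only [Polynomial.derivative_mul, Polynomial.derivative_X, one_mul, Polynomial.derivative_C,
      zero_mul, zero_add, Polynomial.eval_add, Polynomial.eval_mul, Polynomial.eval_X,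
      Polynomial.eval_C, Polynomial.derivative_sub, Polynomial.eval_sub] at h h1 h3
    push_cast
    linear_combination h - h1 + (n + 1) * h3

/-- The derivatives of the Laguerre function `e^{-x/2} L_n(x)`. -/
def lagDer : ℕ → ℕ → ℝ → ℝ
  | 0, n, x => Real.exp (-x / 2) * (lagPoly n).eval x
  | p + 1, n, x => -(1 / 2) * lagDer p n x - ∑ j ∈ Finset.range n, lagDer p j x

lemma lagDer_succ (p n : ℕ) (x : ℝ) :
    lagDer (p + 1) n x = -(1 / 2) * lagDer p n x - ∑ j ∈ Finset.range n, lagDer p j x := rfl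

lemma hasDerivAt_exp_mul_poly (P : Polynomial ℝ) (x : ℝ) :
    HasDerivAt (fun x => Real.exp (-x / 2) * P.eval x)
      (Real.exp (-x / 2) * (Polynomial.derivative P - Polynomial.C (1 / 2) * P).eval x) x := by
  have h1 : HasDerivAt (fun x : ℝ => Real.exp (-x / 2)) (Real.exp (-x / 2) * (-1 / 2)) x :=
    ((hasDerivAt_id x).neg.div_const 2).exp
  refine (h1.mul (P.hasDerivAt x)).congr_deriv ?_
  simp only [Polynomial.eval_sub, Polynomial.eval_mul, Polynomial.eval_C]
  ring

/-- Since `L_n' = -∑_{j<n} L_j`, every derivative is again a finite combination of Laguerre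
functions. This lets growth bounds pass from order zero to all orders. -/
lemma hasDerivAt_lagDer (p n : ℕ) (x : ℝ) :
    HasDerivAt (lagDer p n) (lagDer (p + 1) n x) x := by
  induction p generalizing n with
  | zero =>
    refine (hasDerivAt_exp_mul_poly (lagPoly n) x).congr_deriv ?_
    rw [derivative_lagPoly, lagDer_succ]
    simp only [lagDer, ← Finset.mul_sum, Polynomial.eval_sub, Polynomial.eval_neg,
      Polynomial.eval_finsetSum, Polynomial.eval_mul, Polynomial.eval_C]
    ring
  | succ p ih =>
    exact ((ih n).const_mul _).sub (HasDerivAt.fun_sum fun j _ => ih j)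

lemma continuous_lagDer (p n : ℕ) : Continuous (lagDer p n) :=
  continuous_iff_continuousAt.2 fun x => (hasDerivAt_lagDer p n x).continuousAt

lemma lagDer_one (n : ℕ) (x : ℝ) : lagDer 1 n x = Real.exp (-x / 2) *
    (Polynomial.derivative (lagPoly n) - Polynomial.C (1 / 2) * lagPoly n).eval x :=
  (hasDerivAt_lagDer 0 n x).unique (hasDerivAt_exp_mul_poly (lagPoly n) x)

lemma lagDer_ode (n : ℕ) (x : ℝ) :
    x * lagDer 2 n x + lagDer 1 n x - x / 4 * lagDer 0 n x + 1 / 2 * lagDer 0 n x =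
      -(n * lagDer 0 n x) := by
  have h2 := hasDerivAt_lagDer 1 n x
  rw [show lagDer 1 n = _ from funext (lagDer_one n)] at h2
  rw [h2.unique (hasDerivAt_exp_mul_poly _ x), lagDer_one, lagDer]
  simp only [Polynomial.derivative_sub, Polynomial.derivative_mul, Polynomial.derivative_C,
    zero_mul, zero_add, Polynomial.eval_sub, Polynomial.eval_mul, Polynomial.eval_C]
  linear_combination Real.exp (-x / 2) * eval_lagPoly_ode n x

lemma lagDer_three_term (n : ℕ) (x : ℝ) :
    x * lagDer 0 n x = (2 * n + 1) * lagDer 0 n x - (n + 1) * lagDer 0 (n + 1) x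
      - n * lagDer 0 (n - 1) x := by
  simp only [lagDer]
  linear_combination Real.exp (-x / 2) * eval_lagPoly_three_term n x

lemma integrableOn_exp_neg_mul_poly (P : Polynomial ℝ) :
    IntegrableOn (fun x => Real.exp (-x) * P.eval x) (Ioi 0) := by
  induction P using Polynomial.induction_on' with
  | add p q hp hq =>
    refine (hp.add hq).congr_fun (fun x _ => ?_) measurableSet_Ioi
    simp [mul_add]
  | monomial k a =>
    have h := (Real.GammaIntegral_convergent (s := (k : ℝ) + 1) (by positivity)).mul_const a
    refine IntegrableOn.congr_fun h (fun x _ => ?_) measurableSet_Ioi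
    simp only [add_sub_cancel_right, Real.rpow_natCast, Polynomial.eval_monomial]
    ring

lemma integral_exp_neg_mul_poly (P : Polynomial ℝ) :
    ∫ x in Ioi (0 : ℝ), Real.exp (-x) * (Polynomial.derivative P - P).eval x = -P.eval 0 := by
  have hd : ∀ x ∈ Ici (0 : ℝ), HasDerivAt (fun x => Real.exp (-x) * P.eval x)
      (Real.exp (-x) * (Polynomial.derivative P - P).eval x) x := by
    intro x _
    have h1 : HasDerivAt (fun x : ℝ => Real.exp (-x)) (Real.exp (-x) * (-1)) x :=
      ((hasDerivAt_id x).neg).exp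
    refine (h1.mul (P.hasDerivAt x)).congr_deriv ?_
    rw [Polynomial.eval_sub]
    ring
  have ht : Tendsto (fun x => Real.exp (-x) * P.eval x) atTop (𝓝 0) := by
    refine P.tendsto_div_exp_atTop.congr fun x => ?_
    rw [Real.exp_neg, div_eq_inv_mul]
  rw [integral_Ioi_of_hasDerivAt_of_tendsto' hd (integrableOn_exp_neg_mul_poly _) ht]
  simp

lemma lagDer_zero_mul (m n : ℕ) (x : ℝ) :
    lagDer 0 m x * lagDer 0 n x = Real.exp (-x) * (lagPoly m * lagPoly n).eval x := by
  have : Real.exp (-x) = Real.exp (-x / 2) * Real.exp (-x / 2) := by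
    rw [← Real.exp_add, add_halves]
  rw [this, lagDer, lagDer, Polynomial.eval_mul]
  ring

lemma integrableOn_lagDer_mul (m n : ℕ) :
    IntegrableOn (fun x => lagDer 0 m x * lagDer 0 n x) (Ioi 0) := by
  simp only [lagDer_zero_mul]
  exact integrableOn_exp_neg_mul_poly _

/-- Integrate the derivative of `e^{-x} L_m L_n`, whose value at zero is one, and expand `L_m'` and
`L_n'`. The resulting recursion determines all inner products. -/
lemma integral_lagDer_mul_eq (m n : ℕ) :
    ∫ x in Ioi (0 : ℝ), lagDer 0 m x * lagDer 0 n x =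
      1 - ∑ j ∈ Finset.range m, (∫ x in Ioi (0 : ℝ), lagDer 0 j x * lagDer 0 n x)
        - ∑ j ∈ Finset.range n, ∫ x in Ioi (0 : ℝ), lagDer 0 m x * lagDer 0 j x := by
  have h := integral_exp_neg_mul_poly (lagPoly m * lagPoly n)
  rw [Polynomial.eval_mul, eval_zero_lagPoly, eval_zero_lagPoly] at h
  have hpt : ∀ x : ℝ, Real.exp (-x) * (Polynomial.derivative (lagPoly m * lagPoly n)
      - lagPoly m * lagPoly n).eval x = -(∑ j ∈ Finset.range m, lagDer 0 j x * lagDer 0 n x)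
      - (∑ j ∈ Finset.range n, lagDer 0 m x * lagDer 0 j x) - lagDer 0 m x * lagDer 0 n x := by
    intro x
    simp only [lagDer_zero_mul, Polynomial.derivative_mul, derivative_lagPoly,
      ← Finset.mul_sum, ← Polynomial.eval_finsetSum, ← Finset.sum_mul, Polynomial.eval_sub,
      Polynomial.eval_add, Polynomial.eval_mul, Polynomial.eval_neg]
    ring
  simp only [hpt] at h
  have hi := integrableOn_lagDer_mul
  have h1 : IntegrableOn (fun x => ∑ j ∈ Finset.range m, lagDer 0 j x * lagDer 0 n x) (Ioi 0) :=
    integrable_finsetSum _ fun j _ => hi j n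
  have h2 : IntegrableOn (fun x => ∑ j ∈ Finset.range n, lagDer 0 m x * lagDer 0 j x) (Ioi 0) :=
    integrable_finsetSum _ fun j _ => hi m j
  rw [integral_sub (h1.fun_neg.fun_sub h2) (hi m n), integral_sub h1.fun_neg h2, integral_neg,
    integral_finsetSum _ fun j _ => hi j n, integral_finsetSum _ fun j _ => hi m j] at h
  linarith

/-- By induction on `m + n` the recursion becomes `1 - [n < m] - [m < n]`, which is `[m = n]`. -/
lemma integral_lagDer_mul (m n : ℕ) :
    ∫ x in Ioi (0 : ℝ), lagDer 0 m x * lagDer 0 n x = if m = n then 1 else 0 := by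
  induction h : m + n using Nat.strong_induction_on generalizing m n with
  | _ N ih =>
    rw [integral_lagDer_mul_eq,
      Finset.sum_congr rfl fun j hj => ih (j + n) (by have := Finset.mem_range.1 hj; omega) j n rfl,
      Finset.sum_congr rfl fun j hj => ih (m + j) (by have := Finset.mem_range.1 hj; omega) m j rfl]
    simp only [Finset.sum_ite_eq', Finset.sum_ite_eq, Finset.mem_range]
    rcases lt_trichotomy m n with h1 | h1 | h1
    · simp [h1, h1.ne, h1.le]
    · simp [h1]
    · simp [h1, h1.ne', h1.le]

lemma lagDer_one_sq_le (n : ℕ) (x : ℝ) :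
    lagDer 1 n x ^ 2 ≤ (n + 1) * ∑ j ∈ Finset.range (n + 1), lagDer 0 j x ^ 2 := by
  have h1 : lagDer 1 n x = -∑ j ∈ Finset.range (n + 1),
      (if j = n then (1 / 2 : ℝ) else 1) * lagDer 0 j x := by
    have h2 : ∑ j ∈ Finset.range n, (if j = n then (1 / 2 : ℝ) else 1) * lagDer 0 j x =
        ∑ j ∈ Finset.range n, lagDer 0 j x := Finset.sum_congr rfl fun j hj => by
      rw [if_neg (Finset.mem_range.1 hj).ne, one_mul]
    rw [lagDer_succ, Finset.sum_range_succ, if_pos rfl, h2]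
    ring
  rw [h1, neg_sq]
  refine (sq_sum_le_card_mul_sum_sq).trans ?_
  rw [Finset.card_range, Nat.cast_add, Nat.cast_one]
  refine mul_le_mul_of_nonneg_left (Finset.sum_le_sum fun j _ => ?_) (by positivity)
  rw [mul_pow]
  refine mul_le_of_le_one_left (sq_nonneg _) ?_
  split_ifs <;> norm_num

lemma integrableOn_lagDer_sq (n : ℕ) : IntegrableOn (fun x => lagDer 0 n x ^ 2) (Ioi 0) := by
  simpa only [sq] using integrableOn_lagDer_mul n n

/-- For `f = e^{-x/2} L_n`, `f(x)² = 1 + 2∫ f f' ≤ 1 + ∫ (f² + f'²) ≤ 2 + (n + 1)²` by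
orthonormality. Polynomial growth in `n` is all that is needed later. -/
lemma abs_lagDer_zero_le (n : ℕ) {x : ℝ} (hx : 0 ≤ x) : |lagDer 0 n x| ≤ n + 2 := by
  set g : ℝ → ℝ := fun x => lagDer 0 n x ^ 2 +
    (n + 1) * ∑ j ∈ Finset.range (n + 1), lagDer 0 j x ^ 2 with hg
  have hgi : IntegrableOn g (Ioi 0) := (integrableOn_lagDer_sq n).add
    ((integrable_finsetSum _ fun j _ => integrableOn_lagDer_sq j).const_mul _)
  have hg0 : ∀ x, 0 ≤ g x := fun x => by positivity
  have hint : ∫ x in Ioi (0 : ℝ), g x = 1 + (n + 1) * (n + 1) := by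
    rw [hg, integral_add (integrableOn_lagDer_sq n)
      ((integrable_finsetSum _ fun j _ => integrableOn_lagDer_sq j).const_mul _),
      integral_const_mul, integral_finsetSum _ fun j _ => integrableOn_lagDer_sq j]
    simp [sq, integral_lagDer_mul]
  have hd : ∀ y ∈ uIcc 0 x, HasDerivAt (fun y => lagDer 0 n y ^ 2)
      (2 * lagDer 0 n y * lagDer 1 n y) y := fun y _ => by
    exact ((hasDerivAt_lagDer 0 n y).pow 2).congr_deriv (by simp)
  have hc : Continuous fun y => 2 * lagDer 0 n y * lagDer 1 n y :=
    (continuous_const.mul (continuous_lagDer 0 n)).mul (continuous_lagDer 1 n)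
  have hftc := intervalIntegral.integral_eq_sub_of_hasDerivAt hd (hc.intervalIntegrable 0 x)
  have h0 : lagDer 0 n 0 = 1 := by simp [lagDer, eval_zero_lagPoly]
  have hle : ∫ y in (0 : ℝ)..x, 2 * lagDer 0 n y * lagDer 1 n y ≤ ∫ y in Ioi (0 : ℝ), g y := by
    rw [intervalIntegral.integral_of_le hx]
    calc ∫ y in Ioc 0 x, 2 * lagDer 0 n y * lagDer 1 n y ≤ ∫ y in Ioc 0 x, g y := by
          refine integral_mono hc.integrableOn_Ioc (hgi.mono_set Ioc_subset_Ioi_self) fun y => ?_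
          have := lagDer_one_sq_le n y
          have h2 := two_mul_le_add_sq (lagDer 0 n y) (lagDer 1 n y)
          simp only [hg]
          linarith
      _ ≤ _ := setIntegral_mono_set hgi (Eventually.of_forall hg0)
          (Eventually.of_forall Ioc_subset_Ioi_self)
  rw [hftc, hint, h0] at hle
  refine abs_le_of_sq_le_sq ?_ (by positivity)
  nlinarith [(Nat.cast_nonneg n : (0 : ℝ) ≤ n)]

/-- The three-term recurrence trades each factor `x` for one power of `n`. -/
lemma exists_lagDer_zero_bound (k : ℕ) : ∃ C : ℝ, 0 ≤ C ∧ ∃ K : ℕ, ∀ (n : ℕ) (x : ℝ), 0 ≤ x →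
    x ^ k * |lagDer 0 n x| ≤ C * (1 + n : ℝ) ^ K := by
  induction k with
  | zero =>
    refine ⟨2, by norm_num, 1, fun n x hx => ?_⟩
    have := abs_lagDer_zero_le n hx
    rw [pow_zero, one_mul, pow_one]
    linarith [(Nat.cast_nonneg n : (0 : ℝ) ≤ n)]
  | succ k ih =>
    obtain ⟨C, hC, K, h⟩ := ih
    -- The `2 ^ K` comes from `2 + n ≤ 2 (1 + n)` in the term with index `n + 1`; the `3` bounds the
    -- coefficients `2 n + 1` and `n` of the other two.
    refine ⟨C * (3 + 2 ^ K), by positivity, K + 1, fun n x hx => ?_⟩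
    have hn : (0 : ℝ) ≤ n := Nat.cast_nonneg n
    have hxk : 0 ≤ x ^ k := by positivity
    have hA : (0 : ℝ) ≤ C * (1 + n) ^ K := by positivity
    have h1 := h n x hx
    have h2 : x ^ k * |lagDer 0 (n + 1) x| ≤ C * (2 ^ K * (1 + n) ^ K) := by
      refine (h (n + 1) x hx).trans (mul_le_mul_of_nonneg_left ?_ hC)
      rw [← mul_pow]
      refine pow_le_pow_left₀ (by positivity) ?_ _
      push_cast
      linarith
    have h3 : x ^ k * |lagDer 0 (n - 1) x| ≤ C * (1 + n) ^ K := by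
      refine (h (n - 1) x hx).trans (mul_le_mul_of_nonneg_left ?_ hC)
      refine pow_le_pow_left₀ (by positivity) ?_ _
      have : ((n - 1 : ℕ) : ℝ) ≤ n := by exact_mod_cast Nat.sub_le n 1
      linarith
    have hb : |x * lagDer 0 n x| ≤ (2 * n + 1) * |lagDer 0 n x| + (n + 1) * |lagDer 0 (n + 1) x|
        + n * |lagDer 0 (n - 1) x| := by
      rw [lagDer_three_term]
      refine (abs_sub _ _).trans (add_le_add ((abs_sub _ _).trans (add_le_add ?_ ?_)) ?_) <;>
      · rw [abs_mul, abs_of_nonneg (by positivity)]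
    calc x ^ (k + 1) * |lagDer 0 n x| = x ^ k * |x * lagDer 0 n x| := by
          rw [abs_mul, abs_of_nonneg hx]; ring
      _ ≤ x ^ k * ((2 * n + 1) * |lagDer 0 n x| + (n + 1) * |lagDer 0 (n + 1) x|
          + n * |lagDer 0 (n - 1) x|) := mul_le_mul_of_nonneg_left hb hxk
      _ = (2 * n + 1) * (x ^ k * |lagDer 0 n x|) + (n + 1) * (x ^ k * |lagDer 0 (n + 1) x|)
          + n * (x ^ k * |lagDer 0 (n - 1) x|) := by ring
      _ ≤ (2 * n + 1) * (C * (1 + n) ^ K) + (n + 1) * (C * (2 ^ K * (1 + n) ^ K))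
          + n * (C * (1 + n) ^ K) := by gcongr
      _ ≤ C * (3 + 2 ^ K) * (1 + n) ^ (K + 1) := by
          rw [pow_succ]
          nlinarith

lemma exists_lagDer_bound (k p : ℕ) : ∃ C : ℝ, 0 ≤ C ∧ ∃ K : ℕ, ∀ (n : ℕ) (x : ℝ), 0 ≤ x →
    x ^ k * |lagDer p n x| ≤ C * (1 + n : ℝ) ^ K := by
  induction p with
  | zero => exact exists_lagDer_zero_bound k
  | succ p ih =>
    obtain ⟨C, hC, K, h⟩ := ih
    refine ⟨C, by positivity, K + 1, fun n x hx => ?_⟩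
    have hn : (0 : ℝ) ≤ n := Nat.cast_nonneg n
    have hxk : 0 ≤ x ^ k := by positivity
    have hA : (0 : ℝ) ≤ C * (1 + n) ^ K := by positivity
    have hb : |lagDer (p + 1) n x| ≤ |lagDer p n x| + ∑ j ∈ Finset.range n, |lagDer p j x| := by
      rw [lagDer_succ]
      refine (abs_sub _ _).trans (add_le_add ?_ (Finset.abs_sum_le_sum_abs _ _))
      rw [abs_mul]
      refine mul_le_of_le_one_left (abs_nonneg _) ?_
      norm_num
    calc x ^ k * |lagDer (p + 1) n x|
        ≤ x ^ k * (|lagDer p n x| + ∑ j ∈ Finset.range n, |lagDer p j x|) :=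
          mul_le_mul_of_nonneg_left hb hxk
      _ = x ^ k * |lagDer p n x| + ∑ j ∈ Finset.range n, x ^ k * |lagDer p j x| := by
          rw [mul_add, Finset.mul_sum]
      _ ≤ C * (1 + n) ^ K + ∑ _j ∈ Finset.range n, C * (1 + n) ^ K := by
          refine add_le_add (h n x hx) (Finset.sum_le_sum fun j hj => (h j x hx).trans ?_)
          refine mul_le_mul_of_nonneg_left (pow_le_pow_left₀ (by positivity) ?_ _) hC
          have : (j : ℝ) ≤ n := by exact_mod_cast (Finset.mem_range.1 hj).le
          linarith
      _ = _ := by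
          rw [Finset.sum_const, Finset.card_range, nsmul_eq_mul]
          ring

section LaguerreSeries

/-! ### Laguerre functions of several variables -/

variable {d : ℕ}

/-- The partial derivative `∂^p` of the Laguerre function with index `n`. -/
def lagD (p n : Fin d → ℕ) (x : Fin d → ℝ) : ℂ := ((∏ i, lagDer (p i) (n i) (x i) : ℝ) : ℂ)

/-- The Laguerre series with coefficients `a`, differentiated termwise. -/
def synth (p : Fin d → ℕ) (a : (Fin d → ℕ) → ℂ) (x : Fin d → ℝ) : ℂ := ∑' n, a n * lagD p n x

/-- Rapidly decreasing multi-sequences. -/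
def RapidSeq (a : (Fin d → ℕ) → ℂ) : Prop :=
  ∀ K : ℕ, Summable fun n => ‖a n‖ * (1 + deg n : ℝ) ^ K

lemma orthant_subset_closedOrthant : orthant d ⊆ closedOrthant d := fun _ hx j => (hx j).le

lemma convex_orthant (d : ℕ) : Convex ℝ (orthant d) := by
  intro x hx y hy a b ha hb hab j
  have h1 := hx j
  have h2 := hy j
  simp only [Pi.add_apply, Pi.smul_apply, smul_eq_mul]
  rcases ha.eq_or_lt with rfl | ha
  · obtain rfl : b = 1 := by linarith
    simpa using h2
  · have := mul_pos ha h1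
    have := mul_nonneg hb h2.le
    linarith

lemma exists_lagD_bound (k p : Fin d → ℕ) : ∃ C : ℝ, 0 ≤ C ∧ ∃ K : ℕ, ∀ n, ∀ x ∈ closedOrthant d,
    (∏ j, x j ^ k j) * ‖lagD p n x‖ ≤ C * (1 + deg n : ℝ) ^ K := by
  choose C hC K h using fun i => exists_lagDer_bound (k i) (p i)
  refine ⟨∏ i, C i, Finset.prod_nonneg fun i _ => hC i, ∑ i, K i, fun n x hx => ?_⟩
  rw [lagD, Complex.norm_real, Real.norm_eq_abs, Finset.abs_prod, ← Finset.prod_mul_distrib,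
    ← Finset.prod_pow_eq_pow_sum, ← Finset.prod_mul_distrib]
  refine Finset.prod_le_prod (fun i _ => mul_nonneg (pow_nonneg (hx i) _) (abs_nonneg _))
    fun i _ => (h i (n i) (x i) (hx i)).trans ?_
  refine mul_le_mul_of_nonneg_left (pow_le_pow_left₀ (by positivity) ?_ _) (hC i)
  have : (n i : ℝ) ≤ deg n := by exact_mod_cast le_deg n i
  linarith

lemma exists_norm_lagD_le (p : Fin d → ℕ) : ∃ C : ℝ, 0 ≤ C ∧ ∃ K : ℕ, ∀ n, ∀ x ∈ closedOrthant d,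
    ‖lagD p n x‖ ≤ C * (1 + deg n : ℝ) ^ K := by
  obtain ⟨C, hC, K, h⟩ := exists_lagD_bound 0 p
  exact ⟨C, hC, K, fun n x hx => by simpa using h n x hx⟩

/-- The real linear map with given partial derivatives. -/
def gradCLM (c : Fin d → ℂ) : (Fin d → ℝ) →L[ℝ] ℂ :=
  ∑ i, c i • Complex.ofRealCLM.comp (ContinuousLinearMap.proj i)

lemma gradCLM_apply (c : Fin d → ℂ) (v : Fin d → ℝ) : gradCLM c v = ∑ i, c i * v i := by
  simp [gradCLM]

lemma gradCLM_single (c : Fin d → ℂ) (j : Fin d) : gradCLM c (Pi.single j 1) = c j := by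
  rw [gradCLM_apply, Finset.sum_eq_single j]
  · simp
  · intro i _ hi
    simp [hi]
  · simp

lemma eq_gradCLM (L : (Fin d → ℝ) →L[ℝ] ℂ) : L = gradCLM fun j => L (Pi.single j 1) := by
  refine ContinuousLinearMap.coe_injective (LinearMap.pi_ext' fun i => LinearMap.ext_ring ?_)
  simp [gradCLM_single]

lemma norm_gradCLM_le (c : Fin d → ℂ) : ‖gradCLM c‖ ≤ ∑ i, ‖c i‖ := by
  refine ContinuousLinearMap.opNorm_le_bound _ (Finset.sum_nonneg fun i _ => norm_nonneg _)
    fun v => ?_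
  rw [gradCLM_apply, Finset.sum_mul]
  refine norm_sum_le_of_le _ fun i _ => ?_
  rw [norm_mul, Complex.norm_real]
  exact mul_le_mul_of_nonneg_left (norm_le_pi_norm v i) (norm_nonneg _)

lemma contDiffOn_gradCLM {s : Set (Fin d → ℝ)} {m : WithTop ℕ∞}
    {c : Fin d → (Fin d → ℝ) → ℂ} (hc : ∀ i, ContDiffOn ℝ m (c i) s) :
    ContDiffOn ℝ m (fun x => gradCLM fun i => c i x) s := by
  unfold gradCLM
  exact ContDiffOn.sum fun i _ => (hc i).smul contDiffOn_const

lemma hasFDerivAt_lagD (p n : Fin d → ℕ) (x : Fin d → ℝ) :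
    HasFDerivAt (lagD p n) (gradCLM fun i => lagD (p + Pi.single i 1) n x) x := by
  classical
  have h1 : HasFDerivAt (fun x : Fin d → ℝ => ∏ i, lagDer (p i) (n i) (x i))
      (∑ i, (∏ j ∈ Finset.univ.erase i, lagDer (p j) (n j) (x j)) •
        (lagDer (p i + 1) (n i) (x i) • (ContinuousLinearMap.proj i : (Fin d → ℝ) →L[ℝ] ℝ))) x := by
    refine HasFDerivAt.finsetProd (u := Finset.univ)
      (g := fun i (x : Fin d → ℝ) => lagDer (p i) (n i) (x i)) fun i _ => ?_
    exact (hasDerivAt_lagDer (p i) (n i) (x i)).comp_hasFDerivAt x (hasFDerivAt_apply i x)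
  refine (Complex.ofRealCLM.hasFDerivAt.comp x h1).congr_fderiv ?_
  ext v
  rw [gradCLM_apply]
  simp only [ContinuousLinearMap.comp_apply, _root_.sum_apply,
    _root_.smul_apply, ContinuousLinearMap.proj_apply, smul_eq_mul,
    Complex.ofRealCLM_apply, Complex.ofReal_sum]
  refine Finset.sum_congr rfl fun i _ => ?_
  rw [lagD, ← Complex.ofReal_mul, ← Finset.mul_prod_erase Finset.univ _ (Finset.mem_univ i)]
  congr 1
  have h2 : ∏ j ∈ Finset.univ.erase i, lagDer ((p + Pi.single i 1 : Fin d → ℕ) j) (n j) (x j) =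
      ∏ j ∈ Finset.univ.erase i, lagDer (p j) (n j) (x j) := Finset.prod_congr rfl fun j hj => by
    rw [Pi.add_apply, Pi.single_eq_of_ne (Finset.ne_of_mem_erase hj), add_zero]
  rw [h2, Pi.add_apply, Pi.single_eq_same]
  ring

lemma continuous_lagD (p n : Fin d → ℕ) : Continuous (lagD p n) :=
  continuous_iff_continuousAt.2 fun x => (hasFDerivAt_lagD p n x).continuousAt

lemma partialD_lagD (p n : Fin d → ℕ) (j : Fin d) :
    partialD j (lagD p n) = lagD (p + Pi.single j 1) n := by
  funext x
  rw [partialD, (hasFDerivAt_lagD p n x).fderiv, gradCLM_single]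

namespace RapidSeq

variable {a b : (Fin d → ℕ) → ℂ}

lemma summable_norm (ha : RapidSeq a) : Summable fun n => ‖a n‖ := by
  simpa using ha 0

lemma summable_bound (ha : RapidSeq a) (C : ℝ) (K : ℕ) :
    Summable fun n => ‖a n‖ * (C * (1 + deg n : ℝ) ^ K) := by
  simpa [mul_left_comm] using (ha K).mul_left C

lemma summable_lagD (ha : RapidSeq a) (p : Fin d → ℕ) {x : Fin d → ℝ} (hx : x ∈ closedOrthant d) :
    Summable fun n => ‖a n * lagD p n x‖ := by
  obtain ⟨C, hC, K, h⟩ := exists_norm_lagD_le p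
  refine Summable.of_nonneg_of_le (fun n => norm_nonneg _) (fun n => ?_) (ha.summable_bound C K)
  rw [norm_mul]
  exact mul_le_mul_of_nonneg_left (h n x hx) (norm_nonneg _)

lemma deg_pow_mul (ha : RapidSeq a) (N : ℕ) : RapidSeq fun n => (deg n : ℂ) ^ N * a n := by
  intro K
  refine Summable.of_nonneg_of_le (fun n => by positivity) (fun n => ?_) (ha (N + K))
  rw [norm_mul, norm_pow, Complex.norm_natCast, pow_add]
  have h1 : (deg n : ℝ) ^ N ≤ (1 + deg n : ℝ) ^ N := by gcongr; linarith
  calc (deg n : ℝ) ^ N * ‖a n‖ * (1 + deg n : ℝ) ^ K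
      ≤ (1 + deg n : ℝ) ^ N * ‖a n‖ * (1 + deg n : ℝ) ^ K := by gcongr
    _ = _ := by ring

/-- Termwise differentiation is legitimate because derivatives of Laguerre functions grow
polynomially in the degree, so rapidly decreasing coefficients give a summable majorant. -/
lemma hasFDerivAt_synth (ha : RapidSeq a) (p : Fin d → ℕ) {x : Fin d → ℝ} (hx : x ∈ orthant d) :
    HasFDerivAt (synth p a) (gradCLM fun i => synth (p + Pi.single i 1) a x) x := by
  choose C hC K h using fun i : Fin d => exists_norm_lagD_le (p + Pi.single i 1)
  set u : (Fin d → ℕ) → ℝ := fun n => ∑ i, ‖a n‖ * (C i * (1 + deg n : ℝ) ^ K i)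
  have hu : Summable u := summable_sum fun i _ => ha.summable_bound (C i) (K i)
  have hf : ∀ n, ∀ y ∈ orthant d, HasFDerivAt (fun y => a n * lagD p n y)
      (a n • gradCLM fun i => lagD (p + Pi.single i 1) n y) y := fun n y _ =>
    (hasFDerivAt_lagD p n y).const_smul (a n)
  have hf' : ∀ n, ∀ y ∈ orthant d,
      ‖a n • gradCLM fun i => lagD (p + Pi.single i 1) n y‖ ≤ u n := by
    intro n y hy
    rw [norm_smul, show u n = ‖a n‖ * ∑ i, C i * (1 + deg n : ℝ) ^ K i from
      (Finset.mul_sum _ _ _).symm]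
    refine mul_le_mul_of_nonneg_left ((norm_gradCLM_le _).trans ?_) (norm_nonneg _)
    exact Finset.sum_le_sum fun i _ => h i n y (orthant_subset_closedOrthant hy)
  have hF := hasFDerivAt_tsum_of_isPreconnected hu (isOpen_orthant d)
    (convex_orthant d).isPreconnected hf hf' hx
    (ha.summable_lagD p (orthant_subset_closedOrthant hx)).of_norm hx
  refine hF.congr_fderiv ?_
  have hs : Summable fun n => a n • gradCLM fun i => lagD (p + Pi.single i 1) n x :=
    Summable.of_norm_bounded hu fun n => hf' n x hx
  rw [eq_gradCLM (∑' n, _)]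
  congr 1
  funext j
  have := ((ContinuousLinearMap.apply ℝ ℂ (Pi.single j (1 : ℝ) : Fin d → ℝ)).map_tsum hs)
  simp only [ContinuousLinearMap.apply_apply, _root_.smul_apply, gradCLM_single,
    smul_eq_mul] at this
  exact this

lemma partialD_synth (ha : RapidSeq a) (p : Fin d → ℕ) (j : Fin d) :
    EqOn (partialD j (synth p a)) (synth (p + Pi.single j 1) a) (orthant d) := fun x hx => by
  rw [partialD, (ha.hasFDerivAt_synth p hx).fderiv, gradCLM_single]

lemma isSmooth_synth (ha : RapidSeq a) (p : Fin d → ℕ) : IsSmooth (synth p a) := by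
  refine contDiffOn_infty.2 fun m => ?_
  induction m generalizing p with
  | zero =>
    refine contDiffOn_zero.2 fun x hx => ?_
    exact (ha.hasFDerivAt_synth p hx).continuousAt.continuousWithinAt
  | succ m ih =>
    rw [Nat.cast_add, Nat.cast_one, contDiffOn_succ_iff_fderiv_of_isOpen (isOpen_orthant d)]
    refine ⟨fun x hx => (ha.hasFDerivAt_synth p hx).differentiableAt.differentiableWithinAt,
      by simp, ?_⟩
    refine (contDiffOn_gradCLM fun i => ih (p + Pi.single i 1)).congr fun x hx => ?_
    exact (ha.hasFDerivAt_synth p hx).fderiv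

lemma iterate_partialD_synth (ha : RapidSeq a) (p : Fin d → ℕ) (j : Fin d) (k : ℕ) :
    EqOn ((partialD j)^[k] (synth p a)) (synth (p + Pi.single j k) a) (orthant d) := by
  induction k generalizing p with
  | zero => simp [EqOn]
  | succ k ih =>
    rw [Function.iterate_succ, Function.comp_apply]
    refine (((locLin_partialD j).iterate k).congr _ _ (ha.partialD_synth p j)).trans ?_
    refine (ih (p + Pi.single j 1)).trans ?_
    rw [add_assoc, ← Pi.single_add, add_comm 1 k]
    exact fun x _ => rfl

lemma multiD_synth (ha : RapidSeq a) (p : Fin d → ℕ) :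
    EqOn (multiD p (synth 0 a)) (synth p a) (orthant d) := by
  -- Induction over the list of coordinates; without repetitions each order `p j` is added exactly
  -- once.
  have key : ∀ l : List (Fin d), l.Nodup →
      EqOn (l.foldr (fun j g => (partialD j)^[p j] g) (synth 0 a))
        (synth (fun i => if i ∈ l then p i else 0) a) (orthant d) := by
    intro l hl
    induction l with
    | nil =>
      intro x _
      simp only [List.foldr_nil, List.not_mem_nil, if_false]
      rfl
    | cons j l ih =>
      rw [List.nodup_cons] at hl
      rw [List.foldr_cons]
      refine (((locLin_partialD j).iterate (p j)).congr _ _ (ih hl.2)).trans ?_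
      refine (ha.iterate_partialD_synth _ j (p j)).trans ?_
      have : (fun i => if i ∈ l then p i else 0) + Pi.single j (p j) =
          fun i => if i ∈ j :: l then p i else 0 := by
        funext i
        rw [Pi.add_apply]
        rcases eq_or_ne i j with rfl | h
        · simp [hl.1]
        · simp [h]
      rw [this]
      exact fun x _ => rfl
  have := key (List.finRange d) (List.nodup_finRange d)
  simpa [multiD] using this

lemma continuousOn_synth (ha : RapidSeq a) (p : Fin d → ℕ) :
    ContinuousOn (synth p a) (closedOrthant d) := by
  obtain ⟨C, hC, K, h⟩ := exists_norm_lagD_le p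
  refine continuousOn_tsum (fun n => (continuous_const.mul (continuous_lagD p n)).continuousOn)
    (ha.summable_bound C K) fun n x hx => ?_
  rw [norm_mul]
  exact mul_le_mul_of_nonneg_left (h n x hx) (norm_nonneg _)

lemma exists_synth_bound (ha : RapidSeq a) (k p : Fin d → ℕ) : ∃ C : ℝ, ∀ x ∈ orthant d,
    (∏ j, x j ^ k j) * ‖synth p a x‖ ≤ C := by
  obtain ⟨C, hC, K, h⟩ := exists_lagD_bound k p
  refine ⟨∑' n, ‖a n‖ * (C * (1 + deg n : ℝ) ^ K), fun x hx => ?_⟩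
  have hx' := orthant_subset_closedOrthant hx
  have hk : 0 ≤ ∏ j, x j ^ k j := Finset.prod_nonneg fun j _ => pow_nonneg (hx' j) _
  have hs := ha.summable_lagD p hx'
  calc (∏ j, x j ^ k j) * ‖synth p a x‖
      ≤ (∏ j, x j ^ k j) * ∑' n, ‖a n * lagD p n x‖ :=
        mul_le_mul_of_nonneg_left (norm_tsum_le_tsum_norm hs) hk
    _ = ∑' n, (∏ j, x j ^ k j) * ‖a n * lagD p n x‖ := tsum_mul_left.symm
    _ ≤ _ := by
        refine (hs.mul_left _).tsum_le_tsum (fun n => ?_) (ha.summable_bound C K)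
        rw [norm_mul, mul_left_comm]
        exact mul_le_mul_of_nonneg_left (h n x hx') (norm_nonneg _)

end RapidSeq

/-- The sum of a Laguerre series on the orthant. -/
def lagSum (a : (Fin d → ℕ) → ℂ) : (Fin d → ℝ) → ℂ := (orthant d).indicator (synth 0 a)

lemma eqOn_lagSum (a : (Fin d → ℕ) → ℂ) : EqOn (lagSum a) (synth 0 a) (orthant d) :=
  eqOn_indicator

namespace RapidSeq

variable {a : (Fin d → ℕ) → ℂ}

lemma isSchwartz_lagSum (ha : RapidSeq a) : IsSchwartz (lagSum a) where
  zero_off x hx := indicator_of_notMem hx _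
  smooth := ContDiffOn.congr (ha.isSmooth_synth 0) (eqOn_lagSum a)
  extends_cont p := ⟨synth p a, ha.continuousOn_synth p,
    (((locLin_multiD p).congr _ _ (eqOn_lagSum a)).trans (ha.multiD_synth p)).symm⟩
  decay k p := by
    obtain ⟨C, h⟩ := ha.exists_synth_bound k p
    refine ⟨C, fun x hx => ?_⟩
    rw [(locLin_multiD p).congr _ _ (eqOn_lagSum a) hx, ha.multiD_synth p hx]
    exact h x hx

end RapidSeq

lemma lagD_ode (n : Fin d → ℕ) (j : Fin d) (x : Fin d → ℝ) :
    (x j : ℂ) * lagD (0 + Pi.single j 1 + Pi.single j 1) n x + lagD (0 + Pi.single j 1) n x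
      - (x j : ℂ) / 4 * lagD 0 n x + 1 / 2 * lagD 0 n x = -((n j : ℂ) * lagD 0 n x) := by
  classical
  have h : ∀ p : Fin d → ℕ, (∀ i ≠ j, p i = 0) → lagD p n x =
      ((lagDer (p j) (n j) (x j) * ∏ i ∈ Finset.univ.erase j, lagDer 0 (n i) (x i) : ℝ) : ℂ) := by
    intro p hp
    rw [lagD, ← Finset.mul_prod_erase Finset.univ _ (Finset.mem_univ j),
      Finset.prod_congr rfl (g := fun i => lagDer 0 (n i) (x i)) fun i hi => by
        rw [hp i (Finset.ne_of_mem_erase hi)]]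
  rw [h _ (fun i hi => by simp [hi]), h _ (fun i hi => by simp [hi]), h 0 (fun i _ => rfl)]
  have := lagDer_ode (n j) (x j)
  simp only [Pi.add_apply, Pi.zero_apply, Pi.single_eq_same, zero_add, Nat.reduceAdd]
  have hc := congrArg (fun t : ℝ => ((t * ∏ i ∈ Finset.univ.erase j, lagDer 0 (n i) (x i) : ℝ) : ℂ))
    this
  push_cast at hc ⊢
  linear_combination hc

/-- The one-variable eigenvalues `n_j` add up to `|n|`. -/
lemma laguerreOp_lagD (n : Fin d → ℕ) : laguerreOp (lagD 0 n) = (deg n : ℂ) • lagD 0 n := by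
  funext x
  rw [laguerreOp, Pi.smul_apply, smul_eq_mul]
  simp only [partialD_lagD, lagD_ode]
  rw [Finset.sum_neg_distrib, neg_neg, ← Finset.sum_mul, deg]
  push_cast
  rfl

namespace RapidSeq

variable {a : (Fin d → ℕ) → ℂ}

lemma laguerreOp_synth (ha : RapidSeq a) :
    EqOn (laguerreOp (synth 0 a)) (synth 0 fun n => (deg n : ℂ) * a n) (orthant d) := by
  intro x hx
  have hs := fun p => (ha.summable_lagD p (orthant_subset_closedOrthant hx)).of_norm
  have hj : ∀ j, (x j : ℂ) * partialD j (partialD j (synth 0 a)) x + partialD j (synth 0 a) x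
      - (x j : ℂ) / 4 * synth 0 a x + 1 / 2 * synth 0 a x =
      ∑' n, -((n j : ℂ) * (a n * lagD 0 n x)) := by
    intro j
    rw [(locLin_partialD j).congr _ _ (ha.partialD_synth 0 j) hx, ha.partialD_synth _ j hx,
      ha.partialD_synth 0 j hx]
    simp only [synth]
    rw [← tsum_mul_left, ← tsum_mul_left, ← tsum_mul_left,
      ← ((hs _).mul_left _).tsum_add (hs _),
      ← (((hs _).mul_left _).add (hs _)).tsum_sub ((hs _).mul_left _),
      ← ((((hs _).mul_left _).add (hs _)).sub ((hs _).mul_left _)).tsum_add ((hs _).mul_left _)]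
    refine tsum_congr fun n => ?_
    linear_combination a n * lagD_ode n j x
  have hsj : ∀ j : Fin d, Summable fun n : Fin d → ℕ => -((n j : ℂ) * (a n * lagD 0 n x)) := by
    intro j
    refine Summable.of_norm_bounded
      ((ha.deg_pow_mul 1).summable_lagD 0 (orthant_subset_closedOrthant hx)) fun n => ?_
    rw [norm_neg, pow_one, mul_assoc, norm_mul, norm_mul (deg n : ℂ), Complex.norm_natCast,
      Complex.norm_natCast]
    refine mul_le_mul_of_nonneg_right ?_ (norm_nonneg _)
    exact_mod_cast le_deg n j
  rw [laguerreOp]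
  simp only [hj]
  rw [← Summable.tsum_finsetSum fun j _ => hsj j, synth, ← tsum_neg]
  refine tsum_congr fun n => ?_
  rw [Finset.sum_neg_distrib, neg_neg, ← Finset.sum_mul, deg]
  push_cast
  ring

lemma iterate_laguerreOp_lagSum (ha : RapidSeq a) (N : ℕ) :
    EqOn (laguerreOp^[N] (lagSum a)) (synth 0 fun n => (deg n : ℂ) ^ N * a n) (orthant d) := by
  induction N with
  | zero => simpa using eqOn_lagSum a
  | succ N ih =>
    rw [Function.iterate_succ', Function.comp_apply]
    refine (locLin_laguerreOp.congr _ _ ih).trans ?_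
    refine (ha.deg_pow_mul N).laguerreOp_synth.trans fun x _ => ?_
    simp only [pow_succ', mul_assoc]

end RapidSeq

end LaguerreSeries

section LaguerreIntegrals

variable {d : ℕ}

/-! ### Laguerre coefficients -/

/-- Lebesgue measure on the orthant. -/
abbrev orthantMeasure (d : ℕ) : Measure (Fin d → ℝ) := volume.restrict (orthant d)

lemma orthantMeasure_eq_pi (d : ℕ) :
    orthantMeasure d = Measure.pi fun _ : Fin d => volume.restrict (Ioi (0 : ℝ)) := by
  have : orthant d = Set.pi univ fun _ => Ioi 0 := by
    ext x
    simp [orthant]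
  rw [orthantMeasure, this, volume_pi, Measure.restrict_pi_pi]

lemma integral_lagD_mul (m n : Fin d → ℕ) :
    ∫ x in orthant d, lagD 0 m x * lagD 0 n x = if m = n then 1 else 0 := by
  have h1 : ∀ x, lagD 0 m x * lagD 0 n x =
      ((∏ i, lagDer 0 (m i) (x i) * lagDer 0 (n i) (x i) : ℝ) : ℂ) := fun x => by
    rw [Finset.prod_mul_distrib, Complex.ofReal_mul]
    rfl
  simp only [h1]
  change ∫ x, _ ∂(orthantMeasure d) = _
  rw [integral_complex_ofReal, orthantMeasure_eq_pi,
    integral_fintype_prod_eq_prod (f := fun i t => lagDer 0 (m i) t * lagDer 0 (n i) t)]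
  simp only [integral_lagDer_mul]
  split_ifs with h
  · simp [h]
  · obtain ⟨i, hi⟩ := Function.ne_iff.1 h
    rw [Finset.prod_eq_zero (Finset.mem_univ i) (if_neg hi), Complex.ofReal_zero]

lemma integrable_lagD_mul (m n : Fin d → ℕ) :
    Integrable (fun x => lagD 0 m x * lagD 0 n x) (orthantMeasure d) := by
  have h1 : ∀ x, lagD 0 m x * lagD 0 n x =
      ((∏ i, lagDer 0 (m i) (x i) * lagDer 0 (n i) (x i) : ℝ) : ℂ) := fun x => by
    rw [Finset.prod_mul_distrib, Complex.ofReal_mul]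
    rfl
  simp only [h1]
  rw [orthantMeasure_eq_pi]
  exact (Integrable.fintype_prod (f := fun i t => lagDer 0 (m i) t * lagDer 0 (n i) t)
    fun i => integrableOn_lagDer_mul (m i) (n i)).ofReal

lemma norm_lagD_sq (n : Fin d → ℕ) (x : Fin d → ℝ) :
    ((‖lagD 0 n x‖ ^ 2 : ℝ) : ℂ) = lagD 0 n x * lagD 0 n x := by
  rw [lagD, Complex.norm_real, Real.norm_eq_abs, sq_abs, sq, Complex.ofReal_mul]

lemma integrable_norm_lagD_sq (n : Fin d → ℕ) :
    Integrable (fun x => ‖lagD 0 n x‖ ^ 2) (orthantMeasure d) := by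
  have h : Integrable (fun x => ((‖lagD 0 n x‖ ^ 2 : ℝ) : ℂ)) (orthantMeasure d) := by
    simp only [norm_lagD_sq]
    exact integrable_lagD_mul n n
  exact h.re

lemma integral_norm_lagD_sq (n : Fin d → ℕ) : ∫ x in orthant d, ‖lagD 0 n x‖ ^ 2 = 1 := by
  have h : ((∫ x in orthant d, ‖lagD 0 n x‖ ^ 2 : ℝ) : ℂ) = 1 := by
    rw [← integral_complex_ofReal]
    simp only [norm_lagD_sq]
    rw [integral_lagD_mul, if_pos rfl]
  exact_mod_cast h

lemma eLpNorm_lagD (n : Fin d → ℕ) : eLpNorm (lagD 0 n) 2 (orthantMeasure d) = 1 := by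
  have h : MemLp (lagD 0 n) 2 (orthantMeasure d) :=
    (memLp_two_iff_integrable_sq_norm (continuous_lagD 0 n).aestronglyMeasurable).2
      (integrable_norm_lagD_sq n)
  rw [h.eLpNorm_eq_integral_rpow_norm (by norm_num) (by norm_num)]
  have := integral_norm_lagD_sq n
  simp [this]

/-- Triangle inequality for functions of norm one. Fatou's lemma transfers the bound on partial sums
to the pointwise sum, and boxes are used because it requires a sequence. -/
lemma eLpNorm_synth_le {a : (Fin d → ℕ) → ℂ} (ha : RapidSeq a) :
    eLpNorm (synth 0 a) 2 (orthantMeasure d) ≤ ENNReal.ofReal (∑' n, ‖a n‖) := by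
  set B : ℕ → Finset (Fin d → ℕ) := fun N => Fintype.piFinset fun _ => Finset.range N
  have hB : Tendsto B atTop atTop := by
    refine tendsto_atTop_finset_of_monotone (fun N M h => Fintype.piFinset_subset _ _ fun _ =>
      Finset.range_mono h) fun n => ⟨deg n + 1, Fintype.mem_piFinset.2 fun i => ?_⟩
    exact Finset.mem_range.2 (Nat.lt_succ_of_le (le_deg n i))
  set F : ℕ → (Fin d → ℝ) → ℂ := fun N => ∑ n ∈ B N, a n • lagD 0 n
  have hF : ∀ N, AEStronglyMeasurable (F N) (orthantMeasure d) := fun N =>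
    Finset.aestronglyMeasurable_sum _ fun n _ =>
      (continuous_lagD 0 n).aestronglyMeasurable.const_smul (a n)
  have hlim : ∀ᵐ x ∂(orthantMeasure d), Tendsto (fun N => F N x) atTop (𝓝 (synth 0 a x)) := by
    refine ae_restrict_of_forall_mem (isOpen_orthant d).measurableSet fun x hx => ?_
    have := (ha.summable_lagD 0 (orthant_subset_closedOrthant hx)).of_norm.hasSum
    rw [HasSum, SummationFilter.unconditional_filter] at this
    refine (this.comp hB).congr fun N => ?_
    simp [F]
  refine (Lp.eLpNorm_lim_le_liminf_eLpNorm hF _ hlim).trans ?_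
  refine liminf_le_of_frequently_le' (Frequently.of_forall fun N => ?_)
  calc eLpNorm (F N) 2 (orthantMeasure d)
      ≤ ∑ n ∈ B N, eLpNorm (a n • lagD 0 n) 2 (orthantMeasure d) :=
        eLpNorm_sum_le (fun n _ => (continuous_lagD 0 n).aestronglyMeasurable.const_smul (a n))
          (by norm_num)
    _ = ∑ n ∈ B N, ENNReal.ofReal ‖a n‖ := by
        refine Finset.sum_congr rfl fun n _ => ?_
        rw [eLpNorm_const_smul, eLpNorm_lagD, mul_one, ofReal_norm]
    _ = ENNReal.ofReal (∑ n ∈ B N, ‖a n‖) :=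
        (ENNReal.ofReal_sum_of_nonneg fun n _ => norm_nonneg _).symm
    _ ≤ _ := ENNReal.ofReal_le_ofReal
        (ha.summable_norm.sum_le_tsum _ fun n _ => norm_nonneg _)

/-- The Laguerre coefficients of a function on the orthant. -/
def lagCoeff (f : (Fin d → ℝ) → ℂ) (n : Fin d → ℕ) : ℂ := ∫ x in orthant d, f x * lagD 0 n x

lemma lagCoeff_congr {f g : (Fin d → ℝ) → ℂ} (h : EqOn f g (orthant d)) :
    lagCoeff f = lagCoeff g := by
  funext n
  refine setIntegral_congr_fun (isOpen_orthant d).measurableSet fun x hx => ?_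
  simp only [h hx]

lemma integral_norm_lagD_mul_le (m n : Fin d → ℕ) :
    ∫ x in orthant d, ‖lagD 0 m x * lagD 0 n x‖ ≤ 1 := by
  calc ∫ x in orthant d, ‖lagD 0 m x * lagD 0 n x‖
      ≤ ∫ x in orthant d, (1 / 2 * ‖lagD 0 m x‖ ^ 2 + 1 / 2 * ‖lagD 0 n x‖ ^ 2) := by
        refine integral_mono (integrable_lagD_mul m n).norm
          (((integrable_norm_lagD_sq m).const_mul _).add ((integrable_norm_lagD_sq n).const_mul _))
          fun x => ?_
        have := two_mul_le_add_sq ‖lagD 0 m x‖ ‖lagD 0 n x‖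
        simp only [norm_mul]
        linarith
    _ = 1 := by
        rw [integral_add ((integrable_norm_lagD_sq m).const_mul _)
          ((integrable_norm_lagD_sq n).const_mul _), integral_const_mul, integral_const_mul,
          integral_norm_lagD_sq, integral_norm_lagD_sq]
        norm_num

lemma lagCoeff_lagSum {a : (Fin d → ℕ) → ℂ} (ha : RapidSeq a) : lagCoeff (lagSum a) = a := by
  rw [lagCoeff_congr (eqOn_lagSum a)]
  funext m
  have hi : ∀ n, Integrable (fun x => a n * (lagD 0 n x * lagD 0 m x)) (orthantMeasure d) :=
    fun n => (integrable_lagD_mul n m).const_mul (a n)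
  have hs : Summable fun n => ∫ x in orthant d, ‖a n * (lagD 0 n x * lagD 0 m x)‖ := by
    refine Summable.of_nonneg_of_le (fun n => integral_nonneg fun x => norm_nonneg _)
      (fun n => ?_) ha.summable_norm
    simp only [norm_mul (a n)]
    rw [integral_const_mul]
    exact mul_le_of_le_one_right (norm_nonneg _) (integral_norm_lagD_mul_le n m)
  have h := hasSum_integral_of_summable_integral_norm hi hs
  have h2 : ∀ n, ∫ x in orthant d, a n * (lagD 0 n x * lagD 0 m x) = if n = m then a m else 0 := by
    intro n
    rw [integral_const_mul, integral_lagD_mul]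
    split_ifs with hnm
    · rw [hnm, mul_one]
    · rw [mul_zero]
  simp only [h2] at h
  refine Eq.trans ?_ ((hasSum_ite_eq m (a m)).unique h).symm
  refine integral_congr_ae (Eventually.of_forall fun x => ?_)
  simp only [synth, ← tsum_mul_right, mul_assoc]

lemma enorm_lagCoeff_le {f : (Fin d → ℝ) → ℂ} (hf : IsSmooth f) (n : Fin d → ℕ) :
    ‖lagCoeff f n‖ₑ ≤ eLpNorm f 2 (orthantMeasure d) := by
  calc ‖lagCoeff f n‖ₑ ≤ ∫⁻ x in orthant d, ‖f x * lagD 0 n x‖ₑ := enorm_integral_le_lintegral_enorm _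
    _ = eLpNorm (f • lagD 0 n) 1 (orthantMeasure d) := by
        rw [eLpNorm_one_eq_lintegral_enorm]
        rfl
    _ ≤ eLpNorm f 2 (orthantMeasure d) * eLpNorm (lagD 0 n) 2 (orthantMeasure d) :=
        eLpNorm_smul_le_mul_eLpNorm (continuous_lagD 0 n).aestronglyMeasurable
          hf.aestronglyMeasurable
    _ = _ := by rw [eLpNorm_lagD, mul_one]

end LaguerreIntegrals

section Decay

variable {d : ℕ}

/-! ### Decaying functions -/

/-- Functions smooth on the orthant all of whose partial derivatives up to a given order decay
faster than every monomial. -/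
def Decays : ℕ → ((Fin d → ℝ) → ℂ) → Prop
  | 0, f => IsSmooth f ∧ ∀ k : Fin d → ℕ, ∃ C : ℝ, ∀ x ∈ orthant d, (∏ j, x j ^ k j) * ‖f x‖ ≤ C
  | m + 1, f => Decays 0 f ∧ ∀ j, Decays m (partialD j f)

lemma prod_pow_nonneg {x : Fin d → ℝ} (hx : x ∈ orthant d) (k : Fin d → ℕ) :
    0 ≤ ∏ j, x j ^ k j := Finset.prod_nonneg fun j _ => pow_nonneg (hx j).le _

lemma isSmooth_lagD (p n : Fin d → ℕ) : IsSmooth (lagD p n) := by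
  refine contDiffOn_infty.2 fun m => ?_
  induction m generalizing p with
  | zero => exact contDiffOn_zero.2 (continuous_lagD p n).continuousOn
  | succ m ih =>
    rw [Nat.cast_add, Nat.cast_one, contDiffOn_succ_iff_fderiv_of_isOpen (isOpen_orthant d)]
    refine ⟨fun x hx => (hasFDerivAt_lagD p n x).differentiableAt.differentiableWithinAt,
      by simp, ?_⟩
    refine (contDiffOn_gradCLM fun i => ih (p + Pi.single i 1)).congr fun x hx => ?_
    exact (hasFDerivAt_lagD p n x).fderiv

lemma partialD_mul {f g : (Fin d → ℝ) → ℂ} (hf : IsSmooth f) (hg : IsSmooth g) (j : Fin d) :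
    EqOn (partialD j fun x => f x * g x) ((fun x => partialD j f x * g x) +
      fun x => f x * partialD j g x) (orthant d) := fun x hx => by
  have : HasFDerivAt (fun x => f x * g x) _ x :=
    (hf.differentiableAt hx).hasFDerivAt.mul (hg.differentiableAt hx).hasFDerivAt
  rw [partialD, this.fderiv]
  simp only [_root_.add_apply, _root_.smul_apply, smul_eq_mul, Pi.add_apply,
    partialD]
  ring

lemma partialD_coord (i j : Fin d) :
    partialD i (fun x : Fin d → ℝ => (x j : ℂ)) = fun _ => if i = j then 1 else 0 := by
  funext x
  have h : HasFDerivAt (fun x : Fin d → ℝ => (x j : ℂ)) (Complex.ofRealCLM.comp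
      (ContinuousLinearMap.proj j : (Fin d → ℝ) →L[ℝ] ℝ)) x :=
    Complex.ofRealCLM.hasFDerivAt.comp x (hasFDerivAt_apply j x)
  rw [partialD, h.fderiv]
  simp only [ContinuousLinearMap.comp_apply, ContinuousLinearMap.proj_apply,
    Complex.ofRealCLM_apply, Pi.single_apply, eq_comm (a := j)]
  split_ifs <;> simp

lemma decays_zero_iff {f : (Fin d → ℝ) → ℂ} : Decays 0 f ↔
    IsSmooth f ∧ ∀ k : Fin d → ℕ, ∃ C : ℝ, ∀ x ∈ orthant d, (∏ j, x j ^ k j) * ‖f x‖ ≤ C := by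
  rw [Decays]

lemma decays_succ_iff {m : ℕ} {f : (Fin d → ℝ) → ℂ} :
    Decays (m + 1) f ↔ Decays 0 f ∧ ∀ j, Decays m (partialD j f) := by
  simp only [Decays]

namespace Decays

variable {m : ℕ} {f g : (Fin d → ℝ) → ℂ}

lemma bound (h : Decays 0 f) (k : Fin d → ℕ) :
    ∃ C : ℝ, ∀ x ∈ orthant d, (∏ j, x j ^ k j) * ‖f x‖ ≤ C := (decays_zero_iff.1 h).2 k

lemma partialD (h : Decays (m + 1) f) (j : Fin d) : Decays m (partialD j f) :=
  (decays_succ_iff.1 h).2 j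

lemma zero_of (h : Decays m f) : Decays 0 f := by
  cases m with
  | zero => exact h
  | succ m => exact (decays_succ_iff.1 h).1

lemma smooth (h : Decays m f) : IsSmooth f := (decays_zero_iff.1 h.zero_of).1

lemma of_succ (h : Decays (m + 1) f) : Decays m f := by
  induction m generalizing f with
  | zero => exact h.zero_of
  | succ m ih => exact decays_succ_iff.2 ⟨h.zero_of, fun j => ih (h.partialD j)⟩

lemma congr (h : Decays m f) (e : EqOn g f (orthant d)) : Decays m g := by
  induction m generalizing f g with
  | zero =>
    refine decays_zero_iff.2 ⟨ContDiffOn.congr h.smooth e, fun k => (h.bound k).imp fun C hC x hx => ?_⟩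
    rw [e hx]
    exact hC x hx
  | succ m ih =>
    refine decays_succ_iff.2 ⟨decays_zero_iff.2 ⟨ContDiffOn.congr h.smooth e,
      fun k => (h.zero_of.bound k).imp fun C hC x hx => ?_⟩, fun j => ih (h.partialD j) ((locLin_partialD j).congr _ _ e)⟩
    rw [e hx]
    exact hC x hx

lemma of_partialD (h0 : Decays 0 f) (h : ∀ j, ∃ g, Decays m g ∧ EqOn (POrthant.partialD j f) g (orthant d)) :
    Decays (m + 1) f :=
  decays_succ_iff.2 ⟨h0, fun j => let ⟨_, hg, e⟩ := h j; hg.congr e⟩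

lemma add (hf : Decays m f) (hg : Decays m g) : Decays m (f + g) := by
  have h0 : ∀ {f g : (Fin d → ℝ) → ℂ}, Decays 0 f → Decays 0 g → Decays 0 (f + g) := by
    intro f g hf hg
    refine decays_zero_iff.2 ⟨hf.smooth.add hg.smooth, fun k => ?_⟩
    obtain ⟨A, hA⟩ := hf.bound k
    obtain ⟨B, hB⟩ := hg.bound k
    refine ⟨A + B, fun x hx => ?_⟩
    calc _ ≤ (∏ j, x j ^ k j) * (‖f x‖ + ‖g x‖) :=
          mul_le_mul_of_nonneg_left (norm_add_le _ _) (prod_pow_nonneg hx k)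
      _ ≤ A + B := by rw [mul_add]; exact add_le_add (hA x hx) (hB x hx)
  induction m generalizing f g with
  | zero => exact h0 hf hg
  | succ m ih =>
    exact of_partialD (h0 hf.zero_of hg.zero_of) fun j => ⟨_, ih (hf.partialD j) (hg.partialD j),
      (locLin_partialD j).add f g hf.smooth hg.smooth⟩

/-- A bounded smooth factor preserves decay. -/
lemma mul_bounded (hf : Decays 0 f) (hg : IsSmooth g) {B : ℝ}
    (hB : ∀ x ∈ orthant d, ‖g x‖ ≤ B) : Decays 0 fun x => f x * g x := by
  refine decays_zero_iff.2 ⟨ContDiffOn.mul hf.smooth hg, fun k => ?_⟩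
  obtain ⟨A, hA⟩ := hf.bound k
  refine ⟨A * B, fun x hx => ?_⟩
  rw [norm_mul, ← mul_assoc]
  exact mul_le_mul (hA x hx) (hB x hx) (norm_nonneg _)
    ((mul_nonneg (prod_pow_nonneg hx k) (norm_nonneg _)).trans (hA x hx))

lemma smul (c : ℂ) (hf : Decays m f) : Decays m (c • f) := by
  have h0 : ∀ {f : (Fin d → ℝ) → ℂ}, Decays 0 f → Decays 0 (c • f) := fun {f} hf =>
    (hf.mul_bounded (g := fun _ => c) contDiffOn_const (B := ‖c‖) fun _ _ => le_rfl).congr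
      fun x _ => by simp [mul_comm]
  induction m generalizing f with
  | zero => exact h0 hf
  | succ m ih =>
    exact of_partialD (h0 hf.zero_of) fun j => ⟨_, ih (hf.partialD j),
      (locLin_partialD j).smul c f hf.smooth⟩

lemma zero_fun : Decays m (0 : (Fin d → ℝ) → ℂ) := by
  have h0 : Decays 0 (0 : (Fin d → ℝ) → ℂ) := decays_zero_iff.2 ⟨contDiffOn_const, fun k => ⟨0, by simp⟩⟩
  induction m with
  | zero => exact h0
  | succ m ih =>
    refine of_partialD h0 fun j => ⟨0, ih, fun x _ => ?_⟩
    simp [POrthant.partialD]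

lemma sum {ι : Type*} (s : Finset ι) {F : ι → (Fin d → ℝ) → ℂ} (h : ∀ i ∈ s, Decays m (F i)) :
    Decays m (∑ i ∈ s, F i) := by
  classical
  induction s using Finset.induction_on with
  | empty => simpa using zero_fun
  | insert i s hi ih =>
    rw [Finset.sum_insert hi]
    exact (h i (Finset.mem_insert_self i s)).add
      (ih fun k hk => h k (Finset.mem_insert_of_mem hk))

lemma mul_coord (hf : Decays m f) (i : Fin d) : Decays m fun x => (x i : ℂ) * f x := by
  have h0 : ∀ {f : (Fin d → ℝ) → ℂ}, Decays 0 f → Decays 0 fun x => (x i : ℂ) * f x := by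
    intro f hf
    refine decays_zero_iff.2 ⟨ContDiffOn.mul (isSmooth_coord i) hf.smooth, fun k => ?_⟩
    obtain ⟨C, hC⟩ := hf.bound (k + Pi.single i 1)
    refine ⟨C, fun x hx => ?_⟩
    refine Eq.trans_le ?_ (hC x hx)
    have h1 : ∏ j, x j ^ (k + Pi.single i 1 : Fin d → ℕ) j = (∏ j, x j ^ k j) * x i := by
      simp only [Pi.add_apply, pow_add, Finset.prod_mul_distrib]
      congr 1
      rw [Finset.prod_eq_single i (fun j _ hj => by simp [hj]) (by simp)]
      simp
    rw [h1, norm_mul, Complex.norm_real, Real.norm_eq_abs, abs_of_pos (hx i), mul_assoc]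
  induction m generalizing f with
  | zero => exact h0 hf
  | succ m ih =>
    refine of_partialD (h0 hf.zero_of) fun j =>
      ⟨_, ((hf.of_succ).smul (if j = i then 1 else 0)).add (ih (hf.partialD j)), ?_⟩
    refine (partialD_mul (isSmooth_coord i) hf.smooth j).trans fun x _ => ?_
    by_cases h : j = i <;> simp [partialD_coord, h]

lemma mul_lagD (hf : Decays m f) (p n : Fin d → ℕ) : Decays m fun x => f x * lagD p n x := by
  have h0 : ∀ {f : (Fin d → ℝ) → ℂ} (p : Fin d → ℕ), Decays 0 f →
      Decays 0 fun x => f x * lagD p n x := by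
    intro f p hf
    obtain ⟨C, _, K, h⟩ := exists_norm_lagD_le p
    exact hf.mul_bounded (isSmooth_lagD p n) fun x hx => h n x (orthant_subset_closedOrthant hx)
  induction m generalizing f p with
  | zero => exact h0 p hf
  | succ m ih =>
    refine of_partialD (h0 p hf.zero_of) fun j =>
      ⟨_, (ih (hf.partialD j) p).add (ih hf.of_succ (p + Pi.single j 1)), ?_⟩
    refine (partialD_mul hf.smooth (isSmooth_lagD p n) j).trans fun x _ => ?_
    simp [partialD_lagD]

lemma laguerreOp (hf : Decays (m + 2) f) : Decays m (laguerreOp f) := by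
  have h : Decays m ((-1 : ℂ) • ∑ j, ((fun x => (x j : ℂ) * POrthant.partialD j (POrthant.partialD j f) x) +
      POrthant.partialD j f + (-1 / 4 : ℂ) • (fun x => (x j : ℂ) * f x) + (1 / 2 : ℂ) • f)) := by
    refine (sum _ fun j _ => ?_).smul _
    exact (((((hf.partialD j).partialD j).mul_coord j).add (hf.partialD j).of_succ).add
      ((hf.of_succ.of_succ.mul_coord j).smul _)).add (hf.of_succ.of_succ.smul _)
  refine h.congr fun x _ => ?_
  simp only [POrthant.laguerreOp, Pi.smul_apply, Finset.sum_apply, Pi.add_apply, smul_eq_mul,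
    neg_one_mul]
  congr 1
  refine Finset.sum_congr rfl fun j _ => ?_
  ring

/-- Decay survives multiplication by `∏ (1 + x_i²)`, and the reciprocal of this product is
integrable. -/
lemma integrable (hf : Decays 0 f) : Integrable f (orthantMeasure d) := by
  have h1 : ∀ s : Finset (Fin d), Decays 0 fun x => ((∏ i ∈ s, (1 + x i ^ 2) : ℝ) : ℂ) * f x := by
    classical
    intro s
    induction s using Finset.induction_on with
    | empty => simpa using hf
    | insert i s hi ih =>
      refine (ih.add ((ih.mul_coord i).mul_coord i)).congr fun x _ => ?_
      simp only [Finset.prod_insert hi, Pi.add_apply]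
      push_cast
      ring
  obtain ⟨C, hC⟩ := (h1 Finset.univ).bound 0
  have h2 : Integrable (fun x : Fin d → ℝ => ∏ i, (1 + x i ^ 2)⁻¹) (orthantMeasure d) := by
    rw [orthantMeasure_eq_pi]
    exact Integrable.fintype_prod fun i => integrable_inv_one_add_sq.restrict
  refine Integrable.mono' (h2.const_mul C) hf.smooth.aestronglyMeasurable
    (ae_restrict_of_forall_mem (isOpen_orthant d).measurableSet fun x hx => ?_)
  have h3 : 0 < ∏ i, (1 + x i ^ 2) := Finset.prod_pos fun i _ => by positivity
  have := hC x hx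
  simp only [Pi.zero_apply, pow_zero, Finset.prod_const_one, one_mul, norm_mul, Complex.norm_real,
    Real.norm_eq_abs, abs_of_pos h3] at this
  rw [Finset.prod_inv_distrib, ← div_eq_mul_inv, le_div_iff₀ h3]
  linarith

end Decays

end Decay

section Parts

/-! ### Integration by parts on the orthant -/

lemma integral_eq_zero_of_hasDerivAt {w w' : ℝ → ℂ} {C : ℝ}
    (h : ∀ t, 0 < t → HasDerivAt w (w' t) t) (hi : IntegrableOn w' (Ioi 0))
    (h0 : ∀ t, 0 < t → ‖w t‖ ≤ C * t) (h1 : ∀ t, 0 < t → t * ‖w t‖ ≤ C) :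
    ∫ t in Ioi 0, w' t = 0 := by
  -- Nothing is assumed about `w` at zero, so its value there is reset to the limit zero before the
  -- fundamental theorem is applied.
  set v : ℝ → ℂ := (Ioi 0).indicator w with hv
  have hv0 : v 0 = 0 := by simp [hv]
  have hvt : ∀ t, 0 < t → v t = w t := fun t ht => indicator_of_mem (mem_Ioi.2 ht) w
  have hcont : ContinuousWithinAt v (Ici 0) 0 := by
    rw [ContinuousWithinAt, hv0]
    refine squeeze_zero_norm' (a := fun t => C * t) ?_ ?_
    · refine eventually_of_mem self_mem_nhdsWithin fun t ht => ?_
      rcases (mem_Ici.1 ht).eq_or_lt with rfl | ht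
      · simp [hv0]
      · rw [hvt t ht]
        exact h0 t ht
    · have : Tendsto (fun t : ℝ => C * t) (𝓝 0) (𝓝 (C * 0)) := (continuous_const_mul C).tendsto 0
      rw [mul_zero] at this
      exact this.mono_left nhdsWithin_le_nhds
  have hlim : Tendsto v atTop (𝓝 0) := by
    refine squeeze_zero_norm' (a := fun t => C * t⁻¹) ?_ ?_
    · filter_upwards [eventually_gt_atTop 0] with t ht
      rw [hvt t ht, ← div_eq_mul_inv, le_div_iff₀ ht, mul_comm]
      exact h1 t ht
    · simpa using tendsto_inv_atTop_zero.const_mul C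
  rw [integral_Ioi_of_hasDerivAt_of_tendsto hcont (fun t ht => ?_) hi hlim, hv0, sub_zero]
  exact (h t ht).congr_of_eventuallyEq
    (eventually_of_mem (isOpen_Ioi.mem_nhds ht) fun s hs => hvt s hs)

lemma insertNth_mem_orthant {d : ℕ} (j : Fin (d + 1)) {t : ℝ} (ht : 0 < t) {y : Fin d → ℝ}
    (hy : y ∈ orthant d) : (j.insertNth t y : Fin (d + 1) → ℝ) ∈ orthant (d + 1) := by
  intro i
  refine Fin.succAboveCases j ?_ (fun k => ?_) i
  · simpa using ht
  · simpa using hy k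

lemma hasDerivAt_insertNth {d : ℕ} (j : Fin (d + 1)) (t : ℝ) (y : Fin d → ℝ) :
    HasDerivAt (fun t => (j.insertNth t y : Fin (d + 1) → ℝ)) (Pi.single j 1) t := by
  rw [hasDerivAt_pi]
  intro i
  refine Fin.succAboveCases j ?_ (fun k => ?_) i
  · simpa using hasDerivAt_id' t
  · simpa using hasDerivAt_const t (y k)

/-- The integral of a partial derivative over the orthant vanishes if there are no boundary
terms. -/
lemma integral_partialD_eq_zero {d : ℕ} {V : (Fin d → ℝ) → ℂ} {j : Fin d} (hV : Decays 0 V)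
    (hi : Integrable (partialD j fun x => (x j : ℂ) * V x) (orthantMeasure d)) :
    ∫ x in orthant d, partialD j (fun x => (x j : ℂ) * V x) x = 0 := by
  cases d with
  | zero => exact j.elim0
  | succ d =>
    set F := partialD j fun x => (x j : ℂ) * V x
    have hW : IsSmooth fun x => (x j : ℂ) * V x := ContDiffOn.mul (isSmooth_coord j) hV.smooth
    have mp := measurePreserving_piFinSuccAbove
      (fun _ : Fin (d + 1) => volume.restrict (Ioi (0 : ℝ))) j
    change ∫ x, F x ∂(orthantMeasure (d + 1)) = 0
    rw [orthantMeasure_eq_pi] at hi ⊢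
    rw [← mp.symm.integral_comp']
    rw [← mp.symm.integrable_comp_emb (MeasurableEquiv.measurableEmbedding _)] at hi
    refine (integral_prod_symm _ hi).trans ?_
    obtain ⟨A, hA⟩ := hV.bound 0
    -- Boundedness of `V` makes `x_j V` vanish on the boundary; the bound with `x_j²` controls `x_j
    -- * |x_j V|` and gives decay at infinity.
    obtain ⟨B, hB⟩ := hV.bound (Pi.single j 2)
    refine integral_eq_zero_of_ae ?_
    have h1 := hi.prod_left_ae
    rw [← orthantMeasure_eq_pi d] at h1 ⊢
    filter_upwards [h1, ae_restrict_mem (isOpen_orthant d).measurableSet] with y hy hyo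
    refine integral_eq_zero_of_hasDerivAt (C := max A B)
      (w := fun t => (t : ℂ) * V (j.insertNth t y)) (fun t ht => ?_) hy (fun t ht => ?_)
      fun t ht => ?_
    · have h2 := (hW.differentiableAt (insertNth_mem_orthant j ht hyo)).hasFDerivAt.comp_hasDerivAt
        t (hasDerivAt_insertNth j t y)
      simp only [Function.comp_def, Fin.insertNth_apply_same] at h2
      exact h2
    · have := hA _ (insertNth_mem_orthant j ht hyo)
      simp only [Pi.zero_apply, pow_zero, Finset.prod_const_one, one_mul] at this
      rw [norm_mul, Complex.norm_real, Real.norm_eq_abs, abs_of_pos ht, mul_comm]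
      exact mul_le_mul_of_nonneg_right (this.trans (le_max_left _ _)) ht.le
    · have := hB _ (insertNth_mem_orthant j ht hyo)
      rw [Finset.prod_eq_single j (fun i _ hi => by simp [hi]) (by simp)] at this
      simp only [Pi.single_eq_same, Fin.insertNth_apply_same] at this
      rw [norm_mul, Complex.norm_real, Real.norm_eq_abs, abs_of_pos ht, ← mul_assoc, ← sq]
      exact this.trans (le_max_right _ _)

variable {d : ℕ}

/-- Laguerre coefficients diagonalize the Laguerre operator. -/
lemma lagCoeff_laguerreOp {f : (Fin d → ℝ) → ℂ} (hf : Decays 2 f) (n : Fin d → ℕ) :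
    lagCoeff (laguerreOp f) n = (deg n : ℂ) * lagCoeff f n := by
  -- Lagrange's identity: the second-order part of `E` is `-∑ ∂_j x_j ∂_j`, so `(E f) l - f (E l) =
  -- -∑ ∂_j (x_j (∂_j f l - f ∂_j l))`. The factor `x_j` removes the boundary terms, so `f` need not
  -- vanish on the boundary.
  set V : Fin d → (Fin d → ℝ) → ℂ := fun j =>
    (fun x => partialD j f x * lagD 0 n x) +
      (-1 : ℂ) • fun x => f x * lagD (0 + Pi.single j 1) n x with hVdef
  have hV : ∀ j, Decays 1 (V j) := fun j =>
    ((hf.partialD j).mul_lagD 0 n).add ((hf.of_succ.mul_lagD _ n).smul _)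
  have hW : ∀ j, Decays 0 (partialD j fun x => (x j : ℂ) * V j x) := fun j =>
    ((hV j).mul_coord j).partialD j
  have hz := fun j => integral_partialD_eq_zero (hV j).of_succ (hW j).integrable
  have h1 := (hf.laguerreOp.mul_lagD 0 n).integrable
  have h2 := ((hf.zero_of.mul_lagD 0 n).integrable).const_mul (deg n : ℂ)
  have key : ∀ x ∈ orthant d, laguerreOp f x * lagD 0 n x - (deg n : ℂ) * (f x * lagD 0 n x) =
      -∑ j, partialD j (fun x => (x j : ℂ) * V j x) x := by
    intro x hx
    have e1 : (deg n : ℂ) * lagD 0 n x = laguerreOp (lagD 0 n) x := by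
      rw [laguerreOp_lagD, Pi.smul_apply, smul_eq_mul]
    have e2 : (deg n : ℂ) * (f x * lagD 0 n x) = f x * laguerreOp (lagD 0 n) x := by
      rw [← e1]
      ring
    rw [e2, laguerreOp, laguerreOp, mul_neg, neg_mul, Finset.sum_mul, Finset.mul_sum, neg_sub_neg,
      ← Finset.sum_sub_distrib, ← Finset.sum_neg_distrib]
    refine Finset.sum_congr rfl fun j _ => ?_
    have hdf := (hf.partialD j).smooth
    have hs : ∀ p, IsSmooth (lagD p n) := fun p => isSmooth_lagD p n
    have s1 : IsSmooth fun x => partialD j f x * lagD 0 n x := ContDiffOn.mul hdf (hs 0)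
    have s2 : IsSmooth fun x => f x * lagD (0 + Pi.single j 1) n x := ContDiffOn.mul hf.smooth (hs _)
    rw [partialD_mul (isSmooth_coord j) (hV j).smooth j hx]
    simp only [Pi.add_apply, partialD_coord, if_true, one_mul]
    rw [hVdef, (locLin_partialD j).add _ _ s1 (s2.smul _) hx, Pi.add_apply,
      (locLin_partialD j).smul _ _ s2 hx, partialD_mul hdf (hs 0) j hx, Pi.smul_apply,
      partialD_mul hf.smooth (hs _) j hx]
    simp only [Pi.add_apply, Pi.smul_apply, smul_eq_mul, partialD_lagD]
    ring
  have h3 : ∫ x in orthant d, (laguerreOp f x * lagD 0 n x - (deg n : ℂ) * (f x * lagD 0 n x)) =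
      0 := by
    rw [setIntegral_congr_fun (isOpen_orthant d).measurableSet key, integral_neg,
      integral_finsetSum _ fun j _ => (hW j).integrable]
    simp [hz]
  rw [integral_sub h1 h2, integral_const_mul, sub_eq_zero] at h3
  exact h3

/-! ### Schwartz functions decay -/

lemma partialD_comm {f : (Fin d → ℝ) → ℂ} (hf : IsSmooth f) (i j : Fin d) :
    EqOn (partialD i (partialD j f)) (partialD j (partialD i f)) (orthant d) := by
  intro x hx
  have h1 : ContDiffOn ℝ ∞ (fderiv ℝ f) (orthant d) :=
    ContDiffOn.fderiv_of_isOpen hf (isOpen_orthant d) (by simp)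
  have h2 : DifferentiableAt ℝ (fderiv ℝ f) x :=
    (h1.contDiffAt ((isOpen_orthant d).mem_nhds hx)).differentiableAt (by simp)
  have h3 : ∀ i j : Fin d, partialD i (partialD j f) x =
      fderiv ℝ (fderiv ℝ f) x (Pi.single i 1) (Pi.single j 1) := by
    intro i j
    have := h2.hasFDerivAt.clm_apply (hasFDerivAt_const (Pi.single j (1 : ℝ) : Fin d → ℝ) x)
    change fderiv ℝ (fun y => fderiv ℝ f y (Pi.single j 1)) x _ = _
    rw [this.fderiv]
    simp
  have h4 : IsSymmSndFDerivAt ℝ f x :=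
    (ContDiffOn.contDiffAt hf ((isOpen_orthant d).mem_nhds hx)).isSymmSndFDerivAt
      (by rw [minSmoothness_of_isRCLikeNormedField]; exact WithTop.coe_le_coe.2 le_top)
  rw [h3, h3, h4.eq]

lemma partialD_iterate_comm {f : (Fin d → ℝ) → ℂ} (hf : IsSmooth f) (i j : Fin d) (k : ℕ) :
    EqOn (partialD i ((partialD j)^[k] f)) ((partialD j)^[k] (partialD i f)) (orthant d) := by
  induction k with
  | zero => exact fun x _ => rfl
  | succ k ih =>
    simp only [Function.iterate_succ', Function.comp_apply]
    exact (partialD_comm (((locLin_partialD j).iterate k).smooth f hf) i j).trans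
      ((locLin_partialD j).congr _ _ ih)

/-- `multiD` applies the coordinate derivatives in a fixed order, so an outer `∂_i` has to be
commuted inwards to its place. -/
lemma partialD_multiD {f : (Fin d → ℝ) → ℂ} (hf : IsSmooth f) (p : Fin d → ℕ) (i : Fin d) :
    EqOn (partialD i (multiD p f)) (multiD (p + Pi.single i 1) f) (orthant d) := by
  classical
  have key : ∀ l : List (Fin d), l.Nodup →
      IsSmooth (l.foldr (fun j g => (partialD j)^[p j] g) f) ∧
      (i ∈ l → EqOn (partialD i (l.foldr (fun j g => (partialD j)^[p j] g) f))
        (l.foldr (fun j g => (partialD j)^[(p + Pi.single i 1 : Fin d → ℕ) j] g) f)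
        (orthant d)) ∧
      (i ∉ l → l.foldr (fun j g => (partialD j)^[p j] g) f =
        l.foldr (fun j g => (partialD j)^[(p + Pi.single i 1 : Fin d → ℕ) j] g) f) := by
    intro l hl
    induction l with
    | nil => exact ⟨hf, by simp, fun _ => rfl⟩
    | cons j l ih =>
      rw [List.nodup_cons] at hl
      obtain ⟨h1, h2, h3⟩ := ih hl.2
      refine ⟨((locLin_partialD j).iterate (p j)).smooth _ h1, fun hi => ?_, fun hi => ?_⟩
      · simp only [List.foldr_cons]
        rcases eq_or_ne i j with rfl | hij
        · rw [h3 hl.1, Pi.add_apply, Pi.single_eq_same, Function.iterate_succ',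
            Function.comp_apply]
          exact fun x _ => rfl
        · rw [Pi.add_apply, Pi.single_eq_of_ne hij.symm, add_zero]
          exact (partialD_iterate_comm h1 i j (p j)).trans (((locLin_partialD j).iterate _).congr
            _ _ (h2 ((List.mem_cons.1 hi).resolve_left hij)))
      · rw [List.mem_cons, not_or] at hi
        simp only [List.foldr_cons]
        rw [h3 hi.2, Pi.add_apply, Pi.single_eq_of_ne (Ne.symm hi.1), add_zero]
  exact (key _ (List.nodup_finRange d)).2.1 (List.mem_finRange i)

lemma IsSchwartz.decays {f : (Fin d → ℝ) → ℂ} (hf : IsSchwartz f) (m : ℕ) : Decays m f := by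
  have h : ∀ m p, Decays m (multiD p f) := by
    intro m
    induction m with
    | zero =>
      exact fun p => decays_zero_iff.2
        ⟨(locLin_multiD p).smooth f hf.smooth, fun k => hf.decay k p⟩
    | succ m ih =>
      exact fun p => Decays.of_partialD (ih p).zero_of fun j => ⟨_, ih _, partialD_multiD hf.smooth p j⟩
  refine (h m 0).congr fun x hx => ?_
  have : ∀ l : List (Fin d),
      l.foldr (fun j g => (partialD j)^[(0 : Fin d → ℕ) j] g) f = f := fun l => by
    induction l with
    | nil => rfl
    | cons j l ih => simp
  rw [multiD, this]

lemma Decays.iterate_laguerreOp {f : (Fin d → ℝ) → ℂ} (hf : ∀ m, Decays m f) (N m : ℕ) :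
    Decays m (POrthant.laguerreOp^[N] f) := by
  induction N generalizing m with
  | zero => exact hf m
  | succ N ih =>
    rw [Function.iterate_succ', Function.comp_apply]
    exact (ih (m + 2)).laguerreOp

lemma IsSchwartz.lagCoeff_iterate {f : (Fin d → ℝ) → ℂ} (hf : IsSchwartz f) (N : ℕ)
    (n : Fin d → ℕ) : lagCoeff (laguerreOp^[N] f) n = (deg n : ℂ) ^ N * lagCoeff f n := by
  induction N with
  | zero => simp
  | succ N ih =>
    rw [Function.iterate_succ', Function.comp_apply,
      lagCoeff_laguerreOp (Decays.iterate_laguerreOp hf.decays N 2), ih, pow_succ', mul_assoc]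

lemma IsSchwartz.integrable_mul_lagD {f : (Fin d → ℝ) → ℂ} (hf : IsSchwartz f) (n : Fin d → ℕ) :
    Integrable (fun x => f x * lagD 0 n x) (orthantMeasure d) :=
  ((hf.decays 0).mul_lagD 0 n).integrable

end Parts

section Completeness

/-! ### The generating function of the Laguerre functions -/

lemma hasSum_choose_mul_pow {𝕜 : Type*} [RCLike 𝕜] {z : 𝕜} (hz : ‖z‖ < 1) (k : ℕ) :
    HasSum (fun n : ℕ => (n.choose k : 𝕜) * z ^ n) (z ^ k / (1 - z) ^ (k + 1)) := by
  have h : HasSum (fun n : ℕ => ((n + k).choose k : 𝕜) * z ^ (n + k)) (z ^ k / (1 - z) ^ (k + 1)) := by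
    have := (hasSum_choose_mul_geometric_of_norm_lt_one k hz).mul_right (z ^ k)
    simp only [mul_assoc, ← pow_add] at this
    rwa [one_div_mul_eq_div] at this
  have h2 := (hasSum_nat_add_iff (f := fun n : ℕ => (n.choose k : 𝕜) * z ^ n) k).1 h
  rwa [Finset.sum_eq_zero (fun i hi => by
    rw [Nat.choose_eq_zero_of_lt (Finset.mem_range.1 hi)]; simp), add_zero] at h2

lemma hasSum_exp_pow {𝕜 : Type*} [RCLike 𝕜] (w : 𝕜) :
    HasSum (fun k : ℕ => w ^ k / (k.factorial : 𝕜)) (NormedSpace.exp w) :=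
  NormedSpace.expSeries_div_hasSum_exp w

/-- Interchange the sums over the degree `n` and the coefficient index `k`: summing over `n` first
gives `z^k / (1 - z)^{k+1}`, and the sum over `k` is an exponential series. The same computation
with absolute values justifies the interchange. -/
lemma hasSum_pow_mul_lagPoly {z : ℂ} (hz : ‖z‖ < 1) (x : ℝ) :
    HasSum (fun n : ℕ => z ^ n * ((lagPoly n).eval x : ℝ))
      (1 / (1 - z) * Complex.exp (-(x * z) / (1 - z))) := by
  set F : ℕ × ℕ → ℂ := fun q => (q.2.choose q.1 : ℂ) * z ^ q.2 * ((-x : ℂ) ^ q.1 / q.1.factorial)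
  have hF : Summable fun q => ‖F q‖ := by
    have hz' : ‖‖z‖‖ < 1 := by simpa using hz
    have e : ∀ q : ℕ × ℕ, ‖F q‖ = ((q.2.choose q.1 : ℝ) * ‖z‖ ^ q.2) *
        (|x| ^ q.1 / q.1.factorial) := fun q => by
      simp [F]
    simp only [e]
    refine (summable_prod_of_nonneg fun q => by positivity).2 ⟨fun k => ?_, ?_⟩
    · change Summable fun n : ℕ => ((n.choose k : ℝ) * ‖z‖ ^ n) * (|x| ^ k / k.factorial)
      exact (hasSum_choose_mul_pow (𝕜 := ℝ) hz' k).summable.mul_right _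
    · have : ∀ k : ℕ, ∑' n : ℕ, ((n.choose k : ℝ) * ‖z‖ ^ n) * (|x| ^ k / k.factorial) =
          1 / (1 - ‖z‖) * ((|x| * ‖z‖ / (1 - ‖z‖)) ^ k / k.factorial) := fun k => by
        rw [tsum_mul_right, (hasSum_choose_mul_pow (𝕜 := ℝ) hz' k).tsum_eq]
        have : 1 - ‖z‖ ≠ 0 := by linarith
        rw [div_pow, mul_pow, pow_succ]
        field_simp
      change Summable fun k : ℕ =>
        ∑' n : ℕ, ((n.choose k : ℝ) * ‖z‖ ^ n) * (|x| ^ k / k.factorial)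
      simp only [this]
      exact (hasSum_exp_pow (𝕜 := ℝ) _).summable.mul_left _
  have h1 : HasSum F (1 / (1 - z) * Complex.exp (-(x * z) / (1 - z))) := by
    have h2 := hF.of_norm.hasSum.prod_fiberwise fun k =>
      (hasSum_choose_mul_pow hz k).mul_right ((-x : ℂ) ^ k / k.factorial)
    have h3 : HasSum (fun k : ℕ => z ^ k / (1 - z) ^ (k + 1) * ((-x : ℂ) ^ k / k.factorial))
        (1 / (1 - z) * Complex.exp (-(x * z) / (1 - z))) := by
      rw [Complex.exp_eq_exp_ℂ]
      refine ((hasSum_exp_pow (-(x * z) / (1 - z))).mul_left (1 / (1 - z))).congr_fun fun k => ?_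
      have : 1 - z ≠ 0 := fun h => by
        rw [← sub_eq_zero.1 h] at hz
        simp at hz
      rw [div_pow, show -((x : ℂ) * z) = -x * z by ring, mul_pow, pow_succ]
      field_simp
    rw [← h2.unique h3]
    exact hF.of_norm.hasSum
  have h4 : HasSum (fun q : ℕ × ℕ => F q.swap) (1 / (1 - z) * Complex.exp (-(x * z) / (1 - z))) :=
    (Equiv.prodComm ℕ ℕ).hasSum_iff.2 h1
  refine h4.prod_fiberwise fun n => ?_
  have h5 : z ^ n * ((lagPoly n).eval x : ℝ) = ∑ k ∈ Finset.range (n + 1), F (k, n) := by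
    rw [Polynomial.eval_eq_sum_range' (n := n + 1)]
    · rw [Complex.ofReal_sum, Finset.mul_sum]
      refine Finset.sum_congr rfl fun k _ => ?_
      rw [coeff_lagPoly, neg_pow]
      simp only [F]
      push_cast
      rw [neg_pow (x : ℂ)]
      ring
    · refine Nat.lt_succ_of_le (Polynomial.natDegree_le_iff_coeff_eq_zero.2 fun k hk => ?_)
      rw [coeff_lagPoly, Nat.choose_eq_zero_of_lt hk]
      simp
  rw [h5]
  refine hasSum_sum_of_ne_finset_zero fun k hk => ?_
  simp only [F, Prod.swap]
  rw [Nat.choose_eq_zero_of_lt (by simpa [Nat.lt_succ_iff] using hk)]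
  simp

lemma norm_cayley_lt_one {s : ℂ} (hs : 0 < s.re) : ‖(2 * s - 1) / (2 * s + 1)‖ < 1 := by
  have h1 : Complex.normSq (2 * s - 1) < Complex.normSq (2 * s + 1) := by
    simp only [Complex.normSq_apply, Complex.add_re, Complex.sub_re, Complex.mul_re, Complex.add_im,
      Complex.sub_im, Complex.mul_im, Complex.one_re, Complex.one_im, Complex.re_ofNat,
      Complex.im_ofNat]
    nlinarith
  have h2 : ‖2 * s - 1‖ < ‖2 * s + 1‖ := by
    rw [← Complex.sq_norm, ← Complex.sq_norm] at h1
    exact lt_of_pow_lt_pow_left₀ 2 (norm_nonneg _) h1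
  rw [norm_div, div_lt_one ((norm_nonneg _).trans_lt h2)]
  exact h2

/-- The Cayley transform `z = (2s - 1)/(2s + 1)` turns the generating function into a multiple of
`e^{-st}`. Orthogonality to all Laguerre functions then becomes vanishing of a Laplace transform. -/
lemma hasSum_lagDer {s : ℂ} (hs : 0 < s.re) (t : ℝ) :
    HasSum (fun n : ℕ => ((2 * s - 1) / (2 * s + 1)) ^ n * (lagDer 0 n t : ℂ))
      ((s + 1 / 2) * Complex.exp (-(s * t))) := by
  have h0 : 2 * s + 1 ≠ 0 := fun h => by
    have := congrArg Complex.re h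
    simp at this
    linarith
  have h := (hasSum_pow_mul_lagPoly (norm_cayley_lt_one hs) t).mul_left (Complex.exp (-t / 2))
  have e : 1 - (2 * s - 1) / (2 * s + 1) = 2 / (2 * s + 1) := by
    field_simp
    ring
  rw [e, mul_left_comm, ← Complex.exp_add] at h
  have e1 : 1 / (2 / (2 * s + 1)) = s + 1 / 2 := by
    field_simp
  have e2 : -(t : ℂ) / 2 + -(t * ((2 * s - 1) / (2 * s + 1))) / (2 / (2 * s + 1)) = -(s * t) := by
    field_simp
    ring
  rw [e1, e2] at h
  refine h.congr_fun fun n => ?_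
  rw [lagDer]
  push_cast
  ring

/-! ### Uniqueness of Fourier transforms -/

/-- The positive and negative parts of `u` are densities of two finite measures with equal
characteristic functions, so the measures coincide. -/
lemma ae_eq_zero_of_charFun_real {E : Type*} [NormedAddCommGroup E] [NormedSpace ℝ E]
    [CompleteSpace E] [SecondCountableTopology E] [MeasurableSpace E] [BorelSpace E]
    {μ : Measure E} {u : E → ℝ} (hu : Integrable u μ)
    (h : ∀ L : StrongDual ℝ E, ∫ x, (u x : ℂ) * Complex.exp (L x * Complex.I) ∂μ = 0) :
    u =ᵐ[μ] 0 := by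
  have hm : ∀ {v : E → ℝ}, Integrable v μ → AEMeasurable (fun x => ENNReal.ofReal (v x)) μ :=
    fun hv => hv.aemeasurable.ennreal_ofReal
  have hf : ∀ {v : E → ℝ}, Integrable v μ → ∫⁻ x, ENNReal.ofReal (v x) ∂μ ≠ ⊤ := fun hv =>
    hv.lintegral_lt_top.ne
  have := isFiniteMeasure_withDensity (hf hu)
  have := isFiniteMeasure_withDensity (hf hu.neg)
  have key : μ.withDensity (fun x => ENNReal.ofReal (u x)) =
      μ.withDensity fun x => ENNReal.ofReal ((-u) x) := by
    refine Measure.ext_of_charFunDual (funext fun L => ?_)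
    rw [charFunDual_apply, charFunDual_apply,
      integral_withDensity_eq_integral_toReal_smul₀ (hm hu) (by simp),
      integral_withDensity_eq_integral_toReal_smul₀ (hm hu.neg) (by simp), ← sub_eq_zero]
    have hb : ∀ {v : E → ℝ}, Integrable v μ → Integrable
        (fun x => (ENNReal.ofReal (v x)).toReal • Complex.exp (L x * Complex.I)) μ := by
      intro v hv
      have h1 : Integrable (fun x => (ENNReal.ofReal (v x)).toReal) μ :=
        integrable_toReal_of_lintegral_ne_top (hm hv) (hf hv)
      refine h1.smul_bdd 1 (by fun_prop) (Eventually.of_forall fun x => ?_)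
      rw [Complex.norm_exp_ofReal_mul_I]
    rw [← integral_sub (hb hu) (hb hu.neg), ← h L]
    refine integral_congr_ae (Eventually.of_forall fun x => ?_)
    simp only [Pi.neg_apply, ENNReal.toReal_ofReal']
    rw [← sub_smul, max_zero_sub_max_neg_zero_eq_self, Complex.real_smul]
  have h2 := (withDensity_eq_iff (hm hu) (hm hu.neg) (hf hu)).1 key
  filter_upwards [h2] with x hx
  rw [Pi.neg_apply] at hx
  rcases lt_trichotomy (u x) 0 with h0 | h0 | h0
  · rw [ENNReal.ofReal_of_nonpos h0.le, eq_comm, ENNReal.ofReal_eq_zero] at hx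
    linarith
  · exact h0
  · rw [ENNReal.ofReal_of_nonpos (neg_nonpos.2 h0.le), ENNReal.ofReal_eq_zero] at hx
    linarith

/-- Conjugating the hypothesis at `-L` shows that the conjugate of `u` satisfies it too, hence so do
the real and imaginary parts. -/
lemma ae_eq_zero_of_charFun {E : Type*} [NormedAddCommGroup E] [NormedSpace ℝ E]
    [CompleteSpace E] [SecondCountableTopology E] [MeasurableSpace E] [BorelSpace E]
    {μ : Measure E} {u : E → ℂ} (hu : Integrable u μ)
    (h : ∀ L : StrongDual ℝ E, ∫ x, u x * Complex.exp (L x * Complex.I) ∂μ = 0) :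
    u =ᵐ[μ] 0 := by
  have hb : ∀ {v : E → ℂ}, Integrable v μ → ∀ L : StrongDual ℝ E, Integrable
      (fun x => v x * Complex.exp (L x * Complex.I)) μ := by
    intro v hv L
    refine hv.mul_bdd (c := 1) (by fun_prop) (Eventually.of_forall fun x => ?_)
    rw [Complex.norm_exp_ofReal_mul_I]
  have hc : Integrable (fun x => (starRingEnd ℂ) (u x)) μ :=
    Complex.conjCLE.toContinuousLinearMap.integrable_comp hu
  have h' : ∀ L : StrongDual ℝ E,
      ∫ x, (starRingEnd ℂ) (u x) * Complex.exp (L x * Complex.I) ∂μ = 0 := by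
    intro L
    have := congrArg (starRingEnd ℂ) (h (-L))
    rw [← integral_conj, map_zero] at this
    rw [← this]
    refine integral_congr_ae (Eventually.of_forall fun x => ?_)
    simp [← Complex.exp_conj]
  have hre : (fun x => (u x).re) =ᵐ[μ] 0 := by
    refine ae_eq_zero_of_charFun_real hu.re fun L => ?_
    have e : ∀ x, ((u x).re : ℂ) * Complex.exp (L x * Complex.I) =
        1 / 2 * (u x * Complex.exp (L x * Complex.I)) +
          1 / 2 * ((starRingEnd ℂ) (u x) * Complex.exp (L x * Complex.I)) := fun x => by
      rw [Complex.re_eq_add_conj]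
      ring
    simp only [e]
    rw [integral_add ((hb hu L).const_mul _) ((hb hc L).const_mul _), integral_const_mul,
      integral_const_mul, h, h']
    simp
  have him : (fun x => (u x).im) =ᵐ[μ] 0 := by
    refine ae_eq_zero_of_charFun_real hu.im fun L => ?_
    have e : ∀ x, ((u x).im : ℂ) * Complex.exp (L x * Complex.I) =
        1 / (2 * Complex.I) * (u x * Complex.exp (L x * Complex.I)) -
          1 / (2 * Complex.I) * ((starRingEnd ℂ) (u x) * Complex.exp (L x * Complex.I)) :=
      fun x => by
        rw [Complex.im_eq_sub_conj]
        ring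
    simp only [e]
    rw [integral_sub ((hb hu L).const_mul _) ((hb hc L).const_mul _), integral_const_mul,
      integral_const_mul, h, h']
    simp
  filter_upwards [hre, him] with x h1 h2
  exact Complex.ext h1 h2

/-! ### Completeness of the Laguerre functions -/

variable {d : ℕ}

/-- Integrate the generating series termwise: `|z| < 1` makes its coefficients geometric, which
beats the polynomial growth of the Laguerre functions. -/
lemma integral_mul_exp_eq_zero {F : (Fin d → ℝ) → ℂ} (hF : Integrable F (orthantMeasure d))
    (j : Fin d) (h : ∀ m : ℕ, ∫ x in orthant d, F x * (lagDer 0 m (x j) : ℂ) = 0) {s : ℂ}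
    (hs : 0 < s.re) : ∫ x in orthant d, F x * Complex.exp (-(s * x j)) = 0 := by
  obtain ⟨C, hC, K, hb⟩ := exists_lagDer_bound 0 0
  set z := (2 * s - 1) / (2 * s + 1)
  have hz : ‖z‖ < 1 := norm_cayley_lt_one hs
  have hbd : ∀ m : ℕ, ∀ x ∈ orthant d, ‖(lagDer 0 m (x j) : ℂ)‖ ≤ C * (1 + m : ℝ) ^ K := by
    intro m x hx
    have := hb m (x j) (hx j).le
    rwa [pow_zero, one_mul, ← Real.norm_eq_abs, ← Complex.norm_real] at this
  have hi : ∀ m : ℕ, Integrable (fun x => F x * (lagDer 0 m (x j) : ℂ)) (orthantMeasure d) := by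
    intro m
    refine hF.mul_bdd (c := C * (1 + m : ℝ) ^ K) ?_
      (ae_restrict_of_forall_mem (isOpen_orthant d).measurableSet (hbd m))
    exact (Complex.continuous_ofReal.comp
      ((continuous_lagDer 0 m).comp (continuous_apply j))).aestronglyMeasurable
  have hsum : Summable fun m : ℕ => ∫ x in orthant d, ‖z ^ m * (F x * (lagDer 0 m (x j) : ℂ))‖ := by
    have h1 : Summable fun m : ℕ => ‖z‖ ^ m * (C * (1 + m : ℝ) ^ K) * ∫ x in orthant d, ‖F x‖ := by
      refine Summable.mul_right _ ?_
      have h2 := summable_norm_mul_geometric_of_norm_lt_one (k := K) (r := ‖z‖) (by simpa using hz)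
        (u := fun m : ℕ => (1 + m) ^ K) ?_
      · refine (h2.mul_left C).congr fun m => ?_
        rw [norm_mul, Real.norm_of_nonneg (by positivity), Real.norm_of_nonneg (by positivity)]
        push_cast
        ring
      · refine Asymptotics.isBigO_iff.2 ⟨2 ^ K, ?_⟩
        filter_upwards [eventually_ge_atTop 1] with m hm
        have hm' : (1 : ℝ) ≤ m := by exact_mod_cast hm
        push_cast
        rw [Real.norm_of_nonneg (by positivity), Real.norm_of_nonneg (by positivity), ← mul_pow]
        exact pow_le_pow_left₀ (by positivity) (by linarith) _
    refine Summable.of_nonneg_of_le (fun m => integral_nonneg fun x => norm_nonneg _) (fun m => ?_) h1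
    rw [← integral_const_mul]
    refine integral_mono_ae ((hi m).const_mul _).norm (hF.norm.const_mul _)
      (ae_restrict_of_forall_mem (isOpen_orthant d).measurableSet fun x hx => ?_)
    simp only [norm_mul, norm_pow]
    have := mul_le_mul_of_nonneg_left (hbd m x hx) (norm_nonneg (F x))
    calc ‖z‖ ^ m * (‖F x‖ * ‖(lagDer 0 m (x j) : ℂ)‖)
        ≤ ‖z‖ ^ m * (‖F x‖ * (C * (1 + m : ℝ) ^ K)) := by gcongr
      _ = _ := by ring
  have h3 := hasSum_integral_of_summable_integral_norm (fun m => (hi m).const_mul (z ^ m)) hsum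
  have h4 : ∀ m : ℕ, ∫ x in orthant d, z ^ m * (F x * (lagDer 0 m (x j) : ℂ)) = 0 := fun m => by
    rw [integral_const_mul, h, mul_zero]
  simp only [h4] at h3
  have h5 : ∀ x : Fin d → ℝ, ∑' m : ℕ, z ^ m * (F x * (lagDer 0 m (x j) : ℂ)) =
      (s + 1 / 2) * (F x * Complex.exp (-(s * x j))) := fun x => by
    rw [← mul_left_comm (F x), ← (hasSum_lagDer hs (x j)).tsum_eq, ← tsum_mul_left]
    refine tsum_congr fun m => ?_
    ring
  simp only [h5] at h3
  rw [integral_const_mul] at h3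
  have h6 := hasSum_zero.unique h3
  refine (mul_eq_zero.1 h6.symm).resolve_left fun h7 => ?_
  have := congrArg Complex.re h7
  simp at this
  linarith

lemma integral_mul_prod_exp_eq_zero {f : (Fin d → ℝ) → ℂ} (hf : Integrable f (orthantMeasure d))
    (h : lagCoeff f = 0) {s : Fin d → ℂ} (hs : ∀ j, 0 < (s j).re) :
    ∫ x in orthant d, f x * ∏ j, Complex.exp (-(s j * x j)) = 0 := by
  classical
  -- Mixed products with exponentials in the coordinates of `S` and Laguerre functions elsewhere;
  -- the former replace the latter one coordinate at a time.
  set M : Finset (Fin d) → (Fin d → ℕ) → Fin d → ℝ → ℂ := fun S n j t =>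
    if j ∈ S then Complex.exp (-(s j * t)) else (lagDer 0 (n j) t : ℂ) with hM
  have hcont : ∀ S n j, Continuous (M S n j) := by
    intro S n j
    simp only [hM]
    split_ifs
    · fun_prop
    · exact Complex.continuous_ofReal.comp (continuous_lagDer 0 (n j))
  have hbd : ∀ S n j, ∃ B : ℝ, ∀ t : ℝ, 0 ≤ t → ‖M S n j t‖ ≤ B := by
    intro S n j
    by_cases hj : j ∈ S
    · refine ⟨1, fun t ht => ?_⟩
      simp only [hM, if_pos hj]
      rw [Complex.norm_exp, Real.exp_le_one_iff]
      simpa using mul_nonneg (hs j).le ht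
    · obtain ⟨C, hC, K, hb⟩ := exists_lagDer_bound 0 0
      refine ⟨C * (1 + n j : ℝ) ^ K, fun t ht => ?_⟩
      simp only [hM, if_neg hj]
      have := hb (n j) t ht
      rwa [pow_zero, one_mul, ← Real.norm_eq_abs, ← Complex.norm_real] at this
  have key : ∀ S : Finset (Fin d), ∀ n, ∫ x in orthant d, f x * ∏ j, M S n j (x j) = 0 := by
    intro S
    induction S using Finset.induction_on with
    | empty =>
      intro n
      refine Eq.trans ?_ (congrFun h n)
      refine integral_congr_ae (Eventually.of_forall fun x => ?_)
      simp [hM, lagD]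
    | insert i S hi ih =>
      intro n
      have e : ∀ T n (x : Fin d → ℝ), ∏ j, M T n j (x j) =
          (∏ j ∈ Finset.univ.erase i, M T n j (x j)) * M T n i (x i) := fun T n x =>
        (Finset.prod_erase_mul Finset.univ _ (Finset.mem_univ i)).symm
      have e1 : ∀ x : Fin d → ℝ, ∏ j ∈ Finset.univ.erase i, M (insert i S) n j (x j) =
          ∏ j ∈ Finset.univ.erase i, M S n j (x j) := fun x =>
        Finset.prod_congr rfl fun j hj => by
          simp [hM, Finset.mem_insert, Finset.ne_of_mem_erase hj]
      have e2 : ∀ m (x : Fin d → ℝ), ∏ j ∈ Finset.univ.erase i, M S (Function.update n i m) j (x j) =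
          ∏ j ∈ Finset.univ.erase i, M S n j (x j) := fun m x =>
        Finset.prod_congr rfl fun j hj => by
          simp [hM, Function.update_of_ne (Finset.ne_of_mem_erase hj)]
      choose B hB using hbd S n
      have hF : Integrable (fun x => f x * ∏ j ∈ Finset.univ.erase i, M S n j (x j))
          (orthantMeasure d) := by
        refine hf.mul_bdd (c := ∏ j ∈ Finset.univ.erase i, B j) ?_
          (ae_restrict_of_forall_mem (isOpen_orthant d).measurableSet fun x hx => ?_)
        · exact (continuous_finsetProd _ fun j _ =>
            (hcont S n j).comp (continuous_apply j)).aestronglyMeasurable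
        · rw [norm_prod]
          exact Finset.prod_le_prod (fun j _ => norm_nonneg _) fun j _ => hB j _ (hx j).le
      refine Eq.trans ?_ (integral_mul_exp_eq_zero hF i (fun m => ?_) (hs i))
      · refine integral_congr_ae (Eventually.of_forall fun x => ?_)
        simp only [e, e1]
        simp [hM, mul_assoc]
      · refine Eq.trans ?_ (ih (Function.update n i m))
        refine integral_congr_ae (Eventually.of_forall fun x => ?_)
        simp only [e, e2]
        simp [hM, hi, mul_assoc]
  refine Eq.trans ?_ (key Finset.univ 0)
  simp [hM]

/-- On the line `Re s_j = 1` the vanishing Laplace transform of `f` is the Fourier transform of `f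
e^{-∑ x_j}`. -/
lemma IsSchwartz.eq_zero_of_lagCoeff {f : (Fin d → ℝ) → ℂ} (hf : IsSchwartz f)
    (h : lagCoeff f = 0) : f = 0 := by
  have hi := (hf.decays 0).integrable
  set u : (Fin d → ℝ) → ℂ := fun x => f x * ∏ j, Complex.exp (-(x j : ℂ))
  have hu : Integrable u (orthantMeasure d) := by
    refine hi.mul_bdd (c := 1) (Continuous.aestronglyMeasurable (by fun_prop))
      (ae_restrict_of_forall_mem (isOpen_orthant d).measurableSet fun x hx => ?_)
    rw [norm_prod]
    refine Finset.prod_le_one (fun j _ => norm_nonneg _) fun j _ => ?_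
    rw [Complex.norm_exp, Real.exp_le_one_iff]
    simpa using (hx j).le
  have h1 : u =ᵐ[orthantMeasure d] 0 := by
    refine ae_eq_zero_of_charFun hu fun L => ?_
    refine Eq.trans ?_ (integral_mul_prod_exp_eq_zero hi h
      (s := fun j => 1 - L (Pi.single j 1) * Complex.I) fun j => by simp)
    refine integral_congr_ae (Eventually.of_forall fun x => ?_)
    have hL : L x = ∑ j, x j * L (Pi.single j 1) := by
      conv_lhs => rw [pi_eq_sum_univ' x]
      simp
    simp only [u, hL, mul_assoc]
    rw [← Complex.exp_sum, ← Complex.exp_sum, ← Complex.exp_add]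
    congr 2
    push_cast
    rw [Finset.sum_mul, ← Finset.sum_add_distrib]
    refine Finset.sum_congr rfl fun j _ => ?_
    ring
  have h2 : f =ᵐ[orthantMeasure d] 0 := by
    filter_upwards [h1] with x hx
    exact (mul_eq_zero.1 hx).resolve_right
      (Finset.prod_ne_zero_iff.2 fun j _ => Complex.exp_ne_zero _)
  have h3 : EqOn f 0 (orthant d) :=
    Measure.eqOn_open_of_ae_eq h2 (isOpen_orthant d) (ContDiffOn.continuousOn hf.smooth)
      continuousOn_const
  funext x
  by_cases hx : x ∈ orthant d
  · exact h3 hx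
  · exact hf.zero_off x hx

end Completeness

section Estimates

/-! ### The norms `η` and the Laguerre coefficients -/

lemma rpow_scale {α h t : ℝ} (hh : 0 < h) (ht : 0 ≤ t) :
    (t / h) ^ (1 / α) = h ^ (-(1 / α)) * t ^ (1 / α) := by
  rw [Real.div_rpow ht hh.le, Real.rpow_neg hh.le, div_eq_inv_mul]

lemma exists_step {α s : ℝ} (hα : 0 < α) (hs : 0 < s) : ∃ h > 0, α * h ^ (-(1 / α)) = s := by
  refine ⟨(s / α) ^ (-α), by positivity, ?_⟩
  rw [← Real.rpow_mul (by positivity), neg_mul_neg, mul_one_div_cancel hα.ne', Real.rpow_one,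
    mul_div_cancel₀ _ hα.ne']

/-- The power series of `exp r`, written for `r = (t / h) ^ (1 / α)`. -/
lemma rpow_pow_div_factorial {α y : ℝ} (hα : 0 < α) (hy : 0 ≤ y) (N : ℕ) :
    ((y ^ (1 / α)) ^ N / N.factorial) ^ α = y ^ N / (N.factorial : ℝ) ^ α := by
  rw [Real.div_rpow (by positivity) (by positivity), ← Real.rpow_natCast, ← Real.rpow_mul hy,
    ← Real.rpow_mul hy, mul_right_comm, one_div_mul_cancel hα.ne', one_mul, Real.rpow_natCast]

/-- The `α`-th power of `r^N / N! ≤ e^r` with `r = (t / h)^{1/α}`. -/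
lemma pow_le_factorial_mul_exp {α h t : ℝ} (hα : 0 < α) (hh : 0 < h) (ht : 0 ≤ t) (N : ℕ) :
    t ^ N ≤ h ^ N * (N.factorial : ℝ) ^ α * Real.exp (α * h ^ (-(1 / α)) * t ^ (1 / α)) := by
  have hy : 0 ≤ t / h := div_nonneg ht hh.le
  have h1 := Real.rpow_le_rpow (by positivity)
    (Real.pow_div_factorial_le_exp _ (Real.rpow_nonneg hy (1 / α)) N) hα.le
  rw [rpow_pow_div_factorial hα hy, ← Real.exp_mul, rpow_scale hh ht,
    div_le_iff₀ (by positivity), div_pow, div_le_iff₀ (by positivity)] at h1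
  calc t ^ N ≤ _ := h1
    _ = _ := by
      rw [show h ^ (-(1 / α)) * t ^ (1 / α) * α = α * h ^ (-(1 / α)) * t ^ (1 / α) by ring]
      ring

/-- Take `1/α`-th powers and sum the exponential series at `r / 2`, whose extra factors `2^{-N}`
make the bounds summable. The price is half of the exponent and the constant `2 ^ α`. -/
lemma mul_exp_le_of_forall_mul_pow_le {α h t c H : ℝ} (hα : 0 < α) (hh : 0 < h) (ht : 0 ≤ t)
    (hc : 0 ≤ c) (hH : ∀ N : ℕ, c * t ^ N ≤ H * (h ^ N * (N.factorial : ℝ) ^ α)) :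
    c * Real.exp (α * h ^ (-(1 / α)) / 2 * t ^ (1 / α)) ≤ 2 ^ α * H := by
  have hH0 : 0 ≤ H := by
    have := hH 0
    simp only [pow_zero, mul_one, Nat.factorial_zero, Nat.cast_one, Real.one_rpow] at this
    exact hc.trans this
  set y := t / h
  have hy : 0 ≤ y := div_nonneg ht hh.le
  set r := y ^ (1 / α) with hr
  have hr0 : 0 ≤ r := Real.rpow_nonneg hy _
  have h1 : ∀ N : ℕ, c ^ (1 / α) * (r ^ N / N.factorial) ≤ H ^ (1 / α) := by
    intro N
    have h2 : c * (y ^ N / (N.factorial : ℝ) ^ α) ≤ H := by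
      rw [div_pow, div_div, ← mul_div_assoc, div_le_iff₀ (by positivity)]
      exact hH N
    have h3 := Real.rpow_le_rpow (by positivity) h2 (one_div_pos.2 hα).le
    rwa [← rpow_pow_div_factorial hα hy, Real.mul_rpow hc (by positivity),
      ← Real.rpow_mul (by positivity), mul_one_div_cancel hα.ne', Real.rpow_one] at h3
  have h4 : c ^ (1 / α) * Real.exp (r / 2) ≤ 2 * H ^ (1 / α) := by
    have e1 : HasSum (fun N : ℕ => c ^ (1 / α) * ((r / 2) ^ N / N.factorial))
        (c ^ (1 / α) * Real.exp (r / 2)) := by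
      rw [Real.exp_eq_exp_ℝ]
      exact (hasSum_exp_pow (𝕜 := ℝ) (r / 2)).mul_left _
    have e2 : HasSum (fun N : ℕ => H ^ (1 / α) * (1 / 2) ^ N) (H ^ (1 / α) * 2) :=
      hasSum_geometric_two.mul_left _
    rw [mul_comm 2]
    refine hasSum_le (fun N => ?_) e1 e2
    calc c ^ (1 / α) * ((r / 2) ^ N / N.factorial) =
          c ^ (1 / α) * (r ^ N / N.factorial) * (1 / 2) ^ N := by
          rw [div_pow, one_div_pow]
          ring
      _ ≤ _ := mul_le_mul_of_nonneg_right (h1 N) (by positivity)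
  have h5 := Real.rpow_le_rpow (by positivity) h4 hα.le
  rw [Real.mul_rpow (by positivity) (by positivity), Real.mul_rpow (by positivity) (by positivity),
    ← Real.rpow_mul hc, ← Real.rpow_mul hH0, one_div_mul_cancel hα.ne', Real.rpow_one,
    Real.rpow_one, ← Real.exp_mul, hr, rpow_scale hh ht] at h5
  refine Eq.trans_le ?_ h5
  congr 2
  ring

variable {d : ℕ} {α h : ℝ}

lemma eLpNorm_iterate_le_eta (hh : 0 < h) {f : (Fin d → ℝ) → ℂ} (hf : eta α h f < ⊤) (N : ℕ) :
    eLpNorm (laguerreOp^[N] f) 2 (orthantMeasure d) ≤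
      ENNReal.ofReal ((eta α h f).toReal * (h ^ N * (N.factorial : ℝ) ^ α)) := by
  have hpos : 0 < h ^ N * (N.factorial : ℝ) ^ α := by positivity
  have h1 : eLpNorm (laguerreOp^[N] f) 2 (orthantMeasure d) /
      ENNReal.ofReal (h ^ N * (N.factorial : ℝ) ^ α) ≤ eta α h f :=
    le_iSup (fun N : ℕ => eLpNorm (laguerreOp^[N] f) 2 (volume.restrict (orthant d)) /
      ENNReal.ofReal (h ^ N * (N.factorial : ℝ) ^ α)) N
  rw [ENNReal.div_le_iff (by simpa using hpos) ENNReal.ofReal_ne_top] at h1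
  rwa [ENNReal.ofReal_mul ENNReal.toReal_nonneg, ENNReal.ofReal_toReal hf.ne]

/-- The coefficient `|n|^N c_n` of `E^N f` is at most its `L²` norm, for every `N`. The lost half of
the exponent does no harm because `h` ranges over all positive numbers. -/
lemma IsSchwartz.norm_lagCoeff_mul_wt_le (hα : 0 < α) (hh : 0 < h) {f : (Fin d → ℝ) → ℂ}
    (hf : IsSchwartz f) (he : eta α h f < ⊤) (n : Fin d → ℕ) :
    ‖lagCoeff f n‖ * wt (1 / α) (α * h ^ (-(1 / α)) / 2) n ≤ 2 ^ α * (eta α h f).toReal := by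
  refine mul_exp_le_of_forall_mul_pow_le hα hh (Nat.cast_nonneg _) (norm_nonneg _) fun N => ?_
  have h1 := (enorm_lagCoeff_le ((locLin_laguerreOp.iterate N).smooth f hf.smooth) n).trans
    (eLpNorm_iterate_le_eta hh he N)
  rw [← ofReal_norm, ENNReal.ofReal_le_ofReal_iff (by positivity), hf.lagCoeff_iterate, norm_mul,
    norm_pow, Complex.norm_natCast] at h1
  linarith

lemma eta_lagSum_le (hα : 0 < α) (hh : 0 < h) {a : (Fin d → ℕ) → ℂ} (ha : RapidSeq a)
    (hs : Summable fun n => ‖a n‖ * wt (1 / α) (α * h ^ (-(1 / α))) n) :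
    eta α h (lagSum a) ≤ ENNReal.ofReal (∑' n, ‖a n‖ * wt (1 / α) (α * h ^ (-(1 / α))) n) := by
  refine iSup_le fun N => ?_
  have hpos : 0 < h ^ N * (N.factorial : ℝ) ^ α := by positivity
  rw [ENNReal.div_le_iff (by simpa using hpos) ENNReal.ofReal_ne_top,
    eLpNorm_congr_orthant (ha.iterate_laguerreOp_lagSum N)]
  refine (eLpNorm_synth_le (ha.deg_pow_mul N)).trans ?_
  rw [← ENNReal.ofReal_mul (tsum_nonneg fun n => mul_nonneg (norm_nonneg _) (wt_pos _ _ n).le),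
    ← tsum_mul_right]
  refine ENNReal.ofReal_le_ofReal ((ha.deg_pow_mul N).summable_norm.tsum_le_tsum (fun n => ?_)
    (hs.mul_right _))
  rw [norm_mul, norm_pow, Complex.norm_natCast]
  have := mul_le_mul_of_nonneg_left
    (pow_le_factorial_mul_exp hα hh (Nat.cast_nonneg (deg n)) N) (norm_nonneg (a n))
  rw [wt]
  linarith

lemma rapidSeq_of_summable {β s : ℝ} (hβ : 0 < β) (hs : 0 < s) {a : (Fin d → ℕ) → ℂ}
    (h : Summable fun n => ‖a n‖ * wt β s n) : RapidSeq a := by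
  intro K
  obtain ⟨C, hC, hb⟩ := exists_one_add_pow_le_exp hβ hs K
  refine Summable.of_nonneg_of_le (fun n => by positivity) (fun n => ?_) (h.mul_left C)
  have := mul_le_mul_of_nonneg_left (hb (deg n)) (norm_nonneg (a n))
  rw [wt]
  linarith

lemma summable_of_norm_le {β s C : ℝ} (hβ : 0 < β) {t : ℝ} (hst : t < s) {a : (Fin d → ℕ) → ℂ}
    (h : ∀ n, ‖a n‖ * wt β s n ≤ C) : Summable fun n => ‖a n‖ * wt β t n := by
  refine Summable.of_nonneg_of_le (fun n => mul_nonneg (norm_nonneg _) (wt_pos _ _ n).le)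
    (fun n => ?_) ((summable_wt hβ (sub_neg.2 hst) d).mul_left C)
  have := mul_le_mul_of_nonneg_right (h n) (wt_pos β (t - s) n).le
  rwa [mul_assoc, wt_mul, add_sub_cancel] at this

lemma tsum_norm_mul_le {β s C : ℝ} (hβ : 0 < β) {t : ℝ} (hst : t < s) {a : (Fin d → ℕ) → ℂ}
    (h : ∀ n, ‖a n‖ * wt β s n ≤ C) :
    ∑' n, ‖a n‖ * wt β t n ≤ C * ∑' n : Fin d → ℕ, wt β (t - s) n := by
  rw [← tsum_mul_left]
  refine (summable_of_norm_le hβ hst h).tsum_le_tsum (fun n => ?_)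
    ((summable_wt hβ (sub_neg.2 hst) d).mul_left C)
  have := mul_le_mul_of_nonneg_right (h n) (wt_pos β (t - s) n).le
  rwa [mul_assoc, wt_mul, add_sub_cancel] at this

lemma IsSchwartz.lagCoeff_add {f g : (Fin d → ℝ) → ℂ} (hf : IsSchwartz f) (hg : IsSchwartz g) :
    lagCoeff (f + g) = lagCoeff f + lagCoeff g := by
  funext n
  rw [Pi.add_apply, lagCoeff, lagCoeff, lagCoeff,
    ← integral_add (hf.integrable_mul_lagD n) (hg.integrable_mul_lagD n)]
  simp only [Pi.add_apply, add_mul]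

lemma lagCoeff_smul (c : ℂ) (f : (Fin d → ℝ) → ℂ) : lagCoeff (c • f) = c • lagCoeff f := by
  funext n
  rw [Pi.smul_apply, lagCoeff, lagCoeff, smul_eq_mul, ← integral_const_mul]
  simp only [Pi.smul_apply, smul_eq_mul, mul_assoc]

lemma IsSchwartz.eq_of_lagCoeff {f g : (Fin d → ℝ) → ℂ} (hf : IsSchwartz f) (hg : IsSchwartz g)
    (h : lagCoeff f = lagCoeff g) : f = g := by
  have h1 : f + (-1 : ℂ) • g = 0 := (hf.add (hg.smul _)).eq_zero_of_lagCoeff (by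
    rw [hf.lagCoeff_add (hg.smul _), lagCoeff_smul, h]
    simp)
  simpa [← sub_eq_add_neg, sub_eq_zero] using h1

lemma IsSchwartz.lagSum_lagCoeff {f : (Fin d → ℝ) → ℂ} (hf : IsSchwartz f)
    (h : RapidSeq (lagCoeff f)) : lagSum (lagCoeff f) = f :=
  h.isSchwartz_lagSum.eq_of_lagCoeff hf (lagCoeff_lagSum h)

/-- Laguerre expansions of products in separate variables. -/
lemma IsSchwartz.apply_eq_mul {d₁ d₂ : ℕ} {f : (Fin d₁ → ℝ) → ℂ} {g : (Fin d₂ → ℝ) → ℂ}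
    {F : (Fin (d₁ + d₂) → ℝ) → ℂ} (hf : IsSchwartz f) (hg : IsSchwartz g) (hF : IsSchwartz F)
    (rf : RapidSeq (lagCoeff f)) (rg : RapidSeq (lagCoeff g)) (rF : RapidSeq (lagCoeff F))
    (h : ∀ m n, lagCoeff F (Fin.appendEquiv d₁ d₂ (m, n)) = lagCoeff f m * lagCoeff g n)
    (x : Fin (d₁ + d₂) → ℝ) :
    F x = f (fun i => x (Fin.castAdd d₂ i)) * g (fun j => x (Fin.natAdd d₁ j)) := by
  set x₁ : Fin d₁ → ℝ := fun i => x (Fin.castAdd d₂ i)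
  set x₂ : Fin d₂ → ℝ := fun j => x (Fin.natAdd d₁ j)
  by_cases hx : x ∈ orthant (d₁ + d₂)
  · have hx₁ : x₁ ∈ orthant d₁ := fun i => hx _
    have hx₂ : x₂ ∈ orthant d₂ := fun j => hx _
    rw [← hf.lagSum_lagCoeff rf, ← hg.lagSum_lagCoeff rg, ← hF.lagSum_lagCoeff rF,
      eqOn_lagSum _ hx, eqOn_lagSum _ hx₁, eqOn_lagSum _ hx₂, synth, synth, synth,
      tsum_mul_tsum_of_summable_norm (rf.summable_lagD 0 (orthant_subset_closedOrthant hx₁))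
        (rg.summable_lagD 0 (orthant_subset_closedOrthant hx₂)),
      ← (Fin.appendEquiv d₁ d₂).tsum_eq]
    refine tsum_congr fun q => ?_
    rw [h q.1 q.2]
    have : lagD 0 (Fin.appendEquiv d₁ d₂ (q.1, q.2)) x = lagD 0 q.1 x₁ * lagD 0 q.2 x₂ := by
      simp [lagD, Fin.prod_univ_add, x₁, x₂]
    rw [this]
    ring
  -- Off the product orthant one of the two factors is evaluated outside its own orthant, so both
  -- sides vanish.
  · rw [hF.zero_off x hx]
    by_cases hx₁ : x₁ ∈ orthant d₁
    · have hx₂ : x₂ ∉ orthant d₂ := fun hx₂ => hx fun k => Fin.addCases hx₁ hx₂ k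
      rw [hg.zero_off _ hx₂, mul_zero]
    · rw [hf.zero_off _ hx₁, zero_mul]

end Estimates

section Spaces

variable {α : ℝ} {d : ℕ}

/-! ### The step spaces -/

instance (α h : ℝ) (d : ℕ) : NormedSpace ℂ (StepSpace α h d) where
  norm_smul_le c f := by
    change (eta α h (c • f.1)).toReal ≤ ‖c‖ * (eta α h f.1).toReal
    rw [eta_smul α h c f.2.1.smooth, ENNReal.toReal_mul, toReal_enorm]

lemma StepSpace.norm_lagCoeff_mul_wt_le (hα : 0 < α) {h : ℝ} (hh : 0 < h) (f : StepSpace α h d)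
    (n : Fin d → ℕ) :
    ‖lagCoeff f.1 n‖ * wt (1 / α) (α * h ^ (-(1 / α)) / 2) n ≤ 2 ^ α * ‖f‖ :=
  f.2.1.norm_lagCoeff_mul_wt_le hα hh f.2.2 n

lemma rapidSeq_of_step (hα : 0 < α) {h : ℝ} (hh : 0 < h) {f : (Fin d → ℝ) → ℂ}
    (hf : f ∈ stepSubmodule α h d) : RapidSeq (lagCoeff f) := by
  have hs : 0 < α * h ^ (-(1 / α)) / 2 := by positivity
  exact rapidSeq_of_summable (one_div_pos.2 hα) (half_pos hs)
    (summable_of_norm_le (one_div_pos.2 hα) (half_lt_self hs)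
      (hf.1.norm_lagCoeff_mul_wt_le hα hh hf.2))

lemma rapidSeq_of_summable_step (hα : 0 < α) {h : ℝ} (hh : 0 < h) {a : (Fin d → ℕ) → ℂ}
    (hs : Summable fun n => ‖a n‖ * wt (1 / α) (α * h ^ (-(1 / α))) n) : RapidSeq a :=
  rapidSeq_of_summable (one_div_pos.2 hα) (by positivity) hs

lemma lagSum_mem_step (hα : 0 < α) {h : ℝ} (hh : 0 < h) {a : (Fin d → ℕ) → ℂ}
    (hs : Summable fun n => ‖a n‖ * wt (1 / α) (α * h ^ (-(1 / α))) n) :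
    lagSum a ∈ stepSubmodule α h d :=
  have ha := rapidSeq_of_summable_step hα hh hs
  ⟨ha.isSchwartz_lagSum, (eta_lagSum_le hα hh ha hs).trans_lt ENNReal.ofReal_lt_top⟩

/-- The sum of a Laguerre series as an element of a step space. -/
def stepLagSum (hα : 0 < α) {h : ℝ} (hh : 0 < h) {a : (Fin d → ℕ) → ℂ}
    (hs : Summable fun n => ‖a n‖ * wt (1 / α) (α * h ^ (-(1 / α))) n) : StepSpace α h d :=
  ⟨lagSum a, lagSum_mem_step hα hh hs⟩

lemma norm_stepLagSum_le (hα : 0 < α) {h : ℝ} (hh : 0 < h) {a : (Fin d → ℕ) → ℂ}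
    (hs : Summable fun n => ‖a n‖ * wt (1 / α) (α * h ^ (-(1 / α))) n) :
    ‖stepLagSum hα hh hs‖ ≤ ∑' n, ‖a n‖ * wt (1 / α) (α * h ^ (-(1 / α))) n :=
  ENNReal.toReal_le_of_le_ofReal
    (tsum_nonneg fun n => mul_nonneg (norm_nonneg _) (wt_pos _ _ n).le)
    (eta_lagSum_le hα hh (rapidSeq_of_summable_step hα hh hs) hs)

lemma lagCoeff_stepLagSum (hα : 0 < α) {h : ℝ} (hh : 0 < h) {a : (Fin d → ℕ) → ℂ}
    (hs : Summable fun n => ‖a n‖ * wt (1 / α) (α * h ^ (-(1 / α))) n) :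
    lagCoeff (stepLagSum hα hh hs).1 = a :=
  lagCoeff_lagSum (rapidSeq_of_summable_step hα hh hs)

/-! ### The Beurling space -/

lemma Beurling.mem_step (f : Beurling α d) {h : ℝ} (hh : 0 < h) : f.1 ∈ stepSubmodule α h d :=
  (Submodule.mem_iInf _).1 f.2 ⟨h, hh⟩

lemma Beurling.isSchwartz (f : Beurling α d) : IsSchwartz f.1 := (f.mem_step one_pos).1

lemma Beurling.rapidSeq (hα : 0 < α) (f : Beurling α d) : RapidSeq (lagCoeff f.1) :=
  rapidSeq_of_step hα one_pos (f.mem_step one_pos)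

/-- Laguerre coefficients on the Beurling space. -/
def beurlingCoeff (α : ℝ) (d : ℕ) : Beurling α d →ₗ[ℂ] (Fin d → ℕ) → ℂ where
  toFun f := lagCoeff f.1
  map_add' f g := f.isSchwartz.lagCoeff_add g.isSchwartz
  map_smul' c f := lagCoeff_smul c f.1

lemma Beurling.summable (hα : 0 < α) (f : Beurling α d) {s : ℝ} (hs : 0 < s) :
    Summable fun n => ‖lagCoeff f.1 n‖ * wt (1 / α) s n := by
  -- The factor `2` compensates for the lost half of the exponent, the `+ 1` for the passage from
  -- sup to summability.
  obtain ⟨h, hh, e⟩ := exists_step hα (s := 2 * (s + 1)) (by linarith)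
  have hf := f.mem_step hh
  refine summable_of_norm_le (s := s + 1) (C := 2 ^ α * (eta α h f.1).toReal) (one_div_pos.2 hα)
    (by linarith) fun n => ?_
  have := hf.1.norm_lagCoeff_mul_wt_le hα hh hf.2 n
  rwa [e, mul_div_cancel_left₀ _ two_ne_zero] at this

/-- The norms increase as `h` decreases, so the family is directed and a single step suffices. -/
lemma mem_nhds_zero_beurling (U : Set (Beurling α d)) : U ∈ 𝓝 (0 : Beurling α d) ↔
    ∃ h : Ioi (0 : ℝ), ∃ ε > 0, {f : Beurling α d | ‖beurlingToStep α d h f‖ < ε} ⊆ U := by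
  have hn : 𝓝 (0 : Beurling α d) =
      ⨅ h : Ioi (0 : ℝ), comap (beurlingToStep α d h) (𝓝 0) := by
    refine nhds_iInf.trans (iInf_congr fun h => ?_)
    rw [nhds_induced, map_zero]
  have hdir : Directed (· ≥ ·) fun h : Ioi (0 : ℝ) => comap (beurlingToStep α d h) (𝓝 0) := by
    have mono : ∀ h k : Ioi (0 : ℝ), h ≤ k →
        comap (beurlingToStep α d h) (𝓝 0) ≤ comap (beurlingToStep α d k) (𝓝 0) := by
      intro h k hhk
      refine (((Metric.nhds_basis_ball).comap _).le_basis_iff ((Metric.nhds_basis_ball).comap _)).2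
        fun ε hε => ⟨ε, hε, fun f hf => ?_⟩
      rw [mem_preimage, mem_ball_zero_iff] at hf ⊢
      exact (ENNReal.toReal_mono (beurlingToStep α d h f).2.2.ne
        (eta_anti α h.2 hhk f.1)).trans_lt hf
    intro h k
    rcases le_total h k with hk | hk
    · exact ⟨h, le_rfl, mono h k hk⟩
    · exact ⟨k, mono k h hk, le_rfl⟩
  have : Nonempty (Ioi (0 : ℝ)) := ⟨⟨1, mem_Ioi.2 one_pos⟩⟩
  rw [hn, mem_iInf_of_directed hdir]
  refine exists_congr fun h => ?_
  rw [((Metric.nhds_basis_ball).comap _).mem_iff]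
  refine exists_congr fun ε => and_congr_right fun _ => ?_
  rw [show beurlingToStep α d h ⁻¹' Metric.ball 0 ε =
    {f : Beurling α d | ‖beurlingToStep α d h f‖ < ε} by ext f; simp]

/-- The step norms and the weighted `ℓ¹`-seminorms dominate each other after a change of parameter,
by `norm_stepLagSum_le` in one direction and `StepSpace.norm_lagCoeff_mul_wt_le` in the other. -/
lemma isKothe_beurling (hα : 0 < α) (d : ℕ) :
    IsKothe (beurlingCoeff α d) (beurlingWeights (1 / α) d) where
  topGroup := topologicalAddGroup_iInf fun h => topologicalAddGroup_induced _
  nonneg := by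
    rintro _ ⟨s, hs, rfl⟩ n
    exact (wt_pos _ _ n).le
  pos n := ⟨_, ⟨1, one_pos, rfl⟩, wt_pos _ _ n⟩
  inj f g h := Subtype.ext (f.isSchwartz.eq_of_lagCoeff g.isSchwartz h)
  exists_iff a := by
    constructor
    · rintro ⟨f, rfl⟩ _ ⟨s, hs, rfl⟩
      exact f.summable hα hs
    · intro hs
      have hs' : ∀ h : ℝ, 0 < h → Summable fun n => ‖a n‖ * wt (1 / α) (α * h ^ (-(1 / α))) n :=
        fun h hh => hs _ ⟨_, by positivity, rfl⟩
      exact ⟨⟨lagSum a, (Submodule.mem_iInf _).2 fun h => lagSum_mem_step hα h.2 (hs' h h.2)⟩,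
        lagCoeff_lagSum (rapidSeq_of_summable_step hα one_pos (hs' 1 one_pos))⟩
  mem_nhds_zero U := by
    have hβ := one_div_pos.2 hα
    rw [mem_nhds_zero_beurling]
    constructor
    · rintro ⟨h, ε, hε, hU⟩
      have hh : (0 : ℝ) < h := h.2
      refine ⟨wt (1 / α) (α * (h : ℝ) ^ (-(1 / α))), ⟨_, by positivity, rfl⟩, ε, hε,
        fun f hf => hU ?_⟩
      have hs : 0 < α * (h : ℝ) ^ (-(1 / α)) := by positivity
      have hsum := f.summable hα hs
      have e2 : beurlingToStep α d h f = stepLagSum hα hh hsum :=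
        Subtype.ext (f.isSchwartz.lagSum_lagCoeff (f.rapidSeq hα)).symm
      rw [mem_ofPred_eq, e2]
      exact (norm_stepLagSum_le hα hh hsum).trans_lt hf
    · rintro ⟨_, ⟨s, hs, rfl⟩, ε, hε, hU⟩
      obtain ⟨h, hh, e⟩ := exists_step hα (s := 2 * (s + 1)) (by linarith)
      set A := 2 ^ α * ∑' n : Fin d → ℕ, wt (1 / α) (-1) n
      have hA : 0 ≤ A := mul_nonneg (by positivity) (tsum_nonneg fun n => (wt_pos _ _ n).le)
      refine ⟨⟨h, hh⟩, ε / (A + 1), by positivity, fun f hf => hU ?_⟩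
      rw [mem_ofPred_eq] at hf ⊢
      set g := beurlingToStep α d ⟨h, hh⟩ f
      have h1 : ∑' n, ‖lagCoeff f.1 n‖ * wt (1 / α) s n ≤ A * ‖g‖ := by
        refine (tsum_norm_mul_le (s := s + 1) (C := 2 ^ α * ‖g‖) hβ (by linarith)
          fun n => ?_).trans_eq ?_
        · have := g.norm_lagCoeff_mul_wt_le hα hh n
          rwa [e, mul_div_cancel_left₀ _ two_ne_zero] at this
        · rw [sub_add_cancel_left]
          ring
      refine h1.trans_lt ?_
      calc A * ‖g‖ ≤ (A + 1) * ‖g‖ := by gcongr; linarith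
        _ < (A + 1) * (ε / (A + 1)) := by gcongr
        _ = ε := mul_div_cancel₀ _ (by positivity)

/-! ### The Roumieu space -/

lemma Roumieu.isSchwartz (f : Roumieu α d) : IsSchwartz f.1 := f.2.choose_spec.2.1

lemma Roumieu.rapidSeq (hα : 0 < α) (f : Roumieu α d) : RapidSeq (lagCoeff f.1) :=
  let ⟨_, hh, hf⟩ := f.2
  rapidSeq_of_step hα hh hf

/-- Laguerre coefficients on the Roumieu space. -/
def roumieuCoeff (α : ℝ) (d : ℕ) : Roumieu α d →ₗ[ℂ] (Fin d → ℕ) → ℂ where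
  toFun f := lagCoeff f.1
  map_add' f g := f.isSchwartz.lagCoeff_add g.isSchwartz
  map_smul' c f := lagCoeff_smul c f.1

lemma roumieuCoeff_injective : Function.Injective (roumieuCoeff α d) := fun f g h =>
  Subtype.ext (f.isSchwartz.eq_of_lagCoeff g.isSchwartz h)

lemma exists_roumieuCoeff_iff (hα : 0 < α) (a : (Fin d → ℕ) → ℂ) :
    (∃ f, roumieuCoeff α d f = a) ↔
      ∀ v ∈ roumieuWeights (1 / α) d, Summable fun n => ‖a n‖ * v n := by
  have hβ := one_div_pos.2 hα
  constructor
  · rintro ⟨f, rfl⟩ v hv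
    obtain ⟨h, hh, hf⟩ := f.2
    refine summable_mul_roumieu (s := α * h ^ (-(1 / α)) / 2)
      (C := 2 ^ α * (eta α h f.1).toReal) hβ (fun n => norm_nonneg _) (by positivity) (fun n => ?_) hv
    exact mul_wt_le_iff.1 (hf.1.norm_lagCoeff_mul_wt_le hα hh hf.2 n)
  · intro h
    obtain ⟨s, hs, C, -, hC⟩ := exists_le_of_summable_roumieu h
    -- Half of the decay rate fixes the step; the other half pays for summability.
    obtain ⟨k, hk, e⟩ := exists_step hα (half_pos hs)
    have hsum : Summable fun n => ‖a n‖ * wt (1 / α) (α * k ^ (-(1 / α))) n := by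
      rw [e]
      exact summable_of_norm_le (C := C) hβ (half_lt_self hs) fun n => mul_wt_le_iff.2 (hC n)
    exact ⟨stepToRoumieu α d ⟨k, hk⟩ (stepLagSum hα hk hsum), lagCoeff_stepLagSum hα hk hsum⟩

/-- The weighted `ℓ¹`-seminorms on the Roumieu space. -/
def roumieuSeminorm (hα : 0 < α) {v : (Fin d → ℕ) → ℝ} (hv : v ∈ roumieuWeights (1 / α) d) :
    Seminorm ℂ (Roumieu α d) :=
  have hs := fun f => (exists_roumieuCoeff_iff hα (roumieuCoeff α d f)).1 ⟨f, rfl⟩ v hv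
  Seminorm.of (fun f => ∑' n, ‖roumieuCoeff α d f n‖ * v n)
    (fun f g => by
      rw [← (hs f).tsum_add (hs g)]
      refine (hs _).tsum_le_tsum (fun n => ?_) ((hs f).add (hs g))
      rw [← add_mul, map_add, Pi.add_apply]
      exact mul_le_mul_of_nonneg_right (norm_add_le _ _) (hv.1 n))
    (fun c f => by
      rw [← tsum_mul_left]
      simp [mul_assoc])

lemma roumieuSeminorm_apply (hα : 0 < α) {v : (Fin d → ℕ) → ℝ}
    (hv : v ∈ roumieuWeights (1 / α) d) (f : Roumieu α d) :
    roumieuSeminorm hα hv f = ∑' n, ‖roumieuCoeff α d f n‖ * v n := rfl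

lemma roumieuSeminorm_step_le (hα : 0 < α) {v : (Fin d → ℕ) → ℝ}
    (hv : v ∈ roumieuWeights (1 / α) d) (h : Ioi (0 : ℝ)) : ∃ C : ℝ, ∀ f : StepSpace α h d,
      roumieuSeminorm hα hv (stepToRoumieu α d h f) ≤ C * ‖f‖ := by
  have hβ := one_div_pos.2 hα
  have hh : (0 : ℝ) < h := h.2
  set s := α * (h : ℝ) ^ (-(1 / α)) / 2
  have hs : 0 < s := by positivity
  obtain ⟨D, hD⟩ := hv.2 (s / 2) (half_pos hs)
  have hD0 : 0 ≤ D := nonneg_of_mul_nonneg_left ((hv.1 0).trans (hD 0)) (wt_pos _ _ _)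
  refine ⟨D * (2 ^ α * ∑' n : Fin d → ℕ, wt (1 / α) (s / 2 - s) n), fun f => ?_⟩
  have h1 := f.norm_lagCoeff_mul_wt_le hα hh
  rw [roumieuSeminorm_apply]
  calc ∑' n, ‖lagCoeff f.1 n‖ * v n ≤ ∑' n, D * (‖lagCoeff f.1 n‖ * wt (1 / α) (s / 2) n) := by
        refine Summable.tsum_le_tsum (fun n => ?_)
          ((exists_roumieuCoeff_iff hα _).1 ⟨stepToRoumieu α d h f, rfl⟩ v hv)
          ((summable_of_norm_le hβ (half_lt_self hs) h1).mul_left D)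
        calc ‖lagCoeff f.1 n‖ * v n ≤ ‖lagCoeff f.1 n‖ * (D * wt (1 / α) (s / 2) n) :=
              mul_le_mul_of_nonneg_left (hD n) (norm_nonneg _)
          _ = _ := by ring
    _ = D * ∑' n, ‖lagCoeff f.1 n‖ * wt (1 / α) (s / 2) n := tsum_mul_left
    _ ≤ D * (2 ^ α * ‖f‖ * ∑' n : Fin d → ℕ, wt (1 / α) (s / 2 - s) n) :=
        mul_le_mul_of_nonneg_left (tsum_norm_mul_le hβ (half_lt_self hs) h1) hD0
    _ = _ := by ring

/-- The locally convex topology defined by a single seminorm. -/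
lemma exists_isLCTopology {V : Type*} [AddCommGroup V] [Module ℂ V] (q : Seminorm ℂ V) :
    ∃ t : TopologicalSpace V, IsLCTopology V t ∧ (∀ ε > 0, {x | q x < ε} ∈ @nhds V t 0) ∧
      ∀ {E : Type} [NormedAddCommGroup E] [Module ℂ E] (g : E →ₗ[ℂ] V) (C : ℝ),
        (∀ x, q (g x) ≤ C * ‖x‖) → @Continuous E V _ t g := by
  set p : SeminormFamily ℂ V Unit := fun _ => q
  let t : TopologicalSpace V := p.moduleFilterBasis.topology
  have hp : WithSeminorms p := ⟨rfl⟩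
  have hg : IsTopologicalAddGroup V := hp.topologicalAddGroup
  refine ⟨t, ⟨hg, hp.continuousSMul, hp.toLocallyConvexSpace⟩, fun ε hε => ?_, fun {E} _ _ g C hC => ?_⟩
  · refine (hp.mem_nhds_iff 0 _).2 ⟨{()}, ε, hε, fun x hx => ?_⟩
    simpa [Seminorm.mem_ball, p] using hx
  · refine continuous_of_continuousAt_zero g ?_
    rw [ContinuousAt, map_zero, hp.tendsto_nhds]
    intro _ δ hδ
    have h1 : Tendsto (fun x : E => C * ‖x‖) (𝓝 0) (𝓝 0) := by
      simpa using (tendsto_norm_zero (E := E)).const_mul C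
    filter_upwards [h1.eventually (gt_mem_nhds hδ)] with x hx
    rw [sub_zero]
    exact (hC x).trans_lt hx

/-- The topology of this one seminorm is among the locally convex topologies that make all step
inclusions continuous, and the inductive topology is the finest of these. -/
lemma mem_nhds_zero_of_roumieuSeminorm (hα : 0 < α) {v : (Fin d → ℕ) → ℝ}
    (hv : v ∈ roumieuWeights (1 / α) d) {ε : ℝ} (hε : 0 < ε) :
    {f | roumieuSeminorm hα hv f < ε} ∈ 𝓝 (0 : Roumieu α d) := by
  obtain ⟨t, ht, hn, hc⟩ := exists_isLCTopology (roumieuSeminorm hα hv)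
  have hle : instTopologicalSpaceRoumieu α d ≤ t := by
    refine sInf_le (α := TopologicalSpace (Roumieu α d)) ?_
    refine ⟨ht, fun h => ?_⟩
    obtain ⟨C, hC⟩ := roumieuSeminorm_step_le hα hv h
    exact hc _ C hC
  exact _root_.nhds_mono hle (hn ε hε)

/-- A continuous seminorm on the Roumieu space is dominated by a weighted `ℓ¹`-seminorm. -/
lemma exists_weight_of_continuous (hα : 0 < α) {p : Seminorm ℂ (Roumieu α d)} (hp : Continuous p) :
    ∃ v ∈ roumieuWeights (1 / α) d, ∀ f, p f ≤ ∑' n, ‖roumieuCoeff α d f n‖ * v n := by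
  classical
  have hβ := one_div_pos.2 hα
  have hcont : ∀ h : Ioi (0 : ℝ), Continuous (stepToRoumieu α d h) := fun h =>
    continuous_sInf_rng.2 fun t ht => ht.2 h
  have hstep : ∀ s > 0, ∃ C : ℝ, 0 < C ∧ ∀ f : Roumieu α d,
      (Summable fun n => ‖roumieuCoeff α d f n‖ * wt (1 / α) s n) →
        p f ≤ C * ∑' n, ‖roumieuCoeff α d f n‖ * wt (1 / α) s n := by
    intro s hs
    obtain ⟨h, hh, rfl⟩ := exists_step hα hs
    obtain ⟨C, hC, hb⟩ := Seminorm.bound_of_continuous_normedSpace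
      (p.comp (stepToRoumieu α d ⟨h, hh⟩)) (hp.comp (hcont ⟨h, hh⟩))
    refine ⟨C, hC, fun f hf => ?_⟩
    have e1 : f = stepToRoumieu α d ⟨h, hh⟩ (stepLagSum hα hh hf) :=
      roumieuCoeff_injective (lagCoeff_stepLagSum hα hh hf).symm
    conv_lhs => rw [e1]
    exact (hb _).trans (mul_le_mul_of_nonneg_left (norm_stepLagSum_le hα hh hf) hC.le)
  have hone : ∀ n : Fin d → ℕ, ∃ e, roumieuCoeff α d e = Set.indicator {n} 1 := fun n => by
    refine (exists_roumieuCoeff_iff hα _).2 fun v _ => ?_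
    refine summable_of_ne_finset_zero (s := {n}) fun j hj => ?_
    rw [Set.indicator_of_notMem (by simpa using hj)]
    simp
  choose e he using hone
  have hpe : ∀ s > 0, ∃ C : ℝ, ∀ n, p (e n) ≤ C * wt (1 / α) s n := by
    intro s hs
    obtain ⟨C, -, hC⟩ := hstep s hs
    refine ⟨C, fun n => ?_⟩
    have hz : ∀ j ∉ ({n} : Finset (Fin d → ℕ)),
        ‖roumieuCoeff α d (e n) j‖ * wt (1 / α) s j = 0 := fun j hj => by
      rw [he, Set.indicator_of_notMem (by simpa using hj)]
      simp
    have := hC (e n) (summable_of_ne_finset_zero hz)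
    rw [tsum_eq_sum hz] at this
    simpa [he] using this
  -- The weight is the seminorm evaluated at the coordinate vectors; continuity on each step is
  -- exactly the condition for it to be a Roumieu weight.
  have hv : (fun n => p (e n)) ∈ roumieuWeights (1 / α) d := ⟨fun n => apply_nonneg _ _, hpe⟩
  refine ⟨_, hv, fun f => ?_⟩
  have hsum := (exists_roumieuCoeff_iff hα (roumieuCoeff α d f)).1 ⟨f, rfl⟩ _ hv
  obtain ⟨h, hh, hf⟩ := f.2
  set a := roumieuCoeff α d f with ha
  set s := α * h ^ (-(1 / α)) / 2 with hs_def
  have hs : 0 < s := by positivity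
  have hsum1 : Summable fun n => ‖a n‖ * wt (1 / α) (s / 2) n :=
    summable_of_norm_le hβ (half_lt_self hs) (hf.1.norm_lagCoeff_mul_wt_le hα hh hf.2)
  obtain ⟨C, -, hC⟩ := hstep (s / 2) (half_pos hs)
  set w : (Fin d → ℕ) → ℝ := wt (1 / α) (s / 2)
  -- The remainder of the expansion is measured in a step where it tends to zero, so the constant
  -- `C` of that step disappears in the limit.
  have hfin : ∀ S : Finset (Fin d → ℕ), p f ≤
      C * ∑' n : ↥((↑S : Set (Fin d → ℕ))ᶜ), ‖a n‖ * w n + ∑' n, ‖a n‖ * p (e n) := by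
    intro S
    set g := f - ∑ n ∈ S, a n • e n
    have hg : ∀ n, ‖roumieuCoeff α d g n‖ * w n =
        Set.indicator (↑S : Set (Fin d → ℕ))ᶜ (fun n => ‖a n‖ * w n) n := by
      intro n
      have h1 : roumieuCoeff α d g n = a n - ∑ m ∈ S, if n = m then a m else 0 := by
        rw [map_sub, map_sum, Pi.sub_apply, Finset.sum_apply]
        congr 1
        refine Finset.sum_congr rfl fun m _ => ?_
        rw [map_smul, he, Pi.smul_apply, Set.indicator_apply]
        simp
      rw [h1, Finset.sum_ite_eq]
      by_cases hn : n ∈ S <;> simp [hn]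
    have h2 : p g ≤ C * ∑' n : ↥((↑S : Set (Fin d → ℕ))ᶜ), ‖a n‖ * w n := by
      have := hC g ((summable_congr hg).2 (hsum1.indicator _))
      refine this.trans_eq ?_
      rw [tsum_subtype ((↑S : Set (Fin d → ℕ))ᶜ) fun n => ‖a n‖ * w n]
      rw [tsum_congr hg]
    have h3 : p (∑ n ∈ S, a n • e n) ≤ ∑' n, ‖a n‖ * p (e n) := by
      refine (Finset.le_sum_of_subadditive p (map_zero p).le (map_add_le_add p) S _).trans ?_
      simp only [map_smul_eq_mul]
      exact hsum.sum_le_tsum S fun n _ => mul_nonneg (norm_nonneg _) (apply_nonneg _ _)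
    calc p f = p (g + ∑ n ∈ S, a n • e n) := by rw [sub_add_cancel]
      _ ≤ p g + p (∑ n ∈ S, a n • e n) := map_add_le_add p _ _
      _ ≤ _ := add_le_add h2 h3
  have hlim := ((tendsto_tsum_compl_atTop_zero fun n => ‖a n‖ * w n).const_mul C).add_const
    (∑' n, ‖a n‖ * p (e n))
  rw [mul_zero, zero_add] at hlim
  exact ge_of_tendsto' hlim hfin

lemma isKothe_roumieu (hα : 0 < α) (d : ℕ) :
    IsKothe (roumieuCoeff α d) (roumieuWeights (1 / α) d) where
  topGroup := (isLCTopology_finestLC _ _).1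
  nonneg v hv := hv.1
  pos n := by
    refine ⟨fun _ => 1, ⟨fun _ => zero_le_one, fun s hs => ⟨1, fun m => ?_⟩⟩, one_pos⟩
    rw [one_mul]
    exact (wt_zero (1 / α) m).ge.trans (wt_mono _ hs.le m)
  inj := roumieuCoeff_injective
  exists_iff := exists_roumieuCoeff_iff hα
  mem_nhds_zero U := by
    constructor
    · intro hU
      have h1 := isLCTopology_finestLC (Roumieu α d) fun t =>
        ∀ h : Ioi (0 : ℝ), @Continuous (StepSpace α h d) (Roumieu α d) _ t (stepToRoumieu α d h)
      have : IsTopologicalAddGroup (Roumieu α d) := h1.1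
      have : ContinuousSMul ℂ (Roumieu α d) := h1.2.1
      have : LocallyConvexSpace ℝ (Roumieu α d) := h1.2.2
      obtain ⟨p, hp, hpU⟩ := exists_continuous_seminorm hU
      obtain ⟨v, hv, hb⟩ := exists_weight_of_continuous hα hp
      exact ⟨v, hv, 1, one_pos, fun f hf => hpU ((hb f).trans_lt hf)⟩
    · rintro ⟨v, hv, ε, hε, hU⟩
      exact mem_of_superset (mem_nhds_zero_of_roumieuSeminorm hα hv hε) hU

end Spaces

end POrthant

end

/-! ### The kernel theorems -/

theorem mainTheorem8 (α : ℝ) (hα : 0 < α) (d₁ d₂ : ℕ) (hd₁ : 0 < d₁) (hd₂ : 0 < d₂) :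
    (∃ (Φ : CTensor (Roumieu α d₁) (Roumieu α d₂) ≃L[ℂ] Roumieu α (d₁ + d₂))
       (Ψ : CTensor (StrongDual ℂ (Roumieu α d₁)) (StrongDual ℂ (Roumieu α d₂)) ≃L[ℂ]
          StrongDual ℂ (Roumieu α (d₁ + d₂))),
      (∀ (f : Roumieu α d₁) (g : Roumieu α d₂) (x : Fin (d₁ + d₂) → ℝ),
        Φ (ctmul f g) x =
          f (fun i => x (Fin.castAdd d₂ i)) * g (fun j => x (Fin.natAdd d₁ j))) ∧
      (∀ (u : StrongDual ℂ (Roumieu α d₁)) (v : StrongDual ℂ (Roumieu α d₂))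
        (f : Roumieu α d₁) (g : Roumieu α d₂),
        Ψ (ctmul u v) (Φ (ctmul f g)) = u f * v g)) ∧
    (∃ (Φ : CTensor (Beurling α d₁) (Beurling α d₂) ≃L[ℂ] Beurling α (d₁ + d₂))
       (Ψ : CTensor (StrongDual ℂ (Beurling α d₁)) (StrongDual ℂ (Beurling α d₂)) ≃L[ℂ]
          StrongDual ℂ (Beurling α (d₁ + d₂))),
      (∀ (f : Beurling α d₁) (g : Beurling α d₂) (x : Fin (d₁ + d₂) → ℝ),
        Φ (ctmul f g) x =
          f (fun i => x (Fin.castAdd d₂ i)) * g (fun j => x (Fin.natAdd d₁ j))) ∧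
      (∀ (u : StrongDual ℂ (Beurling α d₁)) (v : StrongDual ℂ (Beurling α d₂))
        (f : Beurling α d₁) (g : Beurling α d₂),
        Ψ (ctmul u v) (Φ (ctmul f g)) = u f * v g)) := by
  have hβ : 0 < 1 / α := one_div_pos.2 hα
  refine ⟨?_, ?_⟩
  · obtain ⟨Φ, Ψ, h1, h2⟩ := (isKothe_roumieu hα d₁).exists_tensorEquiv_and_dual
      (isKothe_roumieu hα d₂) (isKothe_roumieu hα (d₁ + d₂))
      (dominatedByProd_roumieu hβ d₁ d₂) (dominatesProd_roumieu hβ d₁ d₂)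
      (dominatedByProd_kotheDual_roumieu hβ d₁ d₂)
      (isNuclearWeights_roumieu hβ d₁) (isNuclearWeights_roumieu hβ d₂)
      (isNuclearWeights_roumieu hβ (d₁ + d₂))
      (isReflexiveWeights_roumieu hβ d₁) (isReflexiveWeights_roumieu hβ d₂)
      (isReflexiveWeights_roumieu hβ (d₁ + d₂))
    refine ⟨Φ, Ψ, fun f g x => ?_, h2⟩
    -- The abstract theorem only identifies the coefficients of the image; summing the Laguerre
    -- series turns this into the pointwise product.
    exact f.isSchwartz.apply_eq_mul g.isSchwartz (Φ (ctmul f g)).isSchwartz (f.rapidSeq hα)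
      (g.rapidSeq hα) ((Φ (ctmul f g)).rapidSeq hα) (fun m n => h1 f g m n) x
  · obtain ⟨Φ, Ψ, h1, h2⟩ := (isKothe_beurling hα d₁).exists_tensorEquiv_and_dual
      (isKothe_beurling hα d₂) (isKothe_beurling hα (d₁ + d₂))
      (dominatedByProd_beurling hβ d₁ d₂) (dominatesProd_beurling hβ d₁ d₂)
      (dominatedByProd_kotheDual_beurling hβ d₁ d₂)
      (isNuclearWeights_beurling hβ d₁) (isNuclearWeights_beurling hβ d₂)
      (isNuclearWeights_beurling hβ (d₁ + d₂))
      (isReflexiveWeights_beurling hβ d₁) (isReflexiveWeights_beurling hβ d₂)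
      (isReflexiveWeights_beurling hβ (d₁ + d₂))
    refine ⟨Φ, Ψ, fun f g x => ?_, h2⟩
    exact f.isSchwartz.apply_eq_mul g.isSchwartz (Φ (ctmul f g)).isSchwartz (f.rapidSeq hα)
      (g.rapidSeq hα) ((Φ (ctmul f g)).rapidSeq hα) (fun m n => h1 f g m n) x
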